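/- Let $M$ be a smooth (Hausdorff, paracompact, finite-dimensional) manifold, and equip $TM\oplus T^*M$ with the pairing $\langle (u,\alpha),(v,\beta)\rangle=\beta(u)+\alpha(v)$. A *Dirac structure* on $M$ is a smooth vector subbundle $\mathsf D\subset TM\oplus T^*M$ each of whose fibres equals its own orthogonal. It is *integrable* if its space $\Gamma(\mathsf D)$ of smooth local sections is closed under the Courant bracket $$[(X,\alpha),(Y,\beta)]=\bigl([X,Y],\ \pounds_X\beta-\pounds_Y\alpha+\tfrac12\,\mathbf d(\alpha(Y)-\beta(X))\bigr).$$ Let $\mathsf D$ be a Dirac structure on $M$, and let a Lie group $G$ act smoothly, properly and canonically on $(M,\mathsf D)$, where *canonically* means that $(\Phi_g^*X,\Phi_g^*\alpha)\in\Gamma(\mathsf D)$ for all $g\in G$ and $(X,\alpha)\in\Gamma(\mathsf D)$, with $\Phi_g(m)=g\cdot m$. Let $H\subseteq G$ be a subgroup, let $M_H=\{m\in M\mid G_m=H\}$ be the set of points whose isotropy subgroup is exactly $H$, and let $Q$ be a connected component of $M_H$. Then $Q$ is an embedded submanifold of $M$. Let $\iota_Q:Q\hookrightarrow M$ be the inclusion,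 and for $q\in Q$ put $$\mathsf D_Q(q)=\bigl\{(\tilde v,\tilde\alpha)\in T_qQ\times T_q^*Q\ \big|\ \exists\,(v,\alpha)\in\mathsf D(q):\ T_q\iota_Q\,\tilde v=v,\ (T_q\iota_Q)^*\alpha=\tilde\alpha\bigr\}.$$ Then $\mathsf D_Q$ (the backward Dirac image of $\mathsf D$ under $\iota_Q$) is a Dirac structure on $Q$. If $\mathsf D$ is integrable, then so is $\mathsf D_Q$. -/

import Mathlib

open scoped Manifold ContDiff Topology

noncomputable section

namespace DiracGeometry

open Bundle VectorField

section Manifolds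

variable {E : Type*} [NormedAddCommGroup E] [NormedSpace ℝ E]
  {M : Type*} [TopologicalSpace M] [ChartedSpace E M]

variable (E) in
/-- The fibre `T_x M ⊕ T_x^* M` of the Pontryagin bundle of `M` (a manifold modelled on `E`)
at the point `x`. -/
abbrev PontryaginFiber (x : M) : Type _ :=
  TangentSpace 𝓘(ℝ, E) x × (TangentSpace 𝓘(ℝ, E) x →L[ℝ] ℝ)

variable (E M) in
/-- A (not necessarily continuous) section `(X, α)` of the Pontryagin bundle. A local section with
open domain `U` is represented by any such `σ`; only its values on `U` are ever used. -/
abbrev PontryaginSection : Type _ := ∀ x : M, PontryaginFiber E x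

variable (E M) in
/-- A generalized distribution in the Pontryagin bundle: a linear subspace of each fibre. -/
abbrev Distribution : Type _ := ∀ x : M, Submodule ℝ (PontryaginFiber E x)

/-- The vector field `X` is smooth on `U`. -/
def IsSmoothVectorFieldOn [IsManifold 𝓘(ℝ, E) ∞ M]
    (X : ∀ x : M, TangentSpace 𝓘(ℝ, E) x) (U : Set M) : Prop :=
  ContMDiffOn 𝓘(ℝ, E) 𝓘(ℝ, E).tangent ∞ (fun x ↦ (⟨x, X x⟩ : TangentBundle 𝓘(ℝ, E) M)) U

/-- The one-form `α` is smooth on `U`, as a section of the bundle `Hom(TM, ℝ)`. -/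
def IsSmoothOneFormOn [IsManifold 𝓘(ℝ, E) ∞ M]
    (α : ∀ x : M, TangentSpace 𝓘(ℝ, E) x →L[ℝ] ℝ) (U : Set M) : Prop :=
  ContMDiffOn 𝓘(ℝ, E) (𝓘(ℝ, E).prod 𝓘(ℝ, E →L[ℝ] ℝ)) ∞
    (fun x ↦ TotalSpace.mk' (E →L[ℝ] ℝ)
      (E := fun x : M ↦ (TangentSpace 𝓘(ℝ, E) x →L[ℝ] Bundle.Trivial M ℝ x)) x (α x)) U

/-- The section `(X, α)` of the Pontryagin bundle is smooth on `U`. -/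
def IsSmoothSectionOn [IsManifold 𝓘(ℝ, E) ∞ M] (σ : PontryaginSection E M) (U : Set M) : Prop :=
  IsSmoothVectorFieldOn (fun x ↦ (σ x).1) U ∧ IsSmoothOneFormOn (fun x ↦ (σ x).2) U

/-- `σ`, with open domain `U`, belongs to `Γ(D)`: it is smooth and takes its values in `D`. -/
def IsLocalSection [IsManifold 𝓘(ℝ, E) ∞ M] (D : Distribution E M) (U : Set M)
    (σ : PontryaginSection E M) : Prop :=
  IsOpen U ∧ IsSmoothSectionOn σ U ∧ ∀ x ∈ U, σ x ∈ D x

/-- `D` is a smooth vector subbundle of the Pontryagin bundle: around every point it has a smooth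
local frame. -/
def IsSmoothSubbundle [IsManifold 𝓘(ℝ, E) ∞ M] (D : Distribution E M) : Prop :=
  ∀ x : M, ∃ U : Set M, IsOpen U ∧ x ∈ U ∧ ∃ (k : ℕ) (s : Fin k → PontryaginSection E M),
    (∀ i, IsSmoothSectionOn (s i) U) ∧
      ∀ y ∈ U, LinearIndependent ℝ (fun i ↦ s i y) ∧
        Submodule.span ℝ (Set.range fun i ↦ s i y) = D y

/-- The symmetric pairing `⟨(u, α), (v, β)⟩ = β(u) + α(v)` on a fibre of the Pontryagin bundle. -/
def pairing {x : M} (p q : PontryaginFiber E x) : ℝ := q.2 p.1 + p.2 q.1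

/-- Every fibre of `D` coincides with its orthogonal with respect to the pairing. -/
def IsLagrangian (D : Distribution E M) : Prop :=
  ∀ (x : M) (p : PontryaginFiber E x), p ∈ D x ↔ ∀ q ∈ D x, pairing p q = 0

/-- A Dirac structure: a Lagrangian smooth subbundle of the Pontryagin bundle. -/
structure IsDiracStructure [IsManifold 𝓘(ℝ, E) ∞ M] (D : Distribution E M) : Prop where
  isSmoothSubbundle : IsSmoothSubbundle D
  isLagrangian : IsLagrangian D

/-- The local expression of the one-form `α` in the preferred chart `φ` at `x`, that is, the
pull-back of `α` along `φ⁻¹`. -/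
def oneFormInChart (α : ∀ x : M, TangentSpace 𝓘(ℝ, E) x →L[ℝ] ℝ) (x : M) (y : E) : E →L[ℝ] ℝ :=
  (α ((extChartAt 𝓘(ℝ, E) x).symm y)).comp
    (mfderiv 𝓘(ℝ, E) 𝓘(ℝ, E) (extChartAt 𝓘(ℝ, E) x).symm y)

/-- The exterior derivative `dα` of a one-form at `x`. In a chart, where `a` is the local expression
of `α`, it is `dα(v, w) = (Da · v)(w) - (Da · w)(v)`. -/
def extDerivOneForm (α : ∀ x : M, TangentSpace 𝓘(ℝ, E) x →L[ℝ] ℝ) (x : M) :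
    TangentSpace 𝓘(ℝ, E) x →L[ℝ] TangentSpace 𝓘(ℝ, E) x →L[ℝ] ℝ :=
  let φ := extChartAt 𝓘(ℝ, E) x
  let A : E →L[ℝ] E →L[ℝ] ℝ := fderiv ℝ (oneFormInChart α x) (φ x)
  let T : E →L[ℝ] E := mfderiv 𝓘(ℝ, E) 𝓘(ℝ, E) φ x
  let B : E →L[ℝ] E →L[ℝ] ℝ := (A - A.flip).bilinearComp T T
  B

/-- The differential `df` of a real function, as a one-form. -/
def differential (f : M → ℝ) (x : M) : TangentSpace 𝓘(ℝ, E) x →L[ℝ] ℝ :=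
  mfderiv 𝓘(ℝ, E) 𝓘(ℝ, ℝ) f x

/-- The Lie derivative of the one-form `β` along the vector field `X`, by Cartan's formula
`£_X β = i_X dβ + d(β(X))`. -/
def lieDerivOneForm (X : ∀ x : M, TangentSpace 𝓘(ℝ, E) x)
    (β : ∀ x : M, TangentSpace 𝓘(ℝ, E) x →L[ℝ] ℝ) (x : M) : TangentSpace 𝓘(ℝ, E) x →L[ℝ] ℝ :=
  extDerivOneForm β x (X x) + differential (fun y ↦ β y (X y)) x

/-- The (skew-symmetric) Courant bracket
`[(X, α), (Y, β)] = ([X, Y], £_X β - £_Y α + (1/2) d(α(Y) - β(X)))`. -/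
def courantBracket (σ τ : PontryaginSection E M) : PontryaginSection E M := fun x ↦
  (mlieBracket 𝓘(ℝ, E) (fun y ↦ (σ y).1) (fun y ↦ (τ y).1) x,
    lieDerivOneForm (fun y ↦ (σ y).1) (fun y ↦ (τ y).2) x
      - lieDerivOneForm (fun y ↦ (τ y).1) (fun y ↦ (σ y).2) x
      + (1 / 2 : ℝ) • differential (fun y ↦ (σ y).2 (τ y).1 - (τ y).2 (σ y).1) x)

/-- `D` is integrable (closed): `Γ(D)` is closed under the Courant bracket. -/
def IsIntegrable [IsManifold 𝓘(ℝ, E) ∞ M] (D : Distribution E M) : Prop :=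
  ∀ (U : Set M) (σ τ : PontryaginSection E M), IsLocalSection D U σ → IsLocalSection D U τ →
    IsLocalSection D U (courantBracket σ τ)

/-- The pull-back `(φ^* X, φ^* α)` of a section of the Pontryagin bundle under a diffeomorphism
`φ` of `M`, where `(φ^* X)(x) = (T_x φ)⁻¹ X(φ x)` and `(φ^* α)(x) = α(φ x) ∘ T_x φ`. -/
def pullbackSection (φ : M → M) (σ : PontryaginSection E M) : PontryaginSection E M := fun x ↦
  (mpullback 𝓘(ℝ, E) 𝓘(ℝ, E) φ (fun y ↦ (σ y).1) x,
    ((σ (φ x)).2).comp (mfderiv 𝓘(ℝ, E) 𝓘(ℝ, E) φ x))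

/-- The group `G` acts canonically on `(M, D)`: for every `g`, the pull-back under
`Φ_g : x ↦ g • x` maps `Γ(D)` to `Γ(D)` (and the domain `U` of a section to `Φ_g⁻¹(U)`). -/
def IsCanonicalAction [IsManifold 𝓘(ℝ, E) ∞ M] (G : Type*) [Group G] [MulAction G M]
    (D : Distribution E M) : Prop :=
  ∀ (g : G) (U : Set M) (σ : PontryaginSection E M), IsLocalSection D U σ →
    IsLocalSection D ((fun x : M ↦ g • x) ⁻¹' U) (pullbackSection (fun x ↦ g • x) σ)

/-- The pull-back (backward image) of the distribution `D` on `M` under `f : N → M`: its fibre at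
`y` consists of the pairs `(v, β ∘ T_y f)` with `(T_y f v, β) ∈ D (f y)`. -/
def backwardImage {F : Type*} [NormedAddCommGroup F] [NormedSpace ℝ F]
    {N : Type*} [TopologicalSpace N] [ChartedSpace F N] (f : N → M) (D : Distribution E M) :
    Distribution F N := fun y ↦
  { carrier := {p | ∃ q ∈ D (f y), mfderiv 𝓘(ℝ, F) 𝓘(ℝ, E) f y p.1 = q.1 ∧
      p.2 = q.2.comp (mfderiv 𝓘(ℝ, F) 𝓘(ℝ, E) f y)}
    zero_mem' := ⟨0, zero_mem _, by simp, by simp⟩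
    add_mem' := by
      rintro p p' ⟨q, hq, h1, h2⟩ ⟨q', hq', h1', h2'⟩
      refine ⟨q + q', add_mem hq hq', ?_, ?_⟩
      · rw [Prod.fst_add, Prod.fst_add, map_add, h1, h1']
      · rw [Prod.snd_add, Prod.snd_add, h2, h2', ContinuousLinearMap.add_comp]
    smul_mem' := by
      rintro c p ⟨q, hq, h1, h2⟩
      refine ⟨c • q, Submodule.smul_mem _ c hq, ?_, ?_⟩
      · rw [Prod.smul_fst, Prod.smul_fst, map_smul, h1]
      · rw [Prod.smul_snd, Prod.smul_snd, h2, ContinuousLinearMap.smul_comp] }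

end Manifolds

/-- The isotropy type set `M_H`: the points whose isotropy subgroup is exactly `H`. -/
def isotropyType {G : Type*} [Group G] (M : Type*) [MulAction G M] (H : Subgroup G) : Set M :=
  {m | MulAction.stabilizer G m = H}

/-- `Q` is a connected component of the subset `S` of `M`, in the subspace topology. -/
def IsConnectedComponentOf {M : Type*} [TopologicalSpace M] (Q S : Set M) : Prop :=
  ∃ q ∈ S, Q = connectedComponentIn S q

end DiracGeometry

end

/-! Fix a point `m` of `Q`. Properness makes the isotropy group `H = G_m` compact, so its action
near `m` can be linearized by averaging a chart over Haar measure: `e (h • x) = ρ h (e x)`. The mean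
`P` of the operators `ρ h` is a projection onto the vectors fixed by `H`. Near `m` no isotropy group
properly contains `G_m` (`eventually_stabilizer_eq`), so in this chart the points of isotropy `H`
are exactly the fixed vectors of `P` (`exists_slice_chart`). Thus `M_H` is locally a linear
subspace. Its dimension is locally constant, hence constant on the connected set `Q`, which is
therefore an embedded submanifold.

The same chart gives a smooth local retraction `r = e⁻¹ ∘ P ∘ e` onto `Q`. At a point `q` of `Q` the
tangent map `T` of `r`, viewed as a map into `M`, is the mean of the tangent maps of the `h` in `H`.
Since the action is canonical, each `h` carries `(v, α)` in `D(q)` to `(h⁻¹ v, α ∘ h)` in `D(q)`.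
Pairing this with any `(w, β)` in `D(q)` and integrating over `H` gives `β(T v) + α(T w) = 0`. So
`(T v, α ∘ T)` is orthogonal to `D(q)`, hence lies in it (`mem_of_stabilizer_projection`).

This invariance carries the rest. Linear algebra turns it into the Lagrangian property of the
backward image, and shows that the backward image is also the image of `D(q)` under `(T r, (T
ι)^*)`. A local frame of `D` therefore pushes down to smooth spanning sections, and the rank is
constant because Lagrangian fibres have half the dimension (`isDiracStructure_backwardImage`). For
integrability, a section of the backward image is lifted to `D` along `Q` and extended off `Q` by
means of `r` (`exists_related_localSection`). The Courant bracket respects relatedness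
(`courantBracket_of_related`), so closure under the bracket descends from `D`. -/

section

open MeasureTheory Set Filter

universe u

/-! ### Integrals over a compact space, smooth in a parameter -/

section PartialDerivative

variable {EG : Type*} [NormedAddCommGroup EG] [NormedSpace ℝ EG]
  {G : Type*} [TopologicalSpace G] [ChartedSpace EG G] [IsManifold 𝓘(ℝ, EG) ∞ G]
  {E : Type u} [NormedAddCommGroup E] [NormedSpace ℝ E]
  {E' : Type u} [NormedAddCommGroup E'] [NormedSpace ℝ E']

theorem contMDiffOn_partial_fderiv {W : Set (G × E)} (hW : IsOpen W) {F : G × E → E'}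
    (hF : ContMDiffOn (𝓘(ℝ, EG).prod 𝓘(ℝ, E)) 𝓘(ℝ, E') ∞ F W) :
    ContMDiffOn (𝓘(ℝ, EG).prod 𝓘(ℝ, E)) 𝓘(ℝ, E →L[ℝ] E') ∞
      (fun p ↦ fderiv ℝ (fun z ↦ F (p.1, z)) p.2) W := by
  intro p hp
  have hF' : ContMDiffAt (𝓘(ℝ, EG).prod 𝓘(ℝ, E)) 𝓘(ℝ, E') ∞ F p := (hF p hp).contMDiffAt (hW.mem_nhds hp)
  have h2 : ContMDiffAt ((𝓘(ℝ, EG).prod 𝓘(ℝ, E)).prod 𝓘(ℝ, E)) 𝓘(ℝ, E') ∞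
      (Function.uncurry fun (q : G × E) (z : E) ↦ F (q.1, z)) (p, p.2) := by
    have : ContMDiffAt ((𝓘(ℝ, EG).prod 𝓘(ℝ, E)).prod 𝓘(ℝ, E)) (𝓘(ℝ, EG).prod 𝓘(ℝ, E)) ∞
      (fun q : (G × E) × E ↦ (q.1.1, q.2)) (p, p.2) := by
      exact (contMDiff_fst.fst.prodMk contMDiff_snd).contMDiffAt
    exact ContMDiffAt.comp (p, p.2) (g := F) hF' this
  have := h2.mfderiv (m := ∞) (fun (q : G × E) (z : E) ↦ F (q.1, z)) (fun q ↦ q.2) contMDiffAt_snd (by simp)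
  refine (this.congr_of_eventuallyEq (Eventually.of_forall fun q ↦ ?_)).contMDiffWithinAt
  exact (congrFun ((inTangentCoordinates_model_space (I := 𝓘(ℝ, E)) (I' := 𝓘(ℝ, E')) _ _ _ p).trans
    (funext fun q ↦ mfderiv_eq_fderiv)) q).symm

omit [IsManifold 𝓘(ℝ, EG) ∞ G] in
theorem hasFDerivAt_partial {W : Set (G × E)} (hW : IsOpen W) {F : G × E → E'}
    (hF : ContMDiffOn (𝓘(ℝ, EG).prod 𝓘(ℝ, E)) 𝓘(ℝ, E') ∞ F W) {p : G × E} (hp : p ∈ W) :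
    HasFDerivAt (fun z ↦ F (p.1, z)) (fderiv ℝ (fun z ↦ F (p.1, z)) p.2) p.2 := by
  have hF' : ContMDiffAt (𝓘(ℝ, EG).prod 𝓘(ℝ, E)) 𝓘(ℝ, E') ∞ F p := (hF p hp).contMDiffAt (hW.mem_nhds hp)
  have : ContMDiffAt 𝓘(ℝ, E) 𝓘(ℝ, E') ∞ (fun z ↦ F (p.1, z)) p.2 :=
    ContMDiffAt.comp p.2 (g := F) (f := fun z ↦ (p.1, z)) hF' (contMDiffAt_const.prodMk contMDiffAt_id)
  exact (this.contDiffAt.differentiableAt (by simp)).hasFDerivAt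

variable {K : Type*} [TopologicalSpace K] [CompactSpace K] [MeasurableSpace K] [BorelSpace K]
  (μ : Measure K) [IsFiniteMeasure μ] {c : K → G} (hc : Continuous c)

-- The tube lemma: the complement is the projection of a closed set along the compact factor `K`.
omit [MeasurableSpace K] [BorelSpace K] [ChartedSpace EG G] [NormedSpace ℝ E] in
include hc in
theorem isOpen_setOf_forall_mem {W : Set (G × E)} (hW : IsOpen W) :
    IsOpen {z : E | ∀ k, (c k, z) ∈ W} := by
  have : {z : E | ∀ k, (c k, z) ∈ W}ᶜ = Prod.snd '' ((fun p : K × E ↦ (c p.1, p.2)) ⁻¹' Wᶜ) := by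
    ext z; simp
  rw [← isClosed_compl_iff, this]
  exact isClosedMap_snd_of_compactSpace _ (hW.isClosed_compl.preimage (by fun_prop))

variable [FiniteDimensional ℝ E] [FiniteDimensional ℝ E']

-- Differentiation under the integral sign. The dominating constant comes from compactness of `K`
-- times a closed ball on which the whole family stays inside `W`.
include hc in
theorem hasFDerivAt_integral_family {W : Set (G × E)} (hW : IsOpen W) {F : G × E → E'}
    (hF : ContMDiffOn (𝓘(ℝ, EG).prod 𝓘(ℝ, E)) 𝓘(ℝ, E') ∞ F W) {z₀ : E} (hz : ∀ k, (c k, z₀) ∈ W) :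
    HasFDerivAt (fun z ↦ ∫ k, F (c k, z) ∂μ)
      (∫ k, fderiv ℝ (fun z ↦ F (c k, z)) z₀ ∂μ) z₀ := by
  have hU := isOpen_setOf_forall_mem (E := E) hc hW
  obtain ⟨ε, ε0, hε⟩ := Metric.nhds_basis_closedBall.mem_iff.1 (hU.mem_nhds hz)
  have hFc : ∀ z, (∀ k, (c k, z) ∈ W) → Continuous fun k ↦ F (c k, z) := fun z h ↦
    hF.continuousOn.comp_continuous (by fun_prop) h
  have hF' := contMDiffOn_partial_fderiv hW hF
  have : FiniteDimensional ℝ (E →L[ℝ] E') := inferInstance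
  have : ProperSpace (E →L[ℝ] E') := FiniteDimensional.proper ℝ _
  have : ProperSpace E' := FiniteDimensional.proper ℝ _
  have : ProperSpace E := FiniteDimensional.proper ℝ _
  have hcont : ContinuousOn (fun p : K × E ↦ fderiv ℝ (fun z ↦ F (c p.1, z)) p.2)
      (univ ×ˢ Metric.closedBall z₀ ε) :=
    ContinuousOn.comp (t := W) (f := fun p : K × E ↦ (c p.1, p.2)) hF'.continuousOn (by fun_prop)
      (fun p hp ↦ hε hp.2 p.1)
  obtain ⟨C, hC⟩ := ((isCompact_univ.prod (isCompact_closedBall z₀ ε)).exists_bound_of_continuousOn hcont)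
  have hint : ∀ {E'' : Type u} [NormedAddCommGroup E''] [NormedSpace ℝ E''] [ProperSpace E'']
      {f : K → E''} (_ : Continuous f), Integrable f μ := fun {E''} _ _ _ f hf ↦
    hf.integrable_of_hasCompactSupport (HasCompactSupport.of_compactSpace f)
  refine hasFDerivAt_integral_of_dominated_of_fderiv_le (F := fun z k ↦ F (c k, z))
    (F' := fun z k ↦ fderiv ℝ (fun z ↦ F (c k, z)) z) (bound := fun _ ↦ C)
    (Metric.closedBall_mem_nhds z₀ ε0) ?_ (hint (hFc z₀ hz)) ?_ ?_ (integrable_const _) ?_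
  · filter_upwards [hU.mem_nhds hz] with z h using (hFc z h).aestronglyMeasurable
  · refine Continuous.aestronglyMeasurable ?_
    exact hF'.continuousOn.comp_continuous (f := fun k ↦ (c k, z₀)) (by fun_prop) hz
  · exact Eventually.of_forall fun k z h ↦ hC (k, z) ⟨trivial, h⟩
  · exact Eventually.of_forall fun k z h ↦ hasFDerivAt_partial hW hF (p := (c k, z)) (hε h k)

-- Each derivative replaces the target `E'` by `E →L[ℝ] E'`. This is why `E'` is quantified inside
-- the induction and shares the universe of `E`.
include hc in
theorem contDiffOn_integral_family_nat {W : Set (G × E)} (hW : IsOpen W) (n : ℕ) :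
    ∀ {E' : Type u} [NormedAddCommGroup E'] [NormedSpace ℝ E'] [FiniteDimensional ℝ E'] {F : G × E → E'}
    (_ : ContMDiffOn (𝓘(ℝ, EG).prod 𝓘(ℝ, E)) 𝓘(ℝ, E') ∞ F W),
    ContDiffOn ℝ n (fun z ↦ ∫ k, F (c k, z) ∂μ) {z : E | ∀ k, (c k, z) ∈ W} := by
  induction n with
  | zero =>
    intro E' _ _ _ F hF
    rw [Nat.cast_zero, contDiffOn_zero]
    exact fun z hz ↦ (hasFDerivAt_integral_family μ hc hW hF hz).continuousAt.continuousWithinAt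
  | succ n ih =>
    intro E' _ _ _ F hF
    rw [Nat.cast_succ, contDiffOn_succ_iff_fderiv_of_isOpen (isOpen_setOf_forall_mem hc hW)]
    refine ⟨fun z hz ↦ (hasFDerivAt_integral_family μ hc hW hF hz).differentiableAt.differentiableWithinAt,
      by simp, ?_⟩
    refine (ih (contMDiffOn_partial_fderiv hW hF)).congr fun z hz ↦ ?_
    exact (hasFDerivAt_integral_family μ hc hW hF hz).fderiv

include hc in
theorem contDiffOn_integral_family {W : Set (G × E)} (hW : IsOpen W) {F : G × E → E'}
    (hF : ContMDiffOn (𝓘(ℝ, EG).prod 𝓘(ℝ, E)) 𝓘(ℝ, E') ∞ F W) :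
    ContDiffOn ℝ ∞ (fun z ↦ ∫ k, F (c k, z) ∂μ) {z : E | ∀ k, (c k, z) ∈ W} :=
  contDiffOn_infty.2 fun n ↦ contDiffOn_integral_family_nat μ hc hW n hF

end PartialDerivative

/-- On a compact group the Haar probability measure is unique. Its right translates and its image
under inversion are again Haar probability measures, so they all coincide. -/
theorem integral_inv_haar {K : Type*} [Group K] [TopologicalSpace K] [IsTopologicalGroup K] [T2Space K] [CompactSpace K]
    [MeasurableSpace K] [BorelSpace K] (μ : Measure K) [IsProbabilityMeasure μ] [μ.IsHaarMeasure]
    {V : Type*} [NormedAddCommGroup V] [NormedSpace ℝ V] (f : K → V) :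
    ∫ k, f k⁻¹ ∂μ = ∫ k, f k ∂μ := by
  have hr : ∀ g : K, Measure.map (· * g) μ = μ := fun g ↦ by
    have : IsProbabilityMeasure (Measure.map (· * g) μ) :=
      Measure.isProbabilityMeasure_map (by fun_prop)
    exact Measure.isHaarMeasure_eq_of_isProbabilityMeasure _ _
  have : μ.IsMulRightInvariant := ⟨hr⟩
  have : IsProbabilityMeasure μ.inv := Measure.isProbabilityMeasure_map (by fun_prop)
  have : μ.inv.IsHaarMeasure :=
    Measure.isHaarMeasure_of_isCompact_nonempty_interior _ univ isCompact_univ (by simp)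
      (by simp) (by simp)
  have : μ.IsInvInvariant := ⟨Measure.isHaarMeasure_eq_of_isProbabilityMeasure _ _⟩
  exact integral_inv_eq_self f μ

/-! ### The two halves of the constant rank argument -/

section ConstantRank

variable {V : Type*} [NormedAddCommGroup V] [NormedSpace ℝ V] [FiniteDimensional ℝ V]
  {E : Type*} [NormedAddCommGroup E] [NormedSpace ℝ E] [FiniteDimensional ℝ E]

/-- The rank cannot drop near `x₀`, so the upper bound makes it constant. Then `f` is locally
constant along a foliation transverse to `x₀ + S`, and every nearby value is already attained on
that slice. Applied to an orbit map, this yields a local section without any appeal to the subgroup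
structure of the stabilizer. -/
theorem eventually_exists_mem_complement_of_finrank_range_le {f : V → E} {x₀ : V}
    (hf : ContDiffAt ℝ ∞ f x₀)
    (hr : ∀ᶠ x in 𝓝 x₀, Module.finrank ℝ (fderiv ℝ f x).range ≤
      Module.finrank ℝ (fderiv ℝ f x₀).range)
    {S : Submodule ℝ V} (hS : IsCompl S (fderiv ℝ f x₀).ker)
    {N : Set V} (hN : N ∈ 𝓝 x₀) :
    ∀ᶠ x in 𝓝 x₀, ∃ η ∈ S, x₀ + η ∈ N ∧ f (x₀ + η) = f x := by
  set A := fderiv ℝ f x₀ with hA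
  set R := A.range
  obtain ⟨R', hR'⟩ := R.exists_isCompl
  let π : E →L[ℝ] R := (R.projectionOnto R' hR').toContinuousLinearMap
  let pr : V →L[ℝ] A.ker := ((A.ker).projectionOnto S hS.symm).toContinuousLinearMap
  have hπ : ∀ r : R, π r = r := fun r ↦ Submodule.projectionOnto_apply_left hR' r
  have hpr : ∀ k : A.ker, pr k = k := fun k ↦ Submodule.projectionOnto_apply_left hS.symm k
  have hpr0 : ∀ v, pr v = 0 ↔ v ∈ S := fun v ↦
    Submodule.projectionOnto_apply_eq_zero_iff hS.symm
  -- Straightening coordinates: the part of `f` in the range of `A`, together with the component of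
  -- `x - x₀` in the kernel along `S`. The points with second coordinate zero are those of `x₀ + S`.
  let Θ : V → R × A.ker := fun x ↦ (π (f x), pr (x - x₀))
  have hΘ : ContDiffAt ℝ ∞ Θ x₀ := by fun_prop
  have hdf : ∀ᶠ x in 𝓝 x₀, ContDiffAt ℝ 1 f x := (hf.of_le (by simp)).eventually (by simp)
  have hdΘ : ∀ x, ContDiffAt ℝ 1 f x → HasFDerivAt Θ ((π ∘L fderiv ℝ f x).prod pr) x := fun x hx ↦ by
    have h1 := π.hasFDerivAt.comp x (hx.differentiableAt (by simp)).hasFDerivAt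
    have h2 := pr.hasFDerivAt.comp x ((hasFDerivAt_id x).sub_const x₀)
    exact h1.prodMk h2
  let T : V →L[ℝ] R × A.ker := (π ∘L A).prod pr
  have hT : Function.Bijective T := by
    constructor
    · refine (injective_iff_map_eq_zero T).2 fun v hv ↦ ?_
      have h1 : π (A v) = 0 := congrArg Prod.fst hv
      have h2 : pr v = 0 := congrArg Prod.snd hv
      have h3 : A v = 0 := by
        have := hπ ⟨A v, v, rfl⟩
        rw [show π (A v) = 0 from h1] at this
        simpa using (congrArg Subtype.val this).symm
      have := hpr ⟨v, h3⟩
      rw [show pr v = 0 from h2] at this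
      simpa using (congrArg Subtype.val this).symm
    · rintro ⟨⟨_, v, rfl⟩, k⟩
      obtain ⟨s, hs, k', hk', rfl⟩ := Submodule.mem_sup.1 (hS.sup_eq_top ▸ Submodule.mem_top : v ∈ S ⊔ A.ker)
      refine ⟨s + k, Prod.ext ?_ ?_⟩
      · have e1 : A (s + k) = A (s + k') := by
          rw [map_add, map_add, show A k = 0 from k.2, show A k' = 0 from hk']
        change π (A (s + k)) = _
        rw [e1]
        exact hπ ⟨A (s + k'), s + k', rfl⟩
      · change pr (s + k) = k
        rw [map_add, (hpr0 s).2 hs, hpr, zero_add]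
  let T' : V ≃L[ℝ] R × A.ker := (LinearEquiv.ofBijective T.toLinearMap hT).toContinuousLinearEquiv
  have hT' : (T' : V →L[ℝ] R × A.ker) = T := by ext v <;> rfl
  have hd0 : HasFDerivAt Θ (T' : V →L[ℝ] R × A.ker) x₀ := by
    rw [hT']; exact hdΘ x₀ (hf.of_le (by simp))
  let Λ := hΘ.toOpenPartialHomeomorph Θ hd0 (by simp)
  have hΛ : ∀ x, Λ x = Θ x := fun x ↦ rfl
  have hx₀ : x₀ ∈ Λ.source := hΘ.mem_toOpenPartialHomeomorph_source hd0 (by simp)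
  have hΘ0 : Θ x₀ = (π (f x₀), 0) := by simp [Θ]
  have hsymm : ContDiffAt ℝ ∞ Λ.symm (Θ x₀) := hΘ.to_localInverse hd0 (by simp)
  have hsymm1 : ∀ᶠ y in 𝓝 (Θ x₀), ContDiffAt ℝ 1 Λ.symm y := (hsymm.of_le (by simp)).eventually (by simp)
  -- the kernels of `π ∘ f'` and `f'` agree near `x₀`
  have hker : ∀ᶠ x in 𝓝 x₀, ∀ v, π (fderiv ℝ f x v) = 0 → fderiv ℝ f x v = 0 := by
    have hcont : ContinuousAt (fun x ↦ (π ∘L fderiv ℝ f x).prod pr) x₀ := by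
      have h1 : ContinuousAt (fderiv ℝ f) x₀ :=
        (hf.fderiv_right (m := 0) (by simp)).continuousAt
      have h2 : Continuous fun B : V →L[ℝ] E ↦ (π ∘L B).prod pr := by
        have : Continuous fun B : V →L[ℝ] E ↦ ((ContinuousLinearMap.inl ℝ R A.ker) ∘L (π ∘L B) +
          (ContinuousLinearMap.inr ℝ R A.ker) ∘L pr) := by fun_prop
        convert this using 2 with B
        ext v <;> simp
      exact h2.continuousAt.comp h1
    have hmem : range ((↑) : (V ≃L[ℝ] R × A.ker) → V →L[ℝ] R × A.ker) ∈ 𝓝 ((π ∘L fderiv ℝ f x₀).prod pr) := by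
      have := ContinuousLinearEquiv.nhds T'
      rwa [hT'] at this
    filter_upwards [hcont.eventually hmem, hr] with x ⟨e, he⟩ hrx v hv
    -- Invertibility is an open condition, so `π` still maps the range of the nearby derivative onto
    -- `R`. With the rank bound, `π` is then injective on that range.
    have hsurj : Function.Surjective (π.toLinearMap.domRestrict (fderiv ℝ f x).range) := fun r ↦ by
      obtain ⟨v, hv⟩ := e.surjective (r, 0)
      refine ⟨⟨fderiv ℝ f x v, v, rfl⟩, ?_⟩
      have : (e : V →L[ℝ] R × A.ker) v = (r, 0) := hv
      rw [he] at this
      exact congrArg Prod.fst this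
    have hfr : Module.finrank ℝ (fderiv ℝ f x).range = Module.finrank ℝ R :=
      le_antisymm hrx (LinearMap.finrank_le_finrank_of_surjective hsurj)
    have hinj := (LinearMap.injective_iff_surjective_of_finrank_eq_finrank hfr).2 hsurj
    have := (injective_iff_map_eq_zero _).1 hinj ⟨fderiv ℝ f x v, v, rfl⟩ hv
    exact congrArg Subtype.val this
  have hev : ∀ᶠ y in 𝓝 (Θ x₀), ContDiffAt ℝ 1 Λ.symm y ∧ y ∈ Λ.target ∧ Λ.symm y ∈ N ∧
      ContDiffAt ℝ 1 f (Λ.symm y) ∧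
      ∀ v, π (fderiv ℝ f (Λ.symm y) v) = 0 → fderiv ℝ f (Λ.symm y) v = 0 := by
    have ht : Tendsto Λ.symm (𝓝 (Θ x₀)) (𝓝 x₀) := by
      have := hsymm.continuousAt.tendsto
      rwa [show Λ.symm (Θ x₀) = x₀ from Λ.left_inv hx₀] at this
    filter_upwards [hsymm1, Λ.open_target.mem_nhds (Λ.map_source hx₀), ht.eventually hN,
      ht.eventually hdf, ht.eventually hker] with y h1 h2 h3 h4 h5 using ⟨h1, h2, h3, h4, h5⟩
  rw [hΘ0] at hev
  obtain ⟨U₁, hU₁, U₂, hU₂, hU⟩ := Filter.eventually_prod_iff.1 (nhds_prod_eq (X := R) (Y := A.ker) ▸ hev)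
  obtain ⟨δ, δ0, hδ⟩ := Metric.eventually_nhds_iff_ball.1 hU₂
  -- In the straightened coordinates `π ∘ f` is the first projection. Its derivative in the kernel
  -- direction vanishes, and by `hker` so does that of `f` itself.
  have hconst : ∀ a, U₁ a → ∀ b ∈ Metric.ball (0 : A.ker) δ, f (Λ.symm (a, b)) = f (Λ.symm (a, 0)) := by
    intro a ha b hb
    have hD : ∀ b ∈ Metric.ball (0 : A.ker) δ, HasFDerivAt (fun b : A.ker ↦ f (Λ.symm (a, b))) (0 : A.ker →L[ℝ] E) b := by
      intro b hb
      obtain ⟨h1, h2, h3, h4, h5⟩ := hU ha (hδ b hb)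
      have d1 : HasFDerivAt (fun b : A.ker ↦ (a, b)) (ContinuousLinearMap.inr ℝ R A.ker) b :=
        hasFDerivAt_prodMk_right a b
      have d2 := (h1.differentiableAt (by simp)).hasFDerivAt
      have d3 := (h4.differentiableAt (by simp)).hasFDerivAt
      have d4 := (hdΘ _ h4).comp _ d2
      have d5 : HasFDerivAt (Θ ∘ Λ.symm) (ContinuousLinearMap.id ℝ _) (a, b) := by
        refine (hasFDerivAt_id _).congr_of_eventuallyEq ?_
        filter_upwards [Λ.open_target.mem_nhds h2] with y hy using Λ.right_inv hy
      have d6 := d4.unique d5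
      refine ((d3.comp _ d2).comp b d1).congr_fderiv ?_
      ext v
      refine h5 _ ?_
      exact congrArg (fun L : R × A.ker →L[ℝ] R × A.ker ↦ (L (0, v)).1) d6
    refine (convex_ball (0 : A.ker) δ).is_const_of_fderivWithin_eq_zero (𝕜 := ℝ)
      (fun b hb ↦ (hD b hb).differentiableAt.differentiableWithinAt)
      (fun b hb ↦ ?_) hb (Metric.mem_ball_self δ0)
    rw [fderivWithin_of_isOpen Metric.isOpen_ball hb, (hD b hb).fderiv]
  have hΘc : Tendsto Θ (𝓝 x₀) (𝓝 (π (f x₀)) ×ˢ 𝓝 (0 : A.ker)) := by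
    rw [← nhds_prod_eq, ← hΘ0]; exact hΘ.continuousAt
  filter_upwards [hΘc.eventually (hU₁.prod_mk (Metric.ball_mem_nhds _ δ0)), Λ.open_source.mem_nhds hx₀]
    with x ⟨h1, h2⟩ hx
  obtain ⟨-, k2, k3, -, -⟩ := hU h1 (hδ 0 (Metric.mem_ball_self δ0))
  have h3 : Θ (Λ.symm ((Θ x).1, 0)) = ((Θ x).1, 0) := Λ.right_inv k2
  -- The witness is found by sliding `x` along its fibre until the kernel coordinate is zero.
  refine ⟨Λ.symm ((Θ x).1, 0) - x₀, (hpr0 _).1 (congrArg Prod.snd h3), ?_, ?_⟩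
  · simpa using k3
  · rw [add_sub_cancel, ← hconst _ h1 _ h2]
    exact congrArg f (Λ.left_inv hx)

-- A strict derivative controls increments uniformly in the second variable, so one neighbourhood of
-- `x₀` serves for all `z` near `z₀`. With `F` the action in charts, this says that small group
-- elements transverse to the stabilizer of the centre fix no nearby point, except the identity.
omit [FiniteDimensional ℝ E] in
theorem exists_nhds_eq_zero_of_complement {F : V × E → E} {x₀ : V} {z₀ : E} {F' : V × E →L[ℝ] E}
    (hF : HasStrictFDerivAt F F' (x₀, z₀)) {S : Submodule ℝ V}
    (hS : Disjoint S (F' ∘L ContinuousLinearMap.inl ℝ V E).ker) :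
    ∃ N ∈ 𝓝 x₀, ∃ U ∈ 𝓝 z₀, ∀ η ∈ S, x₀ + η ∈ N → ∀ z ∈ U, F (x₀ + η, z) = F (x₀, z) → η = 0 := by
  set A := F' ∘L ContinuousLinearMap.inl ℝ V E
  obtain ⟨K, K0, hK⟩ := (A.toLinearMap.domRestrict S).exists_antilipschitzWith
    (LinearMap.ker_eq_bot'.2 fun v hv ↦ by
      have := Submodule.disjoint_def.1 hS v v.2 hv
      exact Subtype.ext this)
  -- The constant `1 / (2 * K)` leads to `‖η‖ ≤ ‖η‖ / 2` at the end, where `K` is the antilipschitz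
  -- constant of the derivative on `S`.
  have hs := hF.isLittleO.def (c := 1 / (2 * K)) (by positivity)
  rw [nhds_prod_eq] at hs
  obtain ⟨W, hW, W2, hW2, hWW⟩ := Filter.eventually_prod_iff.1 hs
  rw [nhds_prod_eq] at hW hW2
  obtain ⟨N1, hN1, U1, hU1, h1⟩ := Filter.eventually_prod_iff.1 hW
  obtain ⟨N2, hN2, U2, hU2, h2⟩ := Filter.eventually_prod_iff.1 hW2
  refine ⟨{x | N1 x}, hN1, {z | U1 z ∧ U2 z}, hU1.and hU2, fun η hη hN z hz he ↦ ?_⟩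
  have := hWW (h1 hN hz.1) (h2 hN2.self_of_nhds hz.2)
  simp only [he, sub_self, zero_sub, norm_neg, Prod.mk_sub_mk, add_sub_cancel_left] at this
  have hk := hK.le_mul_dist ⟨η, hη⟩ 0
  simp only [map_zero, dist_zero_right, LinearMap.domRestrict_apply] at hk
  have e : A η = F' (η, 0) := by simp [A]
  change ‖η‖ ≤ K * ‖A η‖ at hk
  rw [e] at hk
  have hn : ‖((η, 0) : V × E)‖ = ‖η‖ := by simp [Prod.norm_def]
  rw [hn] at this
  have h3 : ‖η‖ ≤ ‖η‖ / 2 := by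
    calc ‖η‖ ≤ K * ‖F' (η, 0)‖ := hk
      _ ≤ K * (1 / (2 * K) * ‖η‖) := by gcongr
      _ = ‖η‖ / 2 := by have : (K : ℝ) ≠ 0 := by positivity
                        field_simp
  have := norm_nonneg η
  exact norm_eq_zero.1 (by linarith)

end ConstantRank

/-! ### Isotropy groups near a point of a proper action -/

/-- A proper map is closed, so the pairs `(g • x, x)` with `g` outside `W` form a closed set. It
misses `(m, m)`, hence also `(x, x)` for `x` near `m`. -/
theorem eventually_stabilizer_subset_of_properSMul {G : Type*} [TopologicalSpace G] [Group G]
    [IsTopologicalGroup G] {M : Type*} [TopologicalSpace M] [MulAction G M]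
    [ProperSMul G M] (m : M) {W : Set G} (hW : IsOpen W)
    (h : (MulAction.stabilizer G m : Set G) ⊆ W) :
    ∀ᶠ x in 𝓝 m, (MulAction.stabilizer G x : Set G) ⊆ W := by
  have hc : IsClosed ((fun p : G × M ↦ (p.1 • p.2, p.2)) '' (Wᶜ ×ˢ univ)) :=
    (ProperSMul.isProperMap_smul_pair (G := G) (X := M)).isClosedMap _ (hW.isClosed_compl.prod isClosed_univ)
  have hm : (m, m) ∈ ((fun p : G × M ↦ (p.1 • p.2, p.2)) '' (Wᶜ ×ˢ univ))ᶜ := by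
    rintro ⟨⟨g, x⟩, ⟨hg, -⟩, hgx⟩
    obtain ⟨h1, rfl⟩ := Prod.mk.inj hgx
    exact hg (h h1)
  have hd : Tendsto (fun x : M ↦ (x, x)) (𝓝 m) (𝓝 (m, m)) := (continuous_id.prodMk continuous_id).tendsto m
  filter_upwards [hd.eventually (hc.isOpen_compl.mem_nhds hm)] with x hx g hg
  by_contra hgW
  exact hx ⟨(g, x), ⟨hgW, trivial⟩, by simpa using hg⟩

theorem finrank_range_comp_comp_le {V₁ V₂ V₃ V₄ : Type*} [NormedAddCommGroup V₁] [NormedSpace ℝ V₁]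
    [NormedAddCommGroup V₂] [NormedSpace ℝ V₂] [NormedAddCommGroup V₃] [NormedSpace ℝ V₃]
    [NormedAddCommGroup V₄] [NormedSpace ℝ V₄] [FiniteDimensional ℝ V₃]
    (A : V₃ →L[ℝ] V₄) (B : V₂ →L[ℝ] V₃) (C : V₁ →L[ℝ] V₂) :
    Module.finrank ℝ (A ∘L B ∘L C).range ≤ Module.finrank ℝ B.range := by
  have h : (A ∘L B ∘L C).range ≤ B.range.map A.toLinearMap := by
    rintro _ ⟨v, rfl⟩
    exact ⟨B (C v), ⟨C v, rfl⟩, rfl⟩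
  exact (Submodule.finrank_mono h).trans (Submodule.finrank_map_le _ _)

theorem contDiffAt_smul_in_charts {EG : Type*} [NormedAddCommGroup EG] [NormedSpace ℝ EG]
    {G : Type*} [TopologicalSpace G] [ChartedSpace EG G] [Group G]
    [LieGroup 𝓘(ℝ, EG) ∞ G]
    {E : Type*} [NormedAddCommGroup E] [NormedSpace ℝ E]
    {M : Type*} [TopologicalSpace M] [ChartedSpace E M]
    [IsManifold 𝓘(ℝ, E) ∞ M]
    [MulAction G M] [ContMDiffSMul 𝓘(ℝ, EG) 𝓘(ℝ, E) ∞ G M] (m : M) :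
    ContDiffAt ℝ ∞ (fun p : EG × E ↦ extChartAt 𝓘(ℝ, E) m
      ((extChartAt 𝓘(ℝ, EG) (1 : G)).symm p.1 • (extChartAt 𝓘(ℝ, E) m).symm p.2))
      (extChartAt 𝓘(ℝ, EG) (1 : G) 1, extChartAt 𝓘(ℝ, E) m m) := by
  have h1 : ContMDiffAt 𝓘(ℝ, EG) 𝓘(ℝ, EG) ∞ (extChartAt 𝓘(ℝ, EG) (1 : G)).symm
      (extChartAt 𝓘(ℝ, EG) (1 : G) 1) :=
    (contMDiffOn_extChartAt_symm (1 : G)).contMDiffAt (extChartAt_target_mem_nhds (1 : G))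
  have h2 : ContMDiffAt 𝓘(ℝ, E) 𝓘(ℝ, E) ∞ (extChartAt 𝓘(ℝ, E) m).symm
      (extChartAt 𝓘(ℝ, E) m m) :=
    (contMDiffOn_extChartAt_symm m).contMDiffAt (extChartAt_target_mem_nhds m)
  have h3 : ContMDiffAt (𝓘(ℝ, EG).prod 𝓘(ℝ, E)) (𝓘(ℝ, EG).prod 𝓘(ℝ, E)) ∞
      (fun p : EG × E ↦ ((extChartAt 𝓘(ℝ, EG) (1 : G)).symm p.1, (extChartAt 𝓘(ℝ, E) m).symm p.2))
      (extChartAt 𝓘(ℝ, EG) (1 : G) 1, extChartAt 𝓘(ℝ, E) m m) :=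
    (h1.comp (extChartAt 𝓘(ℝ, EG) (1 : G) 1, extChartAt 𝓘(ℝ, E) m m) contMDiffAt_fst).prodMk
      (h2.comp (extChartAt 𝓘(ℝ, EG) (1 : G) 1, extChartAt 𝓘(ℝ, E) m m) contMDiffAt_snd)
  have h4 : ContMDiff (𝓘(ℝ, EG).prod 𝓘(ℝ, E)) 𝓘(ℝ, E) ∞ (fun p : G × M ↦ p.1 • p.2) := contMDiff_smul
  have h5 : ContMDiffAt 𝓘(ℝ, E) 𝓘(ℝ, E) ∞ (extChartAt 𝓘(ℝ, E) m) m := contMDiffAt_extChartAt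
  have h6 := h5.comp_of_eq (h4.contMDiffAt.comp _ h3) (by simp)
  rw [← contMDiffAt_iff_contDiffAt, modelWithCornersSelf_prod, ← chartedSpaceSelf_prod]
  exact h6

/-- By properness an element `g` of `G_x` is close to `G_m`, so it can be written `n h` with `h` in
`G_m` and `n` near `1`. The constant rank lemma replaces `n` by a transverse element `s` with `s • m
= n • m`. When `G_m ≤ G_x`, the element `s` also fixes `x`. Transverse elements fixing a nearby
point are trivial, so `s = 1` and `g` lies in `G_m`. -/
theorem eventually_stabilizer_eq {EG : Type*} [NormedAddCommGroup EG] [NormedSpace ℝ EG] [FiniteDimensional ℝ EG]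
    {G : Type*} [TopologicalSpace G] [ChartedSpace EG G] [Group G]
    [LieGroup 𝓘(ℝ, EG) ∞ G]
    {E : Type*} [NormedAddCommGroup E] [NormedSpace ℝ E] [FiniteDimensional ℝ E]
    {M : Type*} [TopologicalSpace M] [ChartedSpace E M]
    [IsManifold 𝓘(ℝ, E) ∞ M]
    [MulAction G M] [ContMDiffSMul 𝓘(ℝ, EG) 𝓘(ℝ, E) ∞ G M] [ProperSMul G M] (m : M) :
    ∀ᶠ x in 𝓝 m, MulAction.stabilizer G m ≤ MulAction.stabilizer G x →
      MulAction.stabilizer G x = MulAction.stabilizer G m := by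
  have : IsTopologicalGroup G := topologicalGroup_of_lieGroup 𝓘(ℝ, EG) ∞
  set κ := extChartAt 𝓘(ℝ, EG) (1 : G)
  set φ := extChartAt 𝓘(ℝ, E) m
  set ξ₀ := κ 1
  set z₀ := φ m
  let F : EG × E → E := fun p ↦ φ (κ.symm p.1 • φ.symm p.2)
  have hF : ContDiffAt ℝ ∞ F (ξ₀, z₀) := contDiffAt_smul_in_charts m
  have hκ0 : κ.symm ξ₀ = 1 := extChartAt_to_inv (1 : G)
  have hφ0 : φ.symm z₀ = m := extChartAt_to_inv m
  have hκc : ContinuousAt κ.symm ξ₀ := continuousAt_extChartAt_symm (1 : G)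
  have hsmul : ContMDiff (𝓘(ℝ, EG).prod 𝓘(ℝ, E)) 𝓘(ℝ, E) ∞ (fun p : G × M ↦ p.1 • p.2) := contMDiff_smul
  have hcs : Continuous (fun p : G × M ↦ p.1 • p.2) := hsmul.continuous
  let orb : G → M := fun g ↦ g • m
  have horb : ContMDiff 𝓘(ℝ, EG) 𝓘(ℝ, E) ∞ orb := hsmul.comp (contMDiff_id.prodMk contMDiff_const)
  let f : EG → E := fun ξ ↦ F (ξ, z₀)
  have hf : ContDiffAt ℝ ∞ f ξ₀ := ContDiffAt.comp ξ₀ (g := F) hF (contDiffAt_id.prodMk contDiffAt_const)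
  have hforb : ∀ ξ, f ξ = φ (orb (κ.symm ξ)) := fun ξ ↦ by simp only [f, F, hφ0, orb]
  -- rank estimate
  have hr1 : ∀ ξ, ξ ∈ κ.target → orb (κ.symm ξ) ∈ φ.source →
      Module.finrank ℝ (fderiv ℝ f ξ).range ≤
        Module.finrank ℝ (mfderiv 𝓘(ℝ, EG) 𝓘(ℝ, E) orb (κ.symm ξ) : EG →L[ℝ] E).range := by
    intro ξ h1 h2
    have d1 : MDifferentiableAt 𝓘(ℝ, EG) 𝓘(ℝ, EG) κ.symm ξ :=
      ((contMDiffOn_extChartAt_symm (n := ∞) (1 : G)).contMDiffAt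
        ((isOpen_extChartAt_target (1 : G)).mem_nhds h1)).mdifferentiableAt (by simp)
    have d2 : MDifferentiableAt 𝓘(ℝ, EG) 𝓘(ℝ, E) orb (κ.symm ξ) := horb.mdifferentiableAt (by simp)
    have d3 : MDifferentiableAt 𝓘(ℝ, E) 𝓘(ℝ, E) φ (orb (κ.symm ξ)) :=
      (contMDiffAt_extChartAt' (n := ∞) (by simpa [φ] using h2)).mdifferentiableAt (by simp)
    have e : fderiv ℝ f ξ = mfderiv 𝓘(ℝ, EG) 𝓘(ℝ, E) (φ ∘ orb ∘ κ.symm) ξ := by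
      rw [mfderiv_eq_fderiv]; congr 1; funext ξ; exact hforb ξ
    rw [e, mfderiv_comp ξ d3 (d2.comp ξ d1), mfderiv_comp ξ d2 d1]
    exact finrank_range_comp_comp_le (V₁ := EG) (V₂ := EG) (V₃ := E) (V₄ := E) _ _ _
  -- The orbit map intertwines left multiplication by `g` with the action of `g`, so its rank at `g`
  -- is bounded by its rank at `1`.
  have hr2 : ∀ g : G, Module.finrank ℝ (mfderiv 𝓘(ℝ, EG) 𝓘(ℝ, E) orb g : EG →L[ℝ] E).range ≤
      Module.finrank ℝ (mfderiv 𝓘(ℝ, EG) 𝓘(ℝ, E) orb 1 : EG →L[ℝ] E).range := by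
    intro g
    have e : orb = (fun x : M ↦ g • x) ∘ orb ∘ (fun k ↦ g⁻¹ * k) := by
      funext k; simp [orb, smul_smul]
    have d1 : MDifferentiableAt 𝓘(ℝ, EG) 𝓘(ℝ, EG) (fun k ↦ g⁻¹ * k) g :=
      (contMDiff_mul_left (n := ∞)).mdifferentiableAt (by simp)
    have d2 : MDifferentiableAt 𝓘(ℝ, EG) 𝓘(ℝ, E) orb (g⁻¹ * g) := horb.mdifferentiableAt (by simp)
    have d3 : MDifferentiableAt 𝓘(ℝ, E) 𝓘(ℝ, E) (fun x : M ↦ g • x) (orb (g⁻¹ * g)) :=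
      (hsmul.comp (contMDiff_const.prodMk contMDiff_id) :
        ContMDiff 𝓘(ℝ, E) 𝓘(ℝ, E) ∞ (fun x : M ↦ g • x)).mdifferentiableAt (by simp)
    have e2 : (mfderiv 𝓘(ℝ, EG) 𝓘(ℝ, E) orb g : EG →L[ℝ] E) =
        (mfderiv 𝓘(ℝ, E) 𝓘(ℝ, E) (fun x : M ↦ g • x) (orb (g⁻¹ * g)) : E →L[ℝ] E) ∘L
        (mfderiv 𝓘(ℝ, EG) 𝓘(ℝ, E) orb (g⁻¹ * g) : EG →L[ℝ] E) ∘L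
        (mfderiv 𝓘(ℝ, EG) 𝓘(ℝ, EG) (fun k ↦ g⁻¹ * k) g : EG →L[ℝ] EG) := by
      conv_lhs => rw [e]
      rw [mfderiv_comp g d3 (d2.comp g d1), mfderiv_comp g d2 d1]
      rfl
    rw [e2]
    refine (finrank_range_comp_comp_le (V₁ := EG) (V₂ := EG) (V₃ := E) (V₄ := E) _ _ _).trans ?_
    have h1 : ∀ k : G, k = 1 → Module.finrank ℝ (mfderiv 𝓘(ℝ, EG) 𝓘(ℝ, E) orb k : EG →L[ℝ] E).range ≤
        Module.finrank ℝ (mfderiv 𝓘(ℝ, EG) 𝓘(ℝ, E) orb 1 : EG →L[ℝ] E).range := by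
      rintro _ rfl; exact le_rfl
    exact h1 _ (inv_mul_cancel g)
  have hr3 : Module.finrank ℝ (mfderiv 𝓘(ℝ, EG) 𝓘(ℝ, E) orb 1 : EG →L[ℝ] E).range ≤
      Module.finrank ℝ (fderiv ℝ f ξ₀).range := by
    have hfd : MDifferentiableAt 𝓘(ℝ, EG) 𝓘(ℝ, E) f (κ 1) :=
      (hf.differentiableAt (by simp)).mdifferentiableAt
    have d1 : MDifferentiableAt 𝓘(ℝ, EG) 𝓘(ℝ, EG) κ 1 :=
      (contMDiffAt_extChartAt (n := ∞)).mdifferentiableAt (by simp)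
    have hfz : f (κ 1) = z₀ := by
      rw [hforb, show κ 1 = ξ₀ from rfl, hκ0]; simp [orb, z₀]
    have d3 : MDifferentiableAt 𝓘(ℝ, E) 𝓘(ℝ, E) φ.symm (f (κ 1)) := by
      rw [hfz]
      exact ((contMDiffOn_extChartAt_symm (n := ∞) m).contMDiffAt
        (extChartAt_target_mem_nhds m)).mdifferentiableAt (by simp)
    have e : orb =ᶠ[𝓝 1] φ.symm ∘ f ∘ κ := by
      have h1 : ∀ᶠ g in 𝓝 (1 : G), orb g ∈ φ.source :=
        horb.continuous.continuousAt.eventually (by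
          rw [show orb 1 = m from one_smul _ _]; exact extChartAt_source_mem_nhds m)
      filter_upwards [h1, extChartAt_source_mem_nhds (I := 𝓘(ℝ, EG)) (1 : G)] with g hg hg'
      simp only [Function.comp, hforb]
      rw [κ.left_inv hg', φ.left_inv hg]
    have e2 : (mfderiv 𝓘(ℝ, EG) 𝓘(ℝ, E) orb 1 : EG →L[ℝ] E) =
        (mfderiv 𝓘(ℝ, E) 𝓘(ℝ, E) φ.symm (f (κ 1)) : E →L[ℝ] E) ∘L
        (mfderiv 𝓘(ℝ, EG) 𝓘(ℝ, E) f (κ 1) : EG →L[ℝ] E) ∘L (mfderiv 𝓘(ℝ, EG) 𝓘(ℝ, EG) κ 1 : EG →L[ℝ] EG) := by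
      have e3 := e.mfderiv_eq (I := 𝓘(ℝ, EG)) (I' := 𝓘(ℝ, E))
      rw [mfderiv_comp 1 d3 (hfd.comp 1 d1), mfderiv_comp 1 hfd d1] at e3
      exact e3
    have e4 : (mfderiv 𝓘(ℝ, EG) 𝓘(ℝ, E) f (κ 1) : EG →L[ℝ] E) = fderiv ℝ f ξ₀ := mfderiv_eq_fderiv
    rw [← e4, e2]
    exact finrank_range_comp_comp_le (V₁ := EG) (V₂ := EG) (V₃ := E) (V₄ := E) _ _ _
  have horbc : Tendsto (fun ξ ↦ orb (κ.symm ξ)) (𝓝 ξ₀) (𝓝 m) := by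
    have h1 : Tendsto κ.symm (𝓝 ξ₀) (𝓝 1) := by have := hκc.tendsto; rwa [hκ0] at this
    have h2 : Tendsto orb (𝓝 1) (𝓝 m) := by
      have := horb.continuous.tendsto 1; rwa [show orb 1 = m from one_smul _ _] at this
    exact h2.comp h1
  have hrank : ∀ᶠ ξ in 𝓝 ξ₀, Module.finrank ℝ (fderiv ℝ f ξ).range ≤
      Module.finrank ℝ (fderiv ℝ f ξ₀).range := by
    filter_upwards [extChartAt_target_mem_nhds (1 : G), horbc.eventually (extChartAt_source_mem_nhds (I := 𝓘(ℝ, E)) m)]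
      with ξ h1 h2 using (hr1 ξ h1 h2).trans ((hr2 _).trans hr3)
  obtain ⟨S, hS⟩ := (fderiv ℝ f ξ₀).ker.exists_isCompl
  have hFs : HasStrictFDerivAt F (fderiv ℝ F (ξ₀, z₀)) (ξ₀, z₀) := hF.hasStrictFDerivAt (by simp)
  have hA : fderiv ℝ f ξ₀ = fderiv ℝ F (ξ₀, z₀) ∘L ContinuousLinearMap.inl ℝ EG E :=
    (HasFDerivAt.comp (g := F) (f := fun ξ ↦ (ξ, z₀)) ξ₀ hFs.hasFDerivAt
      (hasFDerivAt_prodMk_left ξ₀ z₀)).fderiv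
  obtain ⟨N, hN, U, hU, hNU⟩ := exists_nhds_eq_zero_of_complement hFs (S := S) (hA ▸ hS.symm.disjoint)
  have hN' : N ∩ {ξ | orb (κ.symm ξ) ∈ φ.source} ∈ 𝓝 ξ₀ :=
    inter_mem hN (horbc.eventually (extChartAt_source_mem_nhds (I := 𝓘(ℝ, E)) m))
  have hcov := eventually_exists_mem_complement_of_finrank_range_le hf hrank hS.symm hN'
  -- every `g` near `1` has the form `s h`
  have hκt : Tendsto κ (𝓝 1) (𝓝 ξ₀) := (continuousAt_extChartAt (1 : G)).tendsto
  have hG1 : ∀ᶠ g in 𝓝 (1 : G), ∃ η ∈ S, ξ₀ + η ∈ N ∧ κ.symm (ξ₀ + η) • m = g • m := by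
    have h1 : ∀ᶠ g in 𝓝 (1 : G), orb g ∈ φ.source :=
        horb.continuous.continuousAt.eventually (by
          rw [show orb 1 = m from one_smul _ _]; exact extChartAt_source_mem_nhds m)
    filter_upwards [hκt.eventually hcov, h1, extChartAt_source_mem_nhds (I := 𝓘(ℝ, EG)) (1 : G)]
      with g ⟨η, hη, hηN, he⟩ hg hg'
    refine ⟨η, hη, hηN.1, ?_⟩
    rw [hforb, hforb, κ.left_inv hg'] at he
    exact φ.injOn hηN.2 hg he
  obtain ⟨N₁, hN₁, hN₁o, h1N₁⟩ := mem_nhds_iff.1 hG1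
  -- `W` is the union of the translates `N₁ h`, an open neighbourhood of the whole stabilizer.
  let W : Set G := ⋃ h ∈ MulAction.stabilizer G m, (fun g ↦ g * h⁻¹) ⁻¹' N₁
  have hW : IsOpen W := isOpen_biUnion fun h _ ↦ hN₁o.preimage (by fun_prop)
  have hHW : (MulAction.stabilizer G m : Set G) ⊆ W := fun h hh ↦
    mem_biUnion hh (by simpa using h1N₁)
  have hφt : Tendsto φ (𝓝 m) (𝓝 z₀) := (continuousAt_extChartAt m).tendsto
  filter_upwards [eventually_stabilizer_subset_of_properSMul m hW hHW, hφt.eventually hU,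
    extChartAt_source_mem_nhds (I := 𝓘(ℝ, E)) m] with x hxW hxU hxs hle
  refine le_antisymm (fun g hg ↦ ?_) hle
  obtain ⟨h, hh, hgh⟩ := mem_iUnion₂.1 (hxW hg)
  obtain ⟨η, hη, hηN, he⟩ := hN₁ hgh
  set s := κ.symm (ξ₀ + η) with hs
  -- The elements `g`, `h` and `s⁻¹ (g h⁻¹)` all fix `x`: the first by choice, the other two because
  -- they lie in `G_m ≤ G_x`.
  have hsx : s • x = x := by
    have h1 : s⁻¹ * (g * h⁻¹) ∈ MulAction.stabilizer G m := by
      rw [MulAction.mem_stabilizer_iff, mul_smul, ← he, inv_smul_smul]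
    have h2 := mul_mem (mul_mem hg (inv_mem (hle hh))) (inv_mem (hle h1))
    rw [MulAction.mem_stabilizer_iff] at h2
    rwa [show g * h⁻¹ * (s⁻¹ * (g * h⁻¹))⁻¹ = s by group] at h2
  have hη0 : η = 0 := by
    refine hNU η hη hηN (φ x) hxU ?_
    simp only [F, ← hs, hκ0, φ.left_inv hxs, one_smul, hsx]
  have hs1 : s = 1 := by rw [hs, hη0, add_zero, hκ0]
  rw [hs1, one_smul] at he
  have : g * h⁻¹ ∈ MulAction.stabilizer G m := he.symm
  simpa using mul_mem this hh

/-! ### Linearization of a compact isotropy group and slice charts -/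

/-- The source is cut down to the open set where the derivative is invertible, so that the inverse
is smooth on the whole target and not merely at the image of `z₀`. -/
theorem exists_smooth_openPartialHomeomorph {E : Type*} [NormedAddCommGroup E] [NormedSpace ℝ E]
    [CompleteSpace E] {f : E → E} {U : Set E} (hU : IsOpen U) (hf : ContDiffOn ℝ ∞ f U) {z₀ : E}
    (hz₀ : z₀ ∈ U) {f' : E ≃L[ℝ] E} (hf' : HasFDerivAt f (f' : E →L[ℝ] E) z₀) :
    ∃ Λ : OpenPartialHomeomorph E E, z₀ ∈ Λ.source ∧ Λ.source ⊆ U ∧ (∀ z, Λ z = f z) ∧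
      Λ ∈ contDiffGroupoid ∞ 𝓘(ℝ, E) := by
  have hf0 : ∀ z ∈ U, ContDiffAt ℝ ∞ f z := fun z hz ↦ hf.contDiffAt (hU.mem_nhds hz)
  let Λ₀ := (hf0 z₀ hz₀).toOpenPartialHomeomorph f hf' (by simp)
  have h0 : z₀ ∈ Λ₀.source := (hf0 z₀ hz₀).mem_toOpenPartialHomeomorph_source hf' (by simp)
  let S := U ∩ fderiv ℝ f ⁻¹' range ((↑) : (E ≃L[ℝ] E) → E →L[ℝ] E)
  have hS : IsOpen S := (hf.continuousOn_fderiv_of_isOpen hU (by simp)).isOpen_inter_preimage hU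
    (ContinuousLinearEquiv.isOpen)
  have h0S : z₀ ∈ S := ⟨hz₀, f', hf'.fderiv.symm⟩
  let Λ := Λ₀.restrOpen S hS
  have hsrc : Λ.source = Λ₀.source ∩ S := rfl
  refine ⟨Λ, ⟨h0, h0S⟩, fun z hz ↦ hz.2.1, fun z ↦ rfl, ?_⟩
  rw [contDiffGroupoid, mem_groupoid_of_pregroupoid]
  refine ⟨?_, ?_⟩
  · have : ContDiffOn ℝ ∞ Λ Λ.source := hf.mono fun z hz ↦ hz.2.1
    simpa [contDiffPregroupoid] using this
  · have : ContDiffOn ℝ ∞ Λ.symm Λ.target := fun w hw ↦ by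
      have hs := Λ.map_target hw
      obtain ⟨e, he⟩ := hs.2.2
      have hd := ((hf0 _ hs.2.1).differentiableAt (by simp)).hasFDerivAt
      rw [← he] at hd
      exact (Λ.contDiffAt_symm hw hd (hf0 _ hs.2.1)).contDiffWithinAt
    simpa [contDiffPregroupoid] using this

theorem trans_mem_maximalAtlas {H : Type*} [TopologicalSpace H] {M : Type*} [TopologicalSpace M]
    [ChartedSpace H M] {S : StructureGroupoid H} {e : OpenPartialHomeomorph M H}
    (he : e ∈ S.maximalAtlas M) {Λ : OpenPartialHomeomorph H H} (hΛ : Λ ∈ S) :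
    e.trans Λ ∈ S.maximalAtlas M := by
  rw [mem_maximalAtlas_iff] at he ⊢
  intro e' he'
  constructor
  · rw [OpenPartialHomeomorph.trans_symm_eq_symm_trans_symm, OpenPartialHomeomorph.trans_assoc]
    exact S.trans (S.symm hΛ) (he e' he').1
  · rw [← OpenPartialHomeomorph.trans_assoc]
    exact S.trans (he e' he').2 hΛ

theorem isCompact_stabilizer_of_properSMul {G M : Type*} [TopologicalSpace G] [Group G] [TopologicalSpace M]
    [MulAction G M] [ProperSMul G M] (m : M) : IsCompact (MulAction.stabilizer G m : Set G) := by
  have h := ((ProperSMul.isProperMap_smul_pair (G := G) (X := M)).isCompact_preimage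
    (isCompact_singleton (x := (m, m)))).image continuous_fst
  convert h
  ext g
  simp [MulAction.mem_stabilizer_iff]

/-- Bochner's linearization. Averaging `r k ∘ k⁻¹` over the compact group gives a map `ψ` which
intertwines the action with its derivative `r` at the fixed point and has derivative `1` there.
Equivariance is recorded on the `H`-invariant set `X`, so the chart domain itself need not be
invariant. -/
theorem exists_linearizing_chart {EG : Type*} [NormedAddCommGroup EG] [NormedSpace ℝ EG]
    {G : Type*} [TopologicalSpace G] [T2Space G] [ChartedSpace EG G] [Group G]
    [LieGroup 𝓘(ℝ, EG) ∞ G]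
    {E : Type u} [NormedAddCommGroup E] [NormedSpace ℝ E] [FiniteDimensional ℝ E]
    {M : Type*} [TopologicalSpace M] [ChartedSpace E M]
    [IsManifold 𝓘(ℝ, E) ∞ M]
    [MulAction G M] [ContMDiffSMul 𝓘(ℝ, EG) 𝓘(ℝ, E) ∞ G M] (m : M)
    (hcomp : IsCompact (MulAction.stabilizer G m : Set G)) :
    ∃ (ρ : MulAction.stabilizer G m → E →L[ℝ] E) (e : OpenPartialHomeomorph M E) (X : Set M),
      Continuous ρ ∧ (∀ g h, ρ (g * h) = ρ g ∘L ρ h) ∧ ρ 1 = ContinuousLinearMap.id ℝ E ∧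
      e ∈ IsManifold.maximalAtlas 𝓘(ℝ, E) ∞ M ∧ m ∈ e.source ∧
      IsOpen X ∧ e.source ⊆ X ∧ ∀ x ∈ X, ∀ g : MulAction.stabilizer G m,
        g.1 • x ∈ X ∧ e (g.1 • x) = ρ g (e x) := by
  have : IsTopologicalGroup G := topologicalGroup_of_lieGroup 𝓘(ℝ, EG) ∞
  set H := MulAction.stabilizer G m
  have : CompactSpace H := isCompact_iff_compactSpace.1 hcomp
  let _ : MeasurableSpace H := borel H
  have : BorelSpace H := ⟨rfl⟩
  let μ : Measure H := Measure.haarMeasure ⊤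
  have : IsProbabilityMeasure μ := ⟨Measure.haarMeasure_self (K₀ := ⊤)⟩
  set φ := extChartAt 𝓘(ℝ, E) m
  set z₀ := φ m
  have hφ0 : φ.symm z₀ = m := extChartAt_to_inv m
  have hz₀t : z₀ ∈ φ.target := mem_extChartAt_target m
  have hms : m ∈ φ.source := mem_extChartAt_source m
  have hφt : IsOpen φ.target := isOpen_extChartAt_target m
  have hφs : IsOpen φ.source := isOpen_extChartAt_source m
  have hsmul : ContMDiff (𝓘(ℝ, EG).prod 𝓘(ℝ, E)) 𝓘(ℝ, E) ∞ (fun p : G × M ↦ p.1 • p.2) := contMDiff_smul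
  have hcs : Continuous (fun p : G × M ↦ p.1 • p.2) := hsmul.continuous
  let Φ : G × E → E := fun p ↦ φ (p.1 • φ.symm p.2)
  let W₀ : Set (G × E) := (univ ×ˢ φ.target) ∩ (fun p : G × E ↦ p.1 • φ.symm p.2) ⁻¹' φ.source
  have hact : ContMDiffOn (𝓘(ℝ, EG).prod 𝓘(ℝ, E)) 𝓘(ℝ, E) ∞ (fun p : G × E ↦ p.1 • φ.symm p.2)
      (univ ×ˢ φ.target) :=
    hsmul.comp_contMDiffOn (f := fun p : G × E ↦ (p.1, φ.symm p.2))
      (contMDiffOn_fst.prodMk ((contMDiffOn_extChartAt_symm m).comp contMDiffOn_snd fun p hp ↦ hp.2))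
  have hW₀ : IsOpen W₀ := hact.continuousOn.isOpen_inter_preimage (isOpen_univ.prod hφt) hφs
  have hΦ : ContMDiffOn (𝓘(ℝ, EG).prod 𝓘(ℝ, E)) 𝓘(ℝ, E) ∞ Φ W₀ :=
    (contMDiffOn_extChartAt (x := m)).comp (hact.mono inter_subset_left) fun p hp ↦ by
      simpa [φ] using hp.2
  have hH : ∀ h ∈ H, h • m = m := fun h hh ↦ hh
  have hHW : ∀ h ∈ H, (h, z₀) ∈ W₀ := fun h hh ↦
    ⟨⟨trivial, hz₀t⟩, by simpa only [mem_preimage, hφ0, hH h hh] using hms⟩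
  have hΦ0 : ∀ h ∈ H, Φ (h, z₀) = z₀ := fun h hh ↦ by simp only [Φ, hφ0, hH h hh, z₀]
  let r : G → E →L[ℝ] E := fun g ↦ fderiv ℝ (fun z ↦ Φ (g, z)) z₀
  have hΦd : ∀ p ∈ W₀, HasFDerivAt (fun z ↦ Φ (p.1, z)) (fderiv ℝ (fun z ↦ Φ (p.1, z)) p.2) p.2 :=
    fun p hp ↦ hasFDerivAt_partial hW₀ hΦ hp
  have hΦmul : ∀ (g h : G) (z : E), (h, z) ∈ W₀ → Φ (g * h, z) = Φ (g, Φ (h, z)) := fun g h z hz ↦ by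
    simp only [Φ, mul_smul]; rw [φ.left_inv hz.2]
  have hr_mul : ∀ g ∈ H, ∀ h ∈ H, r (g * h) = r g ∘L r h := by
    intro g hg h hh
    have d1 := hΦd (h, z₀) (hHW h hh)
    have d2 : HasFDerivAt (fun z ↦ Φ (g, z)) (r g) (Φ (h, z₀)) := by
      rw [hΦ0 h hh]; exact hΦd (g, z₀) (hHW g hg)
    refine ((d2.comp z₀ d1).congr_of_eventuallyEq ?_).fderiv
    have : ∀ᶠ z in 𝓝 z₀, (h, z) ∈ W₀ :=
      (hW₀.preimage (continuous_const.prodMk continuous_id)).mem_nhds (hHW h hh)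
    filter_upwards [this] with z hz using hΦmul g h z hz
  have hr_one : r 1 = ContinuousLinearMap.id ℝ E := by
    refine ((hasFDerivAt_id z₀).congr_of_eventuallyEq ?_).fderiv
    filter_upwards [hφt.mem_nhds hz₀t] with z hz
    simp only [Φ, one_smul]
    exact φ.right_inv hz
  -- smoothness of `r`
  let W₁ : Set G := (fun g ↦ (g, z₀)) ⁻¹' W₀
  have hW₁ : IsOpen W₁ := hW₀.preimage (by fun_prop)
  have hr_smooth : ContMDiffOn 𝓘(ℝ, EG) 𝓘(ℝ, E →L[ℝ] E) ∞ r W₁ :=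
    (contMDiffOn_partial_fderiv hW₀ hΦ).comp (f := fun g : G ↦ (g, z₀))
      (contMDiffOn_id.prodMk contMDiffOn_const) fun g hg ↦ hg
  -- Here both factors of the integrand `F` are smooth: `r` at the group element, and the local
  -- action of its inverse at the point.
  let W : Set (G × E) := (Prod.fst ⁻¹' W₁) ∩ (fun p : G × E ↦ (p.1⁻¹, p.2)) ⁻¹' W₀
  have hW : IsOpen W := (hW₁.preimage continuous_fst).inter (hW₀.preimage (by fun_prop))
  let F : G × E → E := fun p ↦ r p.1 (Φ (p.1⁻¹, p.2))
  have hF : ContMDiffOn (𝓘(ℝ, EG).prod 𝓘(ℝ, E)) 𝓘(ℝ, E) ∞ F W := by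
    have h1 : ContMDiffOn (𝓘(ℝ, EG).prod 𝓘(ℝ, E)) 𝓘(ℝ, E →L[ℝ] E) ∞ (fun p : G × E ↦ r p.1) W :=
      hr_smooth.comp contMDiffOn_fst fun p hp ↦ hp.1
    have h2 : ContMDiffOn (𝓘(ℝ, EG).prod 𝓘(ℝ, E)) 𝓘(ℝ, E) ∞ (fun p : G × E ↦ Φ (p.1⁻¹, p.2)) W :=
      hΦ.comp ((contMDiffOn_fst.inv).prodMk contMDiffOn_snd) fun p hp ↦ hp.2
    exact h1.clm_apply h2
  let ψ : E → E := fun z ↦ ∫ k : H, F (k, z) ∂μ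
  let U : Set E := {z | ∀ k : H, ((k : G), z) ∈ W}
  have hc : Continuous ((↑) : H → G) := continuous_subtype_val
  have hU : IsOpen U := isOpen_setOf_forall_mem hc hW
  have hψ : ContDiffOn ℝ ∞ ψ U := contDiffOn_integral_family μ hc hW hF
  have hz₀U : z₀ ∈ U := fun k ↦ ⟨hHW k k.2, hHW _ (inv_mem k.2)⟩
  have hψ' : HasFDerivAt ψ ((ContinuousLinearEquiv.refl ℝ E : E ≃L[ℝ] E) : E →L[ℝ] E) z₀ := by
    refine (hasFDerivAt_integral_family μ hc hW hF hz₀U).congr_fderiv ?_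
    have : ∀ k : H, fderiv ℝ (fun z ↦ F (k, z)) z₀ = ContinuousLinearMap.id ℝ E := fun k ↦ by
      have d1 := (r k).hasFDerivAt.comp z₀ (hΦd ((k : G)⁻¹, z₀) (hHW _ (inv_mem k.2)))
      refine HasFDerivAt.fderiv (d1.congr_fderiv ?_)
      change r k ∘L r (k : G)⁻¹ = _
      rw [← hr_mul _ k.2 _ (inv_mem k.2), mul_inv_cancel, hr_one]
    simp only [this, integral_const, probReal_univ, one_smul]
    rfl
  obtain ⟨Λ, hΛ0, hΛU, hΛψ, hΛ⟩ := exists_smooth_openPartialHomeomorph hU hψ hz₀U hψ'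
  -- Inside the chart, `U` describes the points whose whole `H`-orbit stays in the chart domain.
  -- This makes it invariant.
  have hmemU : ∀ x ∈ φ.source, (φ x ∈ U ↔ ∀ k : H, k.1 • x ∈ φ.source) := fun x hx ↦ by
    constructor
    · intro h k
      have := (h k⁻¹).2.2
      simpa [φ.left_inv hx] using this
    · intro h k
      refine ⟨hHW k k.2, ⟨trivial, φ.map_source hx⟩, ?_⟩
      simpa only [mem_preimage, φ.left_inv hx, Subgroup.coe_inv] using h k⁻¹
  refine ⟨fun k ↦ r k, (chartAt E m).trans Λ, φ.source ∩ φ ⁻¹' U, ?_, fun g h ↦ hr_mul _ g.2 _ h.2, hr_one,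
    trans_mem_maximalAtlas (IsManifold.chart_mem_maximalAtlas m) hΛ, ?_, ?_, ?_, ?_⟩
  · exact hr_smooth.continuousOn.comp_continuous hc fun k ↦ hHW k k.2
  · rw [OpenPartialHomeomorph.trans_source]
    exact ⟨mem_chart_source E m, by simpa [φ, z₀] using hΛ0⟩
  · exact (continuousOn_extChartAt m).isOpen_inter_preimage hφs hU
  · intro x hx
    rw [OpenPartialHomeomorph.trans_source] at hx
    exact ⟨by simpa [φ] using hx.1, by simpa [φ] using hΛU hx.2⟩
  · rintro x ⟨hx, hxU⟩ g
    have hxk := (hmemU x hx).1 hxU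
    have hgx : g.1 • x ∈ φ.source := hxk g
    refine ⟨⟨hgx, (hmemU _ hgx).2 fun k ↦ ?_⟩, ?_⟩
    · rw [smul_smul]; exact hxk (k * g)
    · have e1 : ∀ y, (chartAt E m).trans Λ y = ψ (φ y) := fun y ↦ by simp [φ, hΛψ]
      rw [e1, e1]
      -- The factor `r g` comes out of the integrand at the price of the translation `k ↦ g⁻¹ k`,
      -- which Haar measure absorbs.
      have e2 : ∀ k : H, F (k, φ (g.1 • x)) = r g (F ((g⁻¹ * k : H), φ x)) := fun k ↦ by
        have h1 : (g⁻¹ * k : H)⁻¹ = k⁻¹ * g := by group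
        have h2 : r k = r g ∘L r (g⁻¹ * k : H) := by
          rw [← hr_mul _ g.2 _ (g⁻¹ * k : H).2, ← Subgroup.coe_mul, mul_inv_cancel_left]
        simp only [F, ← Subgroup.coe_inv, h1, h2]
        simp only [Φ, φ.left_inv hx, φ.left_inv hgx, smul_smul, Subgroup.coe_mul,
          ContinuousLinearMap.comp_apply]
      simp only [ψ, e2]
      rw [integral_mul_left_eq_self (fun k : H ↦ r g (F (k, φ x))) g⁻¹,
        ContinuousLinearMap.integral_comp_comm]
      refine Continuous.integrable_of_hasCompactSupport ?_ (HasCompactSupport.of_compactSpace _)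
      exact hF.continuousOn.comp_continuous (f := fun k : H ↦ ((k : G), φ x)) (by fun_prop) hxU

theorem mfderiv_symm_comp_mfderiv_of_mem_maximalAtlas {E : Type*} [NormedAddCommGroup E] [NormedSpace ℝ E]
    {M : Type*} [TopologicalSpace M] [ChartedSpace E M] [IsManifold 𝓘(ℝ, E) ∞ M]
    {e : OpenPartialHomeomorph M E} (he : e ∈ IsManifold.maximalAtlas 𝓘(ℝ, E) ∞ M) {x : M}
    (hx : x ∈ e.source) :
    (mfderiv 𝓘(ℝ, E) 𝓘(ℝ, E) e.symm (e x) : E →L[ℝ] E) ∘L (mfderiv 𝓘(ℝ, E) 𝓘(ℝ, E) e x : E →L[ℝ] E) =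
      ContinuousLinearMap.id ℝ E := by
  have d1 : MDifferentiableAt 𝓘(ℝ, E) 𝓘(ℝ, E) e x :=
    (contMDiffAt_of_mem_maximalAtlas he hx).mdifferentiableAt (by simp)
  have d2 : MDifferentiableAt 𝓘(ℝ, E) 𝓘(ℝ, E) e.symm (e x) :=
    (contMDiffAt_symm_of_mem_maximalAtlas he (e.map_source hx)).mdifferentiableAt (by simp)
  have h := (d2.hasMFDerivAt.comp x d1.hasMFDerivAt).congr_of_eventuallyEq (f₁ := id) (by
    filter_upwards [e.open_source.mem_nhds hx] with y hy using (e.left_inv hy).symm)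
  exact hasMFDerivAt_unique h (hasMFDerivAt_id x)

theorem mfderiv_comp_mfderiv_symm_of_mem_maximalAtlas {E : Type*} [NormedAddCommGroup E] [NormedSpace ℝ E]
    {M : Type*} [TopologicalSpace M] [ChartedSpace E M] [IsManifold 𝓘(ℝ, E) ∞ M]
    {e : OpenPartialHomeomorph M E} (he : e ∈ IsManifold.maximalAtlas 𝓘(ℝ, E) ∞ M) {x : M}
    (hx : x ∈ e.source) :
    (mfderiv 𝓘(ℝ, E) 𝓘(ℝ, E) e x : E →L[ℝ] E) ∘L (mfderiv 𝓘(ℝ, E) 𝓘(ℝ, E) e.symm (e x) : E →L[ℝ] E) =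
      ContinuousLinearMap.id ℝ E := by
  have d1 : HasMFDerivAt 𝓘(ℝ, E) 𝓘(ℝ, E) e (e.symm (e x)) (mfderiv 𝓘(ℝ, E) 𝓘(ℝ, E) e x : E →L[ℝ] E) := by
    rw [e.left_inv hx]
    exact ((contMDiffAt_of_mem_maximalAtlas he hx).mdifferentiableAt (by simp)).hasMFDerivAt
  have d2 : MDifferentiableAt 𝓘(ℝ, E) 𝓘(ℝ, E) e.symm (e x) :=
    (contMDiffAt_symm_of_mem_maximalAtlas he (e.map_source hx)).mdifferentiableAt (by simp)
  have h := (d1.comp (e x) d2.hasMFDerivAt).congr_of_eventuallyEq (f₁ := id) (by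
    filter_upwards [e.open_target.mem_nhds (e.map_source hx)] with y hy using (e.right_inv hy).symm)
  exact hasMFDerivAt_unique h (hasMFDerivAt_id (e x))

/-- Around `m` there is a chart in which the points with isotropy group `G_m` form the fixed space of a
projection `P`, the average of the linearized action of `G_m`. -/
theorem exists_slice_chart {EG : Type*} [NormedAddCommGroup EG] [NormedSpace ℝ EG] [FiniteDimensional ℝ EG]
    {G : Type*} [TopologicalSpace G] [T2Space G] [ChartedSpace EG G] [Group G]
    [LieGroup 𝓘(ℝ, EG) ∞ G]
    {E : Type*} [NormedAddCommGroup E] [NormedSpace ℝ E] [FiniteDimensional ℝ E]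
    {M : Type*} [TopologicalSpace M] [ChartedSpace E M]
    [IsManifold 𝓘(ℝ, E) ∞ M]
    [MulAction G M] [ContMDiffSMul 𝓘(ℝ, EG) 𝓘(ℝ, E) ∞ G M] [ProperSMul G M] (m : M) :
    ∃ (e : OpenPartialHomeomorph M E) (P : E →L[ℝ] E) (c : E) (ε : ℝ),
      e ∈ IsManifold.maximalAtlas 𝓘(ℝ, E) ∞ M ∧ P ∘L P = P ∧ m ∈ e.source ∧
      e.target = Metric.ball c ε ∧ P c = c ∧
      (∀ x ∈ e.source, MulAction.stabilizer G x = MulAction.stabilizer G m ↔ P (e x) = e x) ∧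
      ∀ x ∈ e.source, MulAction.stabilizer G x = MulAction.stabilizer G m →
        ∀ (v w : E) (α β : E →L[ℝ] ℝ),
          (∀ k ∈ MulAction.stabilizer G m,
            β ((mfderiv 𝓘(ℝ, E) 𝓘(ℝ, E) (fun y : M ↦ k⁻¹ • y) x : E →L[ℝ] E) v) +
            α ((mfderiv 𝓘(ℝ, E) 𝓘(ℝ, E) (fun y : M ↦ k • y) x : E →L[ℝ] E) w) = 0) →
          β ((mfderiv 𝓘(ℝ, E) 𝓘(ℝ, E) e.symm (e x) : E →L[ℝ] E)
            (P ((mfderiv 𝓘(ℝ, E) 𝓘(ℝ, E) e x : E →L[ℝ] E) v))) +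
          α ((mfderiv 𝓘(ℝ, E) 𝓘(ℝ, E) e.symm (e x) : E →L[ℝ] E)
            (P ((mfderiv 𝓘(ℝ, E) 𝓘(ℝ, E) e x : E →L[ℝ] E) w))) = 0 := by
  have : IsTopologicalGroup G := topologicalGroup_of_lieGroup 𝓘(ℝ, EG) ∞
  have hcomp := isCompact_stabilizer_of_properSMul (G := G) m
  have hlin := exists_linearizing_chart (EG := EG) (G := G) (E := E) m hcomp
  set H := MulAction.stabilizer G m
  obtain ⟨ρ, e₀, X, hρc, hρm, hρ1, he₀, hm₀, hX, he₀X, hequiv⟩ := hlin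
  have : CompactSpace H := isCompact_iff_compactSpace.1 hcomp
  let _ : MeasurableSpace H := borel H
  have : BorelSpace H := ⟨rfl⟩
  let μ : Measure H := Measure.haarMeasure ⊤
  have : IsProbabilityMeasure μ := ⟨Measure.haarMeasure_self (K₀ := ⊤)⟩
  have : ProperSpace (E →L[ℝ] E) := FiniteDimensional.proper ℝ _
  have hint : ∀ {V : Type _} [NormedAddCommGroup V] [NormedSpace ℝ V] [ProperSpace V] {f : H → V},
      Continuous f → Integrable f μ := fun hf ↦
    hf.integrable_of_hasCompactSupport (HasCompactSupport.of_compactSpace _)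
  let P : E →L[ℝ] E := ∫ k, ρ k ∂μ
  have hPv : ∀ v, P v = ∫ k, ρ k v ∂μ := fun v ↦ ContinuousLinearMap.integral_apply (hint hρc) v
  have hρP : ∀ g v, ρ g (P v) = P v := fun g v ↦ by
    have h1 : ρ g (P v) = ∫ k, ρ (g * k) v ∂μ := by
      rw [hPv, ← ContinuousLinearMap.integral_comp_comm _ (hint (by fun_prop))]
      simp only [hρm, ContinuousLinearMap.comp_apply]
    rw [h1, integral_mul_left_eq_self (fun k : H ↦ ρ k v) g, hPv]
  have hPfix : ∀ v, (∀ k, ρ k v = v) → P v = v := fun v h ↦ by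
    rw [hPv]; simp [h]
  have hPP : P ∘L P = P := by ext v; exact hPfix _ fun k ↦ hρP k v
  have hfixm : ∀ x ∈ X, MulAction.stabilizer G x = H → P (e₀ x) = e₀ x := fun x hx hs ↦
    hPfix _ fun k ↦ by
      rw [← (hequiv x hx k).2]
      have : k.1 ∈ MulAction.stabilizer G x := by rw [hs]; exact k.2
      rw [show k.1 • x = x from this]
  -- shrink the chart
  have hcs : Continuous (fun p : G × M ↦ p.1 • p.2) :=
    (contMDiff_smul : ContMDiff (𝓘(ℝ, EG).prod 𝓘(ℝ, E)) 𝓘(ℝ, E) ∞ (fun p : G × M ↦ p.1 • p.2)).continuous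
  have hS1 : IsOpen {x : M | ∀ k : H, k.1 • x ∈ e₀.source} := by
    have : {x : M | ∀ k : H, k.1 • x ∈ e₀.source}ᶜ =
        Prod.snd '' ((fun p : H × M ↦ p.1.1 • p.2) ⁻¹' e₀.sourceᶜ) := by
      ext z; simp
    rw [← isClosed_compl_iff, this]
    refine isClosedMap_snd_of_compactSpace _ (e₀.open_source.isClosed_compl.preimage ?_)
    exact hcs.comp ((continuous_subtype_val.comp continuous_fst).prodMk continuous_snd)
  have hm1 : m ∈ {x : M | ∀ k : H, k.1 • x ∈ e₀.source} := fun k ↦ by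
    rw [show k.1 • m = m from k.2]; exact hm₀
  have hV := inter_mem (inter_mem (e₀.open_source.mem_nhds hm₀) (hS1.mem_nhds hm1))
    (eventually_stabilizer_eq (G := G) (EG := EG) (E := E) m)
  have hV' := e₀.image_mem_nhds hm₀ hV
  obtain ⟨ε, ε0, hε⟩ := Metric.mem_nhds_iff.1 hV'
  set c := e₀ m
  -- The restriction is made on the inverse chart, so that the target becomes a ball. Its convexity
  -- later shows that the fixed points in the chart are connected.
  let e := (e₀.symm.restrOpen (Metric.ball c ε) Metric.isOpen_ball).symm
  have hball : Metric.ball c ε ⊆ e₀.target := fun w hw ↦ by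
    obtain ⟨x, hx, rfl⟩ := hε hw
    exact e₀.map_source hx.1.1
  have hee : ∀ x, e x = e₀ x := fun x ↦ rfl
  have htar : e.target = Metric.ball c ε := by
    change e₀.target ∩ Metric.ball c ε = _
    exact inter_eq_right.2 hball
  have hsrc : ∀ x, x ∈ e.source ↔ x ∈ e₀.source ∧ e₀ x ∈ Metric.ball c ε := fun x ↦ by
    exact Iff.rfl
  have hsrc2 : ∀ x ∈ e.source, (x ∈ e₀.source ∧ ∀ k : H, k.1 • x ∈ e₀.source) ∧
      (H ≤ MulAction.stabilizer G x → MulAction.stabilizer G x = H) := fun x hx ↦ by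
    obtain ⟨h1, h2⟩ := (hsrc x).1 hx
    obtain ⟨y, hy, hyx⟩ := hε h2
    rw [← e₀.injOn hy.1.1 h1 hyx]
    exact hy
  have heA : e ∈ IsManifold.maximalAtlas 𝓘(ℝ, E) ∞ M := by
    refine StructureGroupoid.mem_maximalAtlas_of_eqOnSource (G := contDiffGroupoid ∞ 𝓘(ℝ, E)) (e := e₀.restr e.source) ?_
      (restr_mem_maximalAtlas _ he₀ e.open_source)
    refine ⟨?_, fun x _ ↦ rfl⟩
    rw [OpenPartialHomeomorph.restr_source' _ _ e.open_source]
    exact (inter_eq_right.2 fun x hx ↦ (hsrc2 x hx).1.1).symm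
  refine ⟨e, P, c, ε, heA, hPP, (hsrc m).2 ⟨hm₀, Metric.mem_ball_self ε0⟩, htar,
    hfixm m (he₀X hm₀) rfl, fun x hx ↦ ⟨fun h ↦ hfixm x (he₀X (hsrc2 x hx).1.1) h, fun h ↦ ?_⟩, ?_⟩
  -- A vector fixed by `P` is fixed by every `ρ g`, so `x` is fixed by all of `H`. The inclusion is
  -- then an equality by the choice of neighbourhood.
  · obtain ⟨⟨h1, h2⟩, h3⟩ := hsrc2 x hx
    refine h3 fun g hg ↦ ?_
    refine e₀.injOn (h2 ⟨g, hg⟩) h1 ?_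
    rw [(hequiv x (he₀X h1) ⟨g, hg⟩).2]
    have h' : P (e₀ x) = e₀ x := h
    rw [← h', hρP]
  · intro x hx hs v w α β hk
    set T : E →L[ℝ] E := mfderiv 𝓘(ℝ, E) 𝓘(ℝ, E) e x with hT
    set S : E →L[ℝ] E := mfderiv 𝓘(ℝ, E) 𝓘(ℝ, E) e.symm (e x)
    have hST : S ∘L T = ContinuousLinearMap.id ℝ E := mfderiv_symm_comp_mfderiv_of_mem_maximalAtlas heA hx
    -- The isotropy group fixes `x` itself, so differentiating the equivariance of `e` at `x`
    -- conjugates the tangent action to `ρ`.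
    have hder : ∀ k : H, (mfderiv 𝓘(ℝ, E) 𝓘(ℝ, E) (fun y : M ↦ k.1 • y) x : E →L[ℝ] E) =
        S ∘L ρ k ∘L T := by
      intro k
      have hkx : k.1 • x = x := by
        have : k.1 ∈ MulAction.stabilizer G x := by rw [hs]; exact k.2
        exact this
      have d1 : MDifferentiableAt 𝓘(ℝ, E) 𝓘(ℝ, E) e x :=
        (contMDiffAt_of_mem_maximalAtlas heA hx).mdifferentiableAt (by simp)
      have d2 : MDifferentiableAt 𝓘(ℝ, E) 𝓘(ℝ, E) (fun y : M ↦ k.1 • y) x :=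
        ((contMDiff_smul : ContMDiff (𝓘(ℝ, EG).prod 𝓘(ℝ, E)) 𝓘(ℝ, E) ∞ (fun p : G × M ↦ p.1 • p.2)).comp
          (contMDiff_const.prodMk contMDiff_id) :
          ContMDiff 𝓘(ℝ, E) 𝓘(ℝ, E) ∞ (fun y : M ↦ k.1 • y)).mdifferentiableAt (by simp)
      have h1 : HasMFDerivAt 𝓘(ℝ, E) 𝓘(ℝ, E) (fun y ↦ ρ k (e y)) x (ρ k ∘L T) :=
        HasMFDerivAt.comp x ((ρ k).hasMFDerivAt) d1.hasMFDerivAt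
      have d1' : HasMFDerivAt 𝓘(ℝ, E) 𝓘(ℝ, E) e (k.1 • x) T := by
        rw [hT, hkx]; exact d1.hasMFDerivAt
      have h2 := d1'.comp x d2.hasMFDerivAt
      have h3 := hasMFDerivAt_unique (h2.congr_of_eventuallyEq (f₁ := fun y ↦ ρ k (e y)) (by
        filter_upwards [hX.mem_nhds (he₀X (hsrc2 x hx).1.1)] with y hy using ((hequiv y hy k).2).symm)) h1
      have h4 : T ∘L (mfderiv 𝓘(ℝ, E) 𝓘(ℝ, E) (fun y : M ↦ k.1 • y) x : E →L[ℝ] E) = ρ k ∘L T := h3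
      ext u
      have h5 := congrArg (fun L : E →L[ℝ] E ↦ S (L u)) h4
      have h6 := DFunLike.congr_fun hST
        ((mfderiv 𝓘(ℝ, E) 𝓘(ℝ, E) (fun y : M ↦ k.1 • y) x : E →L[ℝ] E) u)
      exact h6.symm.trans h5
    have h1 : ∀ k : H, β (S (ρ k⁻¹ (T v))) + α (S (ρ k (T w))) = 0 := fun k ↦ by
      have := hk k k.2
      rw [show (k.1)⁻¹ = (k⁻¹ : H).1 from rfl, hder, hder] at this
      exact this
    have h2 : ∀ (γ : E →L[ℝ] ℝ) (u : E), γ (S (P u)) = ∫ k, γ (S (ρ k u)) ∂μ := fun γ u ↦ by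
      rw [hPv]
      exact ((γ ∘L S).integral_comp_comm (hint (by fun_prop))).symm
    refine (congrArg₂ (· + ·) (h2 β (T v)) (h2 α (T w))).trans ?_
    -- The hypothesis has `k⁻¹` on `v` and `k` on `w`. Invariance under inversion lets both terms
    -- integrate to the same mean `P`.
    rw [← integral_inv_haar μ (fun k ↦ β (S (ρ k (T v)))), ← integral_add]
    · simp [h1]
    · exact Continuous.integrable_of_hasCompactSupport (by fun_prop) (HasCompactSupport.of_compactSpace _)
    · exact Continuous.integrable_of_hasCompactSupport (by fun_prop) (HasCompactSupport.of_compactSpace _)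

end

/-! ### Naturality of the Lie bracket, exterior derivative and Courant bracket -/

section

open MeasureTheory Set Filter VectorField Bundle

theorem fderiv_lieBracket_of_related {E F : Type*} [NormedAddCommGroup E] [NormedSpace ℝ E]
    [NormedAddCommGroup F] [NormedSpace ℝ F] {f : F → E} {x : F} (hf : ContDiffAt ℝ ∞ f x)
    {V W : F → F} {V' W' : E → E} (hV : DifferentiableAt ℝ V x) (hW : DifferentiableAt ℝ W x)
    (hV' : DifferentiableAt ℝ V' (f x)) (hW' : DifferentiableAt ℝ W' (f x))
    (h : ∀ᶠ u in 𝓝 x, fderiv ℝ f u (V u) = V' (f u))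
    (h' : ∀ᶠ u in 𝓝 x, fderiv ℝ f u (W u) = W' (f u)) :
    fderiv ℝ f x (lieBracket ℝ V W x) = lieBracket ℝ V' W' (f x) := by
  have hfx : DifferentiableAt ℝ f x := hf.differentiableAt (by simp)
  rw [fderiv_apply_lieBracket hf (by rw [minSmoothness_of_isRCLikeNormedField]; exact WithTop.coe_le_coe.2 (le_top : (_ : ℕ∞) ≤ ⊤)) hW hV, Filter.EventuallyEq.fderiv_eq h,
    Filter.EventuallyEq.fderiv_eq h']
  have e1 : fderiv ℝ (fun u ↦ V' (f u)) x = (fderiv ℝ V' (f x)).comp (fderiv ℝ f x) :=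
    fderiv_comp x hV' hfx
  have e2 : fderiv ℝ (fun u ↦ W' (f u)) x = (fderiv ℝ W' (f x)).comp (fderiv ℝ f x) :=
    fderiv_comp x hW' hfx
  rw [e1, e2]
  simp only [ContinuousLinearMap.comp_apply, lieBracket, h.self_of_nhds, h'.self_of_nhds]

/-- Differentiating the pull-back produces an extra term in the second derivative of `f`, which is
symmetric and disappears on antisymmetrization: `d` commutes with pull-back. -/
theorem fderiv_sub_flip_of_eq_comp_fderiv {E F : Type*} [NormedAddCommGroup E] [NormedSpace ℝ E]
    [NormedAddCommGroup F] [NormedSpace ℝ F] {f : F → E} {x : F} (hf : ContDiffAt ℝ ∞ f x)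
    {a : E → E →L[ℝ] ℝ} {b : F → F →L[ℝ] ℝ} (ha : DifferentiableAt ℝ a (f x))
    (h : ∀ᶠ u in 𝓝 x, b u = (a (f u)).comp (fderiv ℝ f u)) (v w : F) :
    fderiv ℝ b x v w - fderiv ℝ b x w v =
      fderiv ℝ a (f x) (fderiv ℝ f x v) (fderiv ℝ f x w) -
        fderiv ℝ a (f x) (fderiv ℝ f x w) (fderiv ℝ f x v) := by
  have hfx : DifferentiableAt ℝ f x := hf.differentiableAt (by simp)
  have hdf : DifferentiableAt ℝ (fderiv ℝ f) x :=
    (hf.fderiv_right (m := 1) (by exact WithTop.coe_le_coe.2 (le_top : (_ : ℕ∞) ≤ ⊤))).differentiableAt (by simp)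
  have e1 : HasFDerivAt (fun u ↦ a (f u)) ((fderiv ℝ a (f x)).comp (fderiv ℝ f x)) x :=
    ha.hasFDerivAt.comp x hfx.hasFDerivAt
  have e2 := e1.clm_comp hdf.hasFDerivAt
  rw [(e2.congr_of_eventuallyEq h).fderiv]
  have hs := hf.isSymmSndFDerivAt (by rw [minSmoothness_of_isRCLikeNormedField]; exact WithTop.coe_le_coe.2 (le_top : (_ : ℕ∞) ≤ ⊤)) v w
  simp [hs]

section
variable {E : Type*} [NormedAddCommGroup E] [NormedSpace ℝ E]
  {M : Type*} [TopologicalSpace M] [ChartedSpace E M] [IsManifold 𝓘(ℝ, E) ∞ M]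

/-- Stated for fields along a map, because frames of `D` are also read along the inclusion of `Q`.
-/
theorem contMDiffAt_vectorField_iff {N F : Type*} [NormedAddCommGroup F] [NormedSpace ℝ F]
    [TopologicalSpace N] [ChartedSpace F N] {f : N → M} {n : N} {x₀ : M}
    (hf : ContMDiffAt 𝓘(ℝ, F) 𝓘(ℝ, E) ∞ f n) (hx₀ : f n = x₀)
    (X : ∀ y : N, TangentSpace 𝓘(ℝ, E) (f y)) :
    ContMDiffAt 𝓘(ℝ, F) 𝓘(ℝ, E).tangent ∞
      (fun y ↦ (⟨f y, X y⟩ : TangentBundle 𝓘(ℝ, E) M)) n ↔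
    ContMDiffAt 𝓘(ℝ, F) 𝓘(ℝ, E) ∞
      (fun y ↦ (mfderiv 𝓘(ℝ, E) 𝓘(ℝ, E) (extChartAt 𝓘(ℝ, E) x₀) (f y) : E →L[ℝ] E) (X y)) n := by
  subst hx₀
  have hev : ∀ᶠ y in 𝓝 n, f y ∈ (chartAt E (f n)).source :=
    hf.continuousAt (chart_source_mem_nhds E (f n))
  have key := contMDiffAt_totalSpace (IM := 𝓘(ℝ, F)) (IB := 𝓘(ℝ, E)) (n := ∞)
    (f := fun y ↦ (⟨f y, X y⟩ : TangentBundle 𝓘(ℝ, E) M)) (x₀ := n)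
  have hev2 : (fun y ↦ (trivializationAt E (TangentSpace 𝓘(ℝ, E)) (f n) ⟨f y, X y⟩).2) =ᶠ[𝓝 n]
      (fun y ↦ (mfderiv 𝓘(ℝ, E) 𝓘(ℝ, E) (extChartAt 𝓘(ℝ, E) (f n)) (f y) : E →L[ℝ] E) (X y)) := by
    filter_upwards [hev] with y hy
    have h1 := TangentBundle.continuousLinearMapAt_trivializationAt (I := 𝓘(ℝ, E)) hy
    have h2 := congrArg (fun A : E →L[ℝ] E ↦ A (X y)) h1
    refine Eq.trans ?_ h2
    exact ((trivializationAt E (TangentSpace 𝓘(ℝ, E)) (f n)).continuousLinearMapAt_apply_of_mem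
      (R := ℝ) (b := f y) (by simpa using hy) (X y)).symm
  exact key.trans ⟨fun h ↦ h.2.congr_of_eventuallyEq hev2.symm,
    fun h ↦ ⟨hf, h.congr_of_eventuallyEq hev2⟩⟩

theorem contMDiffAt_oneForm_iff {x₀ : M} (α : ∀ x : M, TangentSpace 𝓘(ℝ, E) x →L[ℝ] ℝ) :
    ContMDiffAt 𝓘(ℝ, E) (𝓘(ℝ, E).prod 𝓘(ℝ, E →L[ℝ] ℝ)) ∞
      (fun x ↦ TotalSpace.mk' (E →L[ℝ] ℝ)
        (E := fun x : M ↦ (TangentSpace 𝓘(ℝ, E) x →L[ℝ] Bundle.Trivial M ℝ x)) x (α x)) x₀ ↔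
    ContDiffAt ℝ ∞ (DiracGeometry.oneFormInChart α x₀) (extChartAt 𝓘(ℝ, E) x₀ x₀) := by
  set φ := extChartAt 𝓘(ℝ, E) x₀ with hφ
  set c : M → E →L[ℝ] ℝ := fun x ↦ ContinuousLinearMap.inCoordinates E (TangentSpace 𝓘(ℝ, E)) ℝ
        (Bundle.Trivial M ℝ) x₀ x x₀ x (α x) with hc
  have hcoord : ∀ x ∈ φ.source, c x = DiracGeometry.oneFormInChart α x₀ (φ x) := by
    intro x hx
    have hx' : x ∈ (chartAt E x₀).source := by simpa [hφ] using hx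
    have h1 := TangentBundle.symmL_trivializationAt (I := 𝓘(ℝ, E)) hx'
    ext v
    have h2 : (α x) ((trivializationAt E (TangentSpace 𝓘(ℝ, E)) x₀).symmL ℝ x v) =
      (α x) (mfderivWithin 𝓘(ℝ, E) 𝓘(ℝ, E) (extChartAt 𝓘(ℝ, E) x₀).symm (range 𝓘(ℝ, E))
        (extChartAt 𝓘(ℝ, E) x₀ x) v) :=
      congrArg (fun A : E →L[ℝ] E ↦ (α x) (A v)) h1
    have h3 := mfderivWithin_univ (I := 𝓘(ℝ, E)) (I' := 𝓘(ℝ, E)) (f := (extChartAt 𝓘(ℝ, E) x₀).symm)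
    have h4 : range 𝓘(ℝ, E) = univ := by simp
    rw [h4, h3] at h2
    have h5 : φ.symm (φ x) = x := φ.left_inv hx
    simp only [hc, ContinuousLinearMap.inCoordinates,
      Bundle.Trivial.fiberBundle_trivializationAt',
      Bundle.Trivial.continuousLinearMapAt_trivialization]
    refine Eq.trans h2 ?_
    -- The base points are equal but not definitionally so. The comparison is made on `E`, the
    -- common model of all tangent spaces, to avoid transport between fibres.
    have h6 : ∀ y, y = x → ∀ w : E, (α x : E → ℝ) w = (α y : E → ℝ) w := by
      rintro y rfl w; rfl
    exact h6 _ h5 _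
  have key := contMDiffAt_hom_bundle (IM := 𝓘(ℝ, E)) (IB := 𝓘(ℝ, E)) (n := ∞)
    (fun x ↦ TotalSpace.mk' (E →L[ℝ] ℝ)
        (E := fun x : M ↦ (TangentSpace 𝓘(ℝ, E) x →L[ℝ] Bundle.Trivial M ℝ x)) x (α x)) (x₀ := x₀)
  have hsrc : φ.source ∈ 𝓝 x₀ := extChartAt_source_mem_nhds (I := 𝓘(ℝ, E)) x₀
  refine key.trans ⟨fun h ↦ ?_, fun h ↦ ⟨contMDiffAt_id, ?_⟩⟩
  · have h1 : ContMDiffAt 𝓘(ℝ, E) 𝓘(ℝ, E →L[ℝ] ℝ) ∞ c (φ.symm (φ x₀)) := by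
      rw [extChartAt_to_inv]; exact h.2
    have h2 : ContMDiffAt 𝓘(ℝ, E) 𝓘(ℝ, E) ∞ φ.symm (φ x₀) :=
      (contMDiffOn_extChartAt_symm x₀).contMDiffAt (extChartAt_target_mem_nhds x₀)
    refine (contMDiffAt_iff_contDiffAt.1 (h1.comp (φ x₀) h2)).congr_of_eventuallyEq ?_
    filter_upwards [extChartAt_target_mem_nhds (I := 𝓘(ℝ, E)) x₀] with u hu
    rw [Function.comp_apply, hcoord _ (φ.map_target hu), φ.right_inv hu]
  · have h1 := (contMDiffAt_iff_contDiffAt.2 h).comp x₀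
      (contMDiffAt_extChartAt (I := 𝓘(ℝ, E)) (n := ∞) (x := x₀))
    refine h1.congr_of_eventuallyEq ?_
    filter_upwards [hsrc] with x hx
    exact hcoord x hx

end

section
variable {E : Type*} [NormedAddCommGroup E] [NormedSpace ℝ E]
  {M : Type*} [TopologicalSpace M] [ChartedSpace E M] [IsManifold 𝓘(ℝ, E) ∞ M]
  {F : Type*} [NormedAddCommGroup F] [NormedSpace ℝ F]
  {N : Type*} [TopologicalSpace N] [ChartedSpace F N] [IsManifold 𝓘(ℝ, F) ∞ N]

theorem mfderiv_extChartAt_comp_mfderiv_symm {x₀ : M} {u : E}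
    (hu : u ∈ (extChartAt 𝓘(ℝ, E) x₀).target) (v : E) :
    (mfderiv 𝓘(ℝ, E) 𝓘(ℝ, E) (extChartAt 𝓘(ℝ, E) x₀) ((extChartAt 𝓘(ℝ, E) x₀).symm u) :
      E →L[ℝ] E) ((mfderiv 𝓘(ℝ, E) 𝓘(ℝ, E) (extChartAt 𝓘(ℝ, E) x₀).symm u : E →L[ℝ] E) v) = v := by
  have h := mfderiv_extChartAt_comp_mfderivWithin_extChartAt_symm (I := 𝓘(ℝ, E)) hu
  have h3 := mfderivWithin_univ (I := 𝓘(ℝ, E)) (I' := 𝓘(ℝ, E)) (f := (extChartAt 𝓘(ℝ, E) x₀).symm)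
  have h4 : range 𝓘(ℝ, E) = univ := by simp
  rw [h4, h3] at h
  exact congrArg (fun A : E →L[ℝ] E ↦ A v) h

theorem mfderiv_symm_comp_mfderiv_extChartAt {x₀ : M} {u : E}
    (hu : u ∈ (extChartAt 𝓘(ℝ, E) x₀).target) (v : E) :
    (mfderiv 𝓘(ℝ, E) 𝓘(ℝ, E) (extChartAt 𝓘(ℝ, E) x₀).symm u : E →L[ℝ] E)
      ((mfderiv 𝓘(ℝ, E) 𝓘(ℝ, E) (extChartAt 𝓘(ℝ, E) x₀) ((extChartAt 𝓘(ℝ, E) x₀).symm u) :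
      E →L[ℝ] E) v) = v := by
  have h := mfderivWithin_extChartAt_symm_comp_mfderiv_extChartAt (I := 𝓘(ℝ, E)) hu
  have h3 := mfderivWithin_univ (I := 𝓘(ℝ, E)) (I' := 𝓘(ℝ, E)) (f := (extChartAt 𝓘(ℝ, E) x₀).symm)
  have h4 : range 𝓘(ℝ, E) = univ := by simp
  rw [h4, h3] at h
  exact congrArg (fun A : E →L[ℝ] E ↦ A v) h

theorem mpullbackWithin_extChartAt_symm_eq {x₀ : M} {u : E}
    (hu : u ∈ (extChartAt 𝓘(ℝ, E) x₀).target) (X : ∀ x : M, TangentSpace 𝓘(ℝ, E) x) :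
    mpullbackWithin 𝓘(ℝ, E) 𝓘(ℝ, E) (extChartAt 𝓘(ℝ, E) x₀).symm X (range 𝓘(ℝ, E)) u =
      (mfderiv 𝓘(ℝ, E) 𝓘(ℝ, E) (extChartAt 𝓘(ℝ, E) x₀) ((extChartAt 𝓘(ℝ, E) x₀).symm u) :
      E →L[ℝ] E) (X ((extChartAt 𝓘(ℝ, E) x₀).symm u)) := by
  rw [mpullbackWithin_apply]
  have h3 := mfderivWithin_univ (I := 𝓘(ℝ, E)) (I' := 𝓘(ℝ, E)) (f := (extChartAt 𝓘(ℝ, E) x₀).symm)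
  have h4 : range 𝓘(ℝ, E) = univ := by simp
  rw [h4, h3]
  set A : E →L[ℝ] E := mfderiv 𝓘(ℝ, E) 𝓘(ℝ, E) (extChartAt 𝓘(ℝ, E) x₀).symm u with hA
  set B : E →L[ℝ] E := mfderiv 𝓘(ℝ, E) 𝓘(ℝ, E) (extChartAt 𝓘(ℝ, E) x₀)
    ((extChartAt 𝓘(ℝ, E) x₀).symm u) with hB
  have h5 : A.inverse = B := ContinuousLinearMap.inverse_eq
    (by ext v; exact mfderiv_symm_comp_mfderiv_extChartAt hu v)
    (by ext v; exact mfderiv_extChartAt_comp_mfderiv_symm hu v)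
  exact congrArg (fun A : E →L[ℝ] E ↦ A (X ((extChartAt 𝓘(ℝ, E) x₀).symm u))) h5

/-- The preferred chart at `x₀` has identity derivative at `x₀`, so nothing remains of the final
pull-back in the definition of the bracket. -/
theorem mlieBracket_eq_lieBracket_extChartAt (X Y : ∀ x : M, TangentSpace 𝓘(ℝ, E) x) (x₀ : M) :
    mlieBracket 𝓘(ℝ, E) X Y x₀ = lieBracket ℝ
      (mpullbackWithin 𝓘(ℝ, E) 𝓘(ℝ, E) (extChartAt 𝓘(ℝ, E) x₀).symm X (range 𝓘(ℝ, E)))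
      (mpullbackWithin 𝓘(ℝ, E) 𝓘(ℝ, E) (extChartAt 𝓘(ℝ, E) x₀).symm Y (range 𝓘(ℝ, E)))
      (extChartAt 𝓘(ℝ, E) x₀ x₀) := by
  rw [← mlieBracketWithin_univ, mlieBracketWithin_apply, mfderiv_extChartAt_self]
  have h4 : (extChartAt 𝓘(ℝ, E) x₀).symm ⁻¹' univ ∩ range 𝓘(ℝ, E) = univ := by simp
  rw [h4]
  have h5 : (ContinuousLinearMap.id ℝ E).inverse = ContinuousLinearMap.id ℝ E :=
    ContinuousLinearMap.inverse_id
  refine (congrArg (fun A : E →L[ℝ] E ↦ A _) h5).trans ?_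
  exact congrFun (lieBracketWithin_univ (𝕜 := ℝ)) _

omit [IsManifold 𝓘(ℝ, E) ∞ M] [IsManifold 𝓘(ℝ, F) ∞ N] in
theorem contDiffAt_writtenInExtChartAt {f : N → M} {y : N}
    (hf : ContMDiffAt 𝓘(ℝ, F) 𝓘(ℝ, E) ∞ f y) :
    ContDiffAt ℝ ∞ (writtenInExtChartAt 𝓘(ℝ, F) 𝓘(ℝ, E) y f) (extChartAt 𝓘(ℝ, F) y y) := by
  have h := (contMDiffAt_iff.1 hf).2
  rwa [show range 𝓘(ℝ, F) = univ by simp, contDiffWithinAt_univ] at h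

theorem eventually_fderiv_writtenInExtChartAt {f : N → M} {y : N}
    (hf : ∀ᶠ z in 𝓝 y, MDifferentiableAt 𝓘(ℝ, F) 𝓘(ℝ, E) f z) :
    ∀ᶠ u in 𝓝 (extChartAt 𝓘(ℝ, F) y y), u ∈ (extChartAt 𝓘(ℝ, F) y).target ∧
      f ((extChartAt 𝓘(ℝ, F) y).symm u) ∈ (extChartAt 𝓘(ℝ, E) (f y)).source ∧
      ∀ v : F, fderiv ℝ (writtenInExtChartAt 𝓘(ℝ, F) 𝓘(ℝ, E) y f) u v =
        (mfderiv 𝓘(ℝ, E) 𝓘(ℝ, E) (extChartAt 𝓘(ℝ, E) (f y))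
          (f ((extChartAt 𝓘(ℝ, F) y).symm u)) : E →L[ℝ] E)
        ((mfderiv 𝓘(ℝ, F) 𝓘(ℝ, E) f ((extChartAt 𝓘(ℝ, F) y).symm u) : F →L[ℝ] E)
        ((mfderiv 𝓘(ℝ, F) 𝓘(ℝ, F) (extChartAt 𝓘(ℝ, F) y).symm u : F →L[ℝ] F) v)) := by
  have hc : ContinuousAt (extChartAt 𝓘(ℝ, F) y).symm (extChartAt 𝓘(ℝ, F) y y) :=
    continuousAt_extChartAt_symm y
  have hto : Tendsto (extChartAt 𝓘(ℝ, F) y).symm (𝓝 (extChartAt 𝓘(ℝ, F) y y)) (𝓝 y) := by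
    have := hc.tendsto
    rwa [extChartAt_to_inv] at this
  have hsrc : ∀ᶠ z in 𝓝 y, f z ∈ (extChartAt 𝓘(ℝ, E) (f y)).source :=
    hf.self_of_nhds.continuousAt (extChartAt_source_mem_nhds (I := 𝓘(ℝ, E)) (f y))
  filter_upwards [extChartAt_target_mem_nhds (I := 𝓘(ℝ, F)) y, hto hf, hto hsrc] with u h1 h2 h3
  refine ⟨h1, h3, fun v ↦ ?_⟩
  have a1 : MDifferentiableAt 𝓘(ℝ, F) 𝓘(ℝ, F) (extChartAt 𝓘(ℝ, F) y).symm u :=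
    ((contMDiffOn_extChartAt_symm (n := ∞) y).contMDiffAt
      (extChartAt_target_mem_nhds' h1)).mdifferentiableAt (by simp)
  have a2 : MDifferentiableAt 𝓘(ℝ, E) 𝓘(ℝ, E) (extChartAt 𝓘(ℝ, E) (f y))
      (f ((extChartAt 𝓘(ℝ, F) y).symm u)) :=
    mdifferentiableAt_extChartAt (by simpa using h3)
  have a3 := HasMFDerivAt.comp (g := extChartAt 𝓘(ℝ, E) (f y))
    (f := f ∘ (extChartAt 𝓘(ℝ, F) y).symm) u a2.hasMFDerivAt
    (HasMFDerivAt.comp u (MDifferentiableAt.hasMFDerivAt h2) a1.hasMFDerivAt)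
  have a4 := HasFDerivAt.fderiv (𝕜 := ℝ) (E := F) (F := E) a3.hasFDerivAt
  exact congrArg (fun A : F →L[ℝ] E ↦ A v) a4

omit [IsManifold 𝓘(ℝ, E) ∞ M] [IsManifold 𝓘(ℝ, F) ∞ N] in
theorem fderiv_writtenInExtChartAt_self {f : N → M} {y : N}
    (hf : MDifferentiableAt 𝓘(ℝ, F) 𝓘(ℝ, E) f y) :
    fderiv ℝ (writtenInExtChartAt 𝓘(ℝ, F) 𝓘(ℝ, E) y f) (extChartAt 𝓘(ℝ, F) y y) =
      mfderiv 𝓘(ℝ, F) 𝓘(ℝ, E) f y := by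
  have h : (mfderiv 𝓘(ℝ, F) 𝓘(ℝ, E) f y : F →L[ℝ] E) =
      fderivWithin ℝ (writtenInExtChartAt 𝓘(ℝ, F) 𝓘(ℝ, E) y f) (range 𝓘(ℝ, F))
        (extChartAt 𝓘(ℝ, F) y y) := if_pos hf
  rw [show range 𝓘(ℝ, F) = univ by simp, fderivWithin_univ] at h
  exact h.symm

section
variable {f : N → M} {y : N} (hf : ContMDiffAt 𝓘(ℝ, F) 𝓘(ℝ, E) ∞ f y)
include hf

theorem eventually_mdifferentiableAt_of_contMDiffAt :
    ∀ᶠ z in 𝓝 y, MDifferentiableAt 𝓘(ℝ, F) 𝓘(ℝ, E) f z := by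
  have h1 : ContMDiffAt 𝓘(ℝ, F) 𝓘(ℝ, E) 1 f y := hf.of_le (by exact_mod_cast le_top)
  filter_upwards [(contMDiffAt_iff_contMDiffAt_nhds (by simp)).1 h1] with z hz using
    hz.mdifferentiableAt (by simp)

theorem eventually_fderiv_mpullback_eq {X : ∀ x : M, TangentSpace 𝓘(ℝ, E) x}
    {X' : ∀ z : N, TangentSpace 𝓘(ℝ, F) z}
    (hX : ∀ᶠ z in 𝓝 y, mfderiv 𝓘(ℝ, F) 𝓘(ℝ, E) f z (X' z) = X (f z)) :
    ∀ᶠ u in 𝓝 (extChartAt 𝓘(ℝ, F) y y),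
      fderiv ℝ (writtenInExtChartAt 𝓘(ℝ, F) 𝓘(ℝ, E) y f) u
        (mpullbackWithin 𝓘(ℝ, F) 𝓘(ℝ, F) (extChartAt 𝓘(ℝ, F) y).symm X' (range 𝓘(ℝ, F)) u) =
      mpullbackWithin 𝓘(ℝ, E) 𝓘(ℝ, E) (extChartAt 𝓘(ℝ, E) (f y)).symm X (range 𝓘(ℝ, E))
        (writtenInExtChartAt 𝓘(ℝ, F) 𝓘(ℝ, E) y f u) := by
  have hto : Tendsto (extChartAt 𝓘(ℝ, F) y).symm (𝓝 (extChartAt 𝓘(ℝ, F) y y)) (𝓝 y) := by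
    have := (continuousAt_extChartAt_symm (I := 𝓘(ℝ, F)) y).tendsto
    rwa [extChartAt_to_inv] at this
  filter_upwards [hto hX, eventually_fderiv_writtenInExtChartAt
    (eventually_mdifferentiableAt_of_contMDiffAt hf)] with u h1 ⟨h2, h3, h4⟩
  have h1' : mfderiv 𝓘(ℝ, F) 𝓘(ℝ, E) f ((extChartAt 𝓘(ℝ, F) y).symm u)
    (X' ((extChartAt 𝓘(ℝ, F) y).symm u)) = X (f ((extChartAt 𝓘(ℝ, F) y).symm u)) := h1
  have h5 : writtenInExtChartAt 𝓘(ℝ, F) 𝓘(ℝ, E) y f u =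
    extChartAt 𝓘(ℝ, E) (f y) (f ((extChartAt 𝓘(ℝ, F) y).symm u)) := rfl
  have h6 : (extChartAt 𝓘(ℝ, E) (f y)).symm (writtenInExtChartAt 𝓘(ℝ, F) 𝓘(ℝ, E) y f u) =
    f ((extChartAt 𝓘(ℝ, F) y).symm u) := by rw [h5, PartialEquiv.left_inv _ h3]
  have h7 : mpullbackWithin 𝓘(ℝ, E) 𝓘(ℝ, E) (extChartAt 𝓘(ℝ, E) (f y)).symm X (range 𝓘(ℝ, E))
      (writtenInExtChartAt 𝓘(ℝ, F) 𝓘(ℝ, E) y f u) =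
      (mfderiv 𝓘(ℝ, E) 𝓘(ℝ, E) (extChartAt 𝓘(ℝ, E) (f y)) (f ((extChartAt 𝓘(ℝ, F) y).symm u)) :
      E →L[ℝ] E) (X (f ((extChartAt 𝓘(ℝ, F) y).symm u))) := by
    rw [mpullbackWithin_extChartAt_symm_eq (by rw [h5]; exact PartialEquiv.map_source _ h3), h6]
  refine (h4 _).trans (Eq.trans ?_ h7.symm)
  refine congrArg (mfderiv 𝓘(ℝ, E) 𝓘(ℝ, E) (extChartAt 𝓘(ℝ, E) (f y))
    (f ((extChartAt 𝓘(ℝ, F) y).symm u)) : E → E) (Eq.trans ?_ h1')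
  rw [mpullbackWithin_extChartAt_symm_eq h2]
  exact congrArg (mfderiv 𝓘(ℝ, F) 𝓘(ℝ, E) f ((extChartAt 𝓘(ℝ, F) y).symm u))
    (mfderiv_symm_comp_mfderiv_extChartAt h2 _)

theorem eventually_oneFormInChart_eq {α : ∀ x : M, TangentSpace 𝓘(ℝ, E) x →L[ℝ] ℝ}
    {α' : ∀ z : N, TangentSpace 𝓘(ℝ, F) z →L[ℝ] ℝ}
    (hα : ∀ᶠ z in 𝓝 y, α' z = (α (f z)).comp (mfderiv 𝓘(ℝ, F) 𝓘(ℝ, E) f z)) :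
    ∀ᶠ u in 𝓝 (extChartAt 𝓘(ℝ, F) y y), DiracGeometry.oneFormInChart α' y u =
      (DiracGeometry.oneFormInChart α (f y) (writtenInExtChartAt 𝓘(ℝ, F) 𝓘(ℝ, E) y f u)).comp
        (fderiv ℝ (writtenInExtChartAt 𝓘(ℝ, F) 𝓘(ℝ, E) y f) u) := by
  have hto : Tendsto (extChartAt 𝓘(ℝ, F) y).symm (𝓝 (extChartAt 𝓘(ℝ, F) y y)) (𝓝 y) := by
    have := (continuousAt_extChartAt_symm (I := 𝓘(ℝ, F)) y).tendsto
    rwa [extChartAt_to_inv] at this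
  filter_upwards [hto hα, eventually_fderiv_writtenInExtChartAt
    (eventually_mdifferentiableAt_of_contMDiffAt hf)] with u h1 ⟨h2, h3, h4⟩
  have h1' : α' ((extChartAt 𝓘(ℝ, F) y).symm u) = (α (f ((extChartAt 𝓘(ℝ, F) y).symm u))).comp
    (mfderiv 𝓘(ℝ, F) 𝓘(ℝ, E) f ((extChartAt 𝓘(ℝ, F) y).symm u)) := h1
  have h5 : writtenInExtChartAt 𝓘(ℝ, F) 𝓘(ℝ, E) y f u =
    extChartAt 𝓘(ℝ, E) (f y) (f ((extChartAt 𝓘(ℝ, F) y).symm u)) := rfl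
  have h6 : (extChartAt 𝓘(ℝ, E) (f y)).symm (writtenInExtChartAt 𝓘(ℝ, F) 𝓘(ℝ, E) y f u) =
    f ((extChartAt 𝓘(ℝ, F) y).symm u) := by rw [h5, PartialEquiv.left_inv _ h3]
  have h7 : writtenInExtChartAt 𝓘(ℝ, F) 𝓘(ℝ, E) y f u ∈ (extChartAt 𝓘(ℝ, E) (f y)).target := by
    rw [h5]; exact PartialEquiv.map_source _ h3
  ext v
  rw [ContinuousLinearMap.comp_apply, h4]
  have h10 : DiracGeometry.oneFormInChart α' y u v =
      (α (f ((extChartAt 𝓘(ℝ, F) y).symm u)) : E → ℝ)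
        ((mfderiv 𝓘(ℝ, F) 𝓘(ℝ, E) f ((extChartAt 𝓘(ℝ, F) y).symm u) : F →L[ℝ] E)
      ((mfderiv 𝓘(ℝ, F) 𝓘(ℝ, F) (extChartAt 𝓘(ℝ, F) y).symm u : F →L[ℝ] F) v)) :=
    DFunLike.congr_fun h1' _
  refine h10.trans ?_
  have h8 := mfderiv_symm_comp_mfderiv_extChartAt h7
    ((mfderiv 𝓘(ℝ, F) 𝓘(ℝ, E) f ((extChartAt 𝓘(ℝ, F) y).symm u) : F →L[ℝ] E)
      ((mfderiv 𝓘(ℝ, F) 𝓘(ℝ, F) (extChartAt 𝓘(ℝ, F) y).symm u : F →L[ℝ] F) v))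
  rw [h6] at h8
  have h9 : ∀ x x', x = x' → ∀ w : E, (α x : E → ℝ) w = (α x' : E → ℝ) w := by
    rintro x _ rfl w; rfl
  refine Eq.trans ?_ (h9 _ _ h6.symm _)
  exact (congrArg (α (f ((extChartAt 𝓘(ℝ, F) y).symm u)) : E → ℝ) h8).symm

end

end

section
variable {E : Type*} [NormedAddCommGroup E] [NormedSpace ℝ E]
  {M : Type*} [TopologicalSpace M] [ChartedSpace E M] [IsManifold 𝓘(ℝ, E) ∞ M]
  {F : Type*} [NormedAddCommGroup F] [NormedSpace ℝ F]
  {N : Type*} [TopologicalSpace N] [ChartedSpace F N] [IsManifold 𝓘(ℝ, F) ∞ N]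

theorem contMDiffAt_oneForm_apply {x₀ : M} {α : ∀ x : M, TangentSpace 𝓘(ℝ, E) x →L[ℝ] ℝ}
    {X : ∀ x : M, TangentSpace 𝓘(ℝ, E) x}
    (hα : ContMDiffAt 𝓘(ℝ, E) (𝓘(ℝ, E).prod 𝓘(ℝ, E →L[ℝ] ℝ)) ∞
      (fun x ↦ TotalSpace.mk' (E →L[ℝ] ℝ)
        (E := fun x : M ↦ (TangentSpace 𝓘(ℝ, E) x →L[ℝ] Bundle.Trivial M ℝ x)) x (α x)) x₀)
    (hX : ContMDiffAt 𝓘(ℝ, E) 𝓘(ℝ, E).tangent ∞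
      (fun x ↦ (⟨x, X x⟩ : TangentBundle 𝓘(ℝ, E) M)) x₀) :
    ContMDiffAt 𝓘(ℝ, E) 𝓘(ℝ, ℝ) ∞ (fun x ↦ α x (X x)) x₀ := by
  have h := ContMDiffAt.clm_bundle_apply (b := fun x : M ↦ x) (E₂ := Bundle.Trivial M ℝ)
    (F₂ := ℝ) hα hX
  exact ((contMDiffAt_section (E := Bundle.Trivial M ℝ) x₀).1 h)

theorem ContMDiffAt.oneForm_pullback {f : N → M} {y : N} (hf : ContMDiffAt 𝓘(ℝ, F) 𝓘(ℝ, E) ∞ f y)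
    {α : ∀ x : M, TangentSpace 𝓘(ℝ, E) x →L[ℝ] ℝ} {α' : ∀ z : N, TangentSpace 𝓘(ℝ, F) z →L[ℝ] ℝ}
    (hα : ContMDiffAt 𝓘(ℝ, E) (𝓘(ℝ, E).prod 𝓘(ℝ, E →L[ℝ] ℝ)) ∞
      (fun x ↦ TotalSpace.mk' (E →L[ℝ] ℝ)
        (E := fun x : M ↦ (TangentSpace 𝓘(ℝ, E) x →L[ℝ] Bundle.Trivial M ℝ x)) x (α x)) (f y))
    (h : ∀ᶠ z in 𝓝 y, α' z = (α (f z)).comp (mfderiv 𝓘(ℝ, F) 𝓘(ℝ, E) f z)) :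
    ContMDiffAt 𝓘(ℝ, F) (𝓘(ℝ, F).prod 𝓘(ℝ, F →L[ℝ] ℝ)) ∞
      (fun z ↦ TotalSpace.mk' (F →L[ℝ] ℝ)
        (E := fun z : N ↦ (TangentSpace 𝓘(ℝ, F) z →L[ℝ] Bundle.Trivial N ℝ z)) z (α' z)) y := by
  rw [contMDiffAt_oneForm_iff] at hα ⊢
  refine ContDiffAt.congr_of_eventuallyEq ?_ (eventually_oneFormInChart_eq hf h)
  have hw := contDiffAt_writtenInExtChartAt hf
  have hwy : writtenInExtChartAt 𝓘(ℝ, F) 𝓘(ℝ, E) y f (extChartAt 𝓘(ℝ, F) y y) =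
    extChartAt 𝓘(ℝ, E) (f y) (f y) := by simp [writtenInExtChartAt]
  rw [← hwy] at hα
  exact (hα.comp _ hw).clm_comp (hw.fderiv_right (m := ∞) (by simp))

theorem differentiableAt_oneFormInChart {x₀ : M} {α : ∀ x : M, TangentSpace 𝓘(ℝ, E) x →L[ℝ] ℝ}
    (hα : ContMDiffAt 𝓘(ℝ, E) (𝓘(ℝ, E).prod 𝓘(ℝ, E →L[ℝ] ℝ)) ∞
      (fun x ↦ TotalSpace.mk' (E →L[ℝ] ℝ)
        (E := fun x : M ↦ (TangentSpace 𝓘(ℝ, E) x →L[ℝ] Bundle.Trivial M ℝ x)) x (α x)) x₀) :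
    DifferentiableAt ℝ (DiracGeometry.oneFormInChart α x₀) (extChartAt 𝓘(ℝ, E) x₀ x₀) :=
  ((contMDiffAt_oneForm_iff α).1 hα).differentiableAt (by simp)

theorem differentiableAt_mpullbackWithin_extChartAt [CompleteSpace E] {x₀ : M}
    {X : ∀ x : M, TangentSpace 𝓘(ℝ, E) x}
    (hX : ContMDiffAt 𝓘(ℝ, E) 𝓘(ℝ, E).tangent ∞
      (fun x ↦ (⟨x, X x⟩ : TangentBundle 𝓘(ℝ, E) M)) x₀) :
    DifferentiableAt ℝ (E := E) (F := E) (mpullbackWithin 𝓘(ℝ, E) 𝓘(ℝ, E)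
      (extChartAt 𝓘(ℝ, E) x₀).symm X (range 𝓘(ℝ, E))) (extChartAt 𝓘(ℝ, E) x₀ x₀) := by
  have : IsManifold 𝓘(ℝ, E) 2 M := IsManifold.of_le (n := ∞)
    (WithTop.coe_le_coe.2 (le_top : (_ : ℕ∞) ≤ ⊤))
  have h1 : MDifferentiableWithinAt 𝓘(ℝ, E) 𝓘(ℝ, E).tangent
      (fun x ↦ (⟨x, X x⟩ : TangentBundle 𝓘(ℝ, E) M)) univ x₀ :=
    (hX.mdifferentiableAt (by simp)).mdifferentiableWithinAt
  have h2 := MDifferentiableWithinAt.differentiableWithinAt_mpullbackWithin_vectorField h1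
  have h4 : (extChartAt 𝓘(ℝ, E) x₀).symm ⁻¹' univ ∩ range 𝓘(ℝ, E) = univ := by simp
  rw [h4] at h2
  exact differentiableWithinAt_univ.1 h2

theorem extDerivOneForm_apply (α : ∀ x : M, TangentSpace 𝓘(ℝ, E) x →L[ℝ] ℝ) (x : M) (v w : E) :
    (DiracGeometry.extDerivOneForm α x : E →L[ℝ] E →L[ℝ] ℝ) v w =
      fderiv ℝ (DiracGeometry.oneFormInChart α x) (extChartAt 𝓘(ℝ, E) x x) v w -
      fderiv ℝ (DiracGeometry.oneFormInChart α x) (extChartAt 𝓘(ℝ, E) x x) w v := by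
  have e1 : (mfderiv 𝓘(ℝ, E) 𝓘(ℝ, E) (extChartAt 𝓘(ℝ, E) x) x : E →L[ℝ] E) =
    ContinuousLinearMap.id ℝ E := mfderiv_extChartAt_self
  set T : E →L[ℝ] E := mfderiv 𝓘(ℝ, E) 𝓘(ℝ, E) (extChartAt 𝓘(ℝ, E) x) x with hT
  set A := fderiv ℝ (DiracGeometry.oneFormInChart α x) (extChartAt 𝓘(ℝ, E) x x) with hA
  have e2 : (DiracGeometry.extDerivOneForm α x : E →L[ℝ] E →L[ℝ] ℝ) v w =
    (A - A.flip) (T v) (T w) := rfl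
  have e3 : T = ContinuousLinearMap.id ℝ E := e1
  rw [e2, e3]
  rfl

section
variable [CompleteSpace E] [CompleteSpace F]
  {f : N → M} {y : N} (hf : ContMDiffAt 𝓘(ℝ, F) 𝓘(ℝ, E) ∞ f y)
include hf

theorem mfderiv_mlieBracket_of_related
    {X Y : ∀ x : M, TangentSpace 𝓘(ℝ, E) x} {X' Y' : ∀ z : N, TangentSpace 𝓘(ℝ, F) z}
    (hX : ContMDiffAt 𝓘(ℝ, E) 𝓘(ℝ, E).tangent ∞
      (fun x ↦ (⟨x, X x⟩ : TangentBundle 𝓘(ℝ, E) M)) (f y))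
    (hY : ContMDiffAt 𝓘(ℝ, E) 𝓘(ℝ, E).tangent ∞
      (fun x ↦ (⟨x, Y x⟩ : TangentBundle 𝓘(ℝ, E) M)) (f y))
    (hX' : ContMDiffAt 𝓘(ℝ, F) 𝓘(ℝ, F).tangent ∞
      (fun x ↦ (⟨x, X' x⟩ : TangentBundle 𝓘(ℝ, F) N)) y)
    (hY' : ContMDiffAt 𝓘(ℝ, F) 𝓘(ℝ, F).tangent ∞
      (fun x ↦ (⟨x, Y' x⟩ : TangentBundle 𝓘(ℝ, F) N)) y)
    (h : ∀ᶠ z in 𝓝 y, mfderiv 𝓘(ℝ, F) 𝓘(ℝ, E) f z (X' z) = X (f z))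
    (h' : ∀ᶠ z in 𝓝 y, mfderiv 𝓘(ℝ, F) 𝓘(ℝ, E) f z (Y' z) = Y (f z)) :
    mfderiv 𝓘(ℝ, F) 𝓘(ℝ, E) f y (mlieBracket 𝓘(ℝ, F) X' Y' y) = mlieBracket 𝓘(ℝ, E) X Y (f y) := by
  have hwy : writtenInExtChartAt 𝓘(ℝ, F) 𝓘(ℝ, E) y f (extChartAt 𝓘(ℝ, F) y y) =
    extChartAt 𝓘(ℝ, E) (f y) (f y) := by simp [writtenInExtChartAt]
  have h1 := differentiableAt_mpullbackWithin_extChartAt hX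
  have h2 := differentiableAt_mpullbackWithin_extChartAt hY
  rw [← hwy] at h1 h2
  have key := fderiv_lieBracket_of_related (contDiffAt_writtenInExtChartAt hf)
    (differentiableAt_mpullbackWithin_extChartAt hX')
    (differentiableAt_mpullbackWithin_extChartAt hY') h1 h2
    (eventually_fderiv_mpullback_eq hf h) (eventually_fderiv_mpullback_eq hf h')
  rw [mlieBracket_eq_lieBracket_extChartAt, mlieBracket_eq_lieBracket_extChartAt, ← hwy]
  rw [fderiv_writtenInExtChartAt_self (hf.mdifferentiableAt (by simp))] at key
  exact key

omit [CompleteSpace E] [CompleteSpace F] in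
theorem extDerivOneForm_of_related {α : ∀ x : M, TangentSpace 𝓘(ℝ, E) x →L[ℝ] ℝ}
    {α' : ∀ z : N, TangentSpace 𝓘(ℝ, F) z →L[ℝ] ℝ}
    (hα : ContMDiffAt 𝓘(ℝ, E) (𝓘(ℝ, E).prod 𝓘(ℝ, E →L[ℝ] ℝ)) ∞
      (fun x ↦ TotalSpace.mk' (E →L[ℝ] ℝ)
        (E := fun x : M ↦ (TangentSpace 𝓘(ℝ, E) x →L[ℝ] Bundle.Trivial M ℝ x)) x (α x)) (f y))
    (h : ∀ᶠ z in 𝓝 y, α' z = (α (f z)).comp (mfderiv 𝓘(ℝ, F) 𝓘(ℝ, E) f z)) (v w : F) :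
    (DiracGeometry.extDerivOneForm α' y : F →L[ℝ] F →L[ℝ] ℝ) v w =
      (DiracGeometry.extDerivOneForm α (f y) : E →L[ℝ] E →L[ℝ] ℝ)
        ((mfderiv 𝓘(ℝ, F) 𝓘(ℝ, E) f y : F →L[ℝ] E) v)
        ((mfderiv 𝓘(ℝ, F) 𝓘(ℝ, E) f y : F →L[ℝ] E) w) := by
  have hwy : writtenInExtChartAt 𝓘(ℝ, F) 𝓘(ℝ, E) y f (extChartAt 𝓘(ℝ, F) y y) =
    extChartAt 𝓘(ℝ, E) (f y) (f y) := by simp [writtenInExtChartAt]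
  have h1 := differentiableAt_oneFormInChart hα
  rw [← hwy] at h1
  have key := fderiv_sub_flip_of_eq_comp_fderiv (contDiffAt_writtenInExtChartAt hf) h1
    (eventually_oneFormInChart_eq hf h) v w
  rw [fderiv_writtenInExtChartAt_self (hf.mdifferentiableAt (by simp)), hwy] at key
  rw [extDerivOneForm_apply]
  exact key.trans (extDerivOneForm_apply α (f y) _ _).symm

omit [CompleteSpace E] [CompleteSpace F] [IsManifold 𝓘(ℝ, E) ∞ M] [IsManifold 𝓘(ℝ, F) ∞ N] in
theorem differential_of_related {h : M → ℝ} {h' : N → ℝ}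
    (hh : ContMDiffAt 𝓘(ℝ, E) 𝓘(ℝ, ℝ) ∞ h (f y)) (hr : ∀ᶠ z in 𝓝 y, h' z = h (f z)) :
    DiracGeometry.differential (E := F) h' y =
      (DiracGeometry.differential (E := E) h (f y)).comp (mfderiv 𝓘(ℝ, F) 𝓘(ℝ, E) f y) := by
  have h1 : mfderiv 𝓘(ℝ, F) 𝓘(ℝ, ℝ) h' y = mfderiv 𝓘(ℝ, F) 𝓘(ℝ, ℝ) (h ∘ f) y :=
    Filter.EventuallyEq.mfderiv_eq hr
  exact h1.trans (mfderiv_comp y (hh.mdifferentiableAt (by simp)) (hf.mdifferentiableAt (by simp)))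

omit [CompleteSpace E] [CompleteSpace F] in
theorem lieDerivOneForm_of_related {α : ∀ x : M, TangentSpace 𝓘(ℝ, E) x →L[ℝ] ℝ}
    {α' : ∀ z : N, TangentSpace 𝓘(ℝ, F) z →L[ℝ] ℝ}
    {X : ∀ x : M, TangentSpace 𝓘(ℝ, E) x} {X' : ∀ z : N, TangentSpace 𝓘(ℝ, F) z}
    (hα : ContMDiffAt 𝓘(ℝ, E) (𝓘(ℝ, E).prod 𝓘(ℝ, E →L[ℝ] ℝ)) ∞
      (fun x ↦ TotalSpace.mk' (E →L[ℝ] ℝ)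
        (E := fun x : M ↦ (TangentSpace 𝓘(ℝ, E) x →L[ℝ] Bundle.Trivial M ℝ x)) x (α x)) (f y))
    (hX : ContMDiffAt 𝓘(ℝ, E) 𝓘(ℝ, E).tangent ∞
      (fun x ↦ (⟨x, X x⟩ : TangentBundle 𝓘(ℝ, E) M)) (f y))
    (h : ∀ᶠ z in 𝓝 y, α' z = (α (f z)).comp (mfderiv 𝓘(ℝ, F) 𝓘(ℝ, E) f z))
    (h' : ∀ᶠ z in 𝓝 y, mfderiv 𝓘(ℝ, F) 𝓘(ℝ, E) f z (X' z) = X (f z)) :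
    DiracGeometry.lieDerivOneForm X' α' y =
      (DiracGeometry.lieDerivOneForm X α (f y)).comp (mfderiv 𝓘(ℝ, F) 𝓘(ℝ, E) f y) := by
  have h1 := differential_of_related hf (contMDiffAt_oneForm_apply hα hX)
    (h' := fun z ↦ α' z (X' z)) (by
      filter_upwards [h, h'] with z hz hz'
      rw [hz, ← hz']; rfl)
  refine ContinuousLinearMap.ext fun v ↦ ?_
  have h2 := extDerivOneForm_of_related hf hα h (X' y) v
  have h3 := DFunLike.congr_fun h1 v
  have h4 := congrArg (fun u : E ↦ (DiracGeometry.extDerivOneForm α (f y) : E →L[ℝ] E →L[ℝ] ℝ) u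
    ((mfderiv 𝓘(ℝ, F) 𝓘(ℝ, E) f y : F →L[ℝ] E) v)) h'.self_of_nhds
  exact congrArg₂ (· + ·) (h2.trans h4) h3

/-- Each term of the bracket is natural: brackets of related fields are related, Cartan's formula
reduces Lie derivatives to `d` and contraction, and the functions being differentiated agree along
`f`. -/
theorem courantBracket_of_related {σ τ : DiracGeometry.PontryaginSection E M}
    {σ' τ' : DiracGeometry.PontryaginSection F N}
    (hσ : ContMDiffAt 𝓘(ℝ, E) 𝓘(ℝ, E).tangent ∞
      (fun x ↦ (⟨x, (σ x).1⟩ : TangentBundle 𝓘(ℝ, E) M)) (f y))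
    (hτ : ContMDiffAt 𝓘(ℝ, E) 𝓘(ℝ, E).tangent ∞
      (fun x ↦ (⟨x, (τ x).1⟩ : TangentBundle 𝓘(ℝ, E) M)) (f y))
    (hσ' : ContMDiffAt 𝓘(ℝ, F) 𝓘(ℝ, F).tangent ∞
      (fun x ↦ (⟨x, (σ' x).1⟩ : TangentBundle 𝓘(ℝ, F) N)) y)
    (hτ' : ContMDiffAt 𝓘(ℝ, F) 𝓘(ℝ, F).tangent ∞
      (fun x ↦ (⟨x, (τ' x).1⟩ : TangentBundle 𝓘(ℝ, F) N)) y)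
    (hσ2 : ContMDiffAt 𝓘(ℝ, E) (𝓘(ℝ, E).prod 𝓘(ℝ, E →L[ℝ] ℝ)) ∞
      (fun x ↦ TotalSpace.mk' (E →L[ℝ] ℝ)
        (E := fun x : M ↦ (TangentSpace 𝓘(ℝ, E) x →L[ℝ] Bundle.Trivial M ℝ x)) x (σ x).2) (f y))
    (hτ2 : ContMDiffAt 𝓘(ℝ, E) (𝓘(ℝ, E).prod 𝓘(ℝ, E →L[ℝ] ℝ)) ∞
      (fun x ↦ TotalSpace.mk' (E →L[ℝ] ℝ)
        (E := fun x : M ↦ (TangentSpace 𝓘(ℝ, E) x →L[ℝ] Bundle.Trivial M ℝ x)) x (τ x).2) (f y))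
    (h1 : ∀ᶠ z in 𝓝 y, mfderiv 𝓘(ℝ, F) 𝓘(ℝ, E) f z (σ' z).1 = (σ (f z)).1)
    (h2 : ∀ᶠ z in 𝓝 y, (σ' z).2 = (σ (f z)).2.comp (mfderiv 𝓘(ℝ, F) 𝓘(ℝ, E) f z))
    (h3 : ∀ᶠ z in 𝓝 y, mfderiv 𝓘(ℝ, F) 𝓘(ℝ, E) f z (τ' z).1 = (τ (f z)).1)
    (h4 : ∀ᶠ z in 𝓝 y, (τ' z).2 = (τ (f z)).2.comp (mfderiv 𝓘(ℝ, F) 𝓘(ℝ, E) f z)) :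
    mfderiv 𝓘(ℝ, F) 𝓘(ℝ, E) f y (DiracGeometry.courantBracket σ' τ' y).1 =
      (DiracGeometry.courantBracket σ τ (f y)).1 ∧
    (DiracGeometry.courantBracket σ' τ' y).2 =
      (DiracGeometry.courantBracket σ τ (f y)).2.comp (mfderiv 𝓘(ℝ, F) 𝓘(ℝ, E) f y) := by
  refine ⟨mfderiv_mlieBracket_of_related hf hσ hτ hσ' hτ' h1 h3, ?_⟩
  have a1 := lieDerivOneForm_of_related hf hτ2 hσ h4 h1
  have a2 := lieDerivOneForm_of_related hf hσ2 hτ h2 h3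
  have a3 := differential_of_related hf
    (h := fun x ↦ (σ x).2 (τ x).1 - (τ x).2 (σ x).1)
    (h' := fun x ↦ (σ' x).2 (τ' x).1 - (τ' x).2 (σ' x).1)
    ((contMDiffAt_oneForm_apply hσ2 hτ).sub (contMDiffAt_oneForm_apply hτ2 hσ)) (by
      filter_upwards [h1, h2, h3, h4] with z b1 b2 b3 b4
      rw [b2, b4, ← b1, ← b3]; rfl)
  refine ContinuousLinearMap.ext fun v ↦ ?_
  exact congrArg₂ (· + ·) (congrArg₂ (· - ·) (DFunLike.congr_fun a1 v) (DFunLike.congr_fun a2 v))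
    (congrArg ((1 / 2 : ℝ) • ·) (DFunLike.congr_fun a3 v))

end
end

/-! ### Coordinates on Pontryagin fibres and smooth coefficients -/

section
variable {E : Type*} [NormedAddCommGroup E] [NormedSpace ℝ E]
  {M : Type*} [TopologicalSpace M] [ChartedSpace E M]
  {F : Type*} [NormedAddCommGroup F] [NormedSpace ℝ F]
  {N : Type*} [TopologicalSpace N] [ChartedSpace F N]

/-- The coordinates of an element of the Pontryagin fibre at `x` in the preferred chart at `x₀`. -/
noncomputable def pontryaginCoord (x₀ x : M) :
    (E × (E →L[ℝ] ℝ)) →ₗ[ℝ] (E × (E →L[ℝ] ℝ)) :=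
  LinearMap.prodMap
    (ContinuousLinearMap.toLinearMap
      (mfderiv 𝓘(ℝ, E) 𝓘(ℝ, E) (extChartAt 𝓘(ℝ, E) x₀) x : E →L[ℝ] E))
    (ContinuousLinearMap.toLinearMap ((ContinuousLinearMap.compL ℝ E E ℝ).flip
      (mfderiv 𝓘(ℝ, E) 𝓘(ℝ, E) (extChartAt 𝓘(ℝ, E) x₀).symm (extChartAt 𝓘(ℝ, E) x₀ x) :
        E →L[ℝ] E)))

variable [IsManifold 𝓘(ℝ, E) ∞ M] [IsManifold 𝓘(ℝ, F) ∞ N]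

theorem pontryaginCoord_injective {x₀ x : M} (hx : x ∈ (extChartAt 𝓘(ℝ, E) x₀).source) :
    Function.Injective (pontryaginCoord (E := E) x₀ x) := by
  rw [injective_iff_map_eq_zero]
  rintro ⟨v, α⟩ h
  have h1 : (mfderiv 𝓘(ℝ, E) 𝓘(ℝ, E) (extChartAt 𝓘(ℝ, E) x₀) x : E →L[ℝ] E) v = 0 :=
    congrArg Prod.fst h
  have h2 : ∀ w, α ((mfderiv 𝓘(ℝ, E) 𝓘(ℝ, E) (extChartAt 𝓘(ℝ, E) x₀).symm
      (extChartAt 𝓘(ℝ, E) x₀ x) : E →L[ℝ] E) w) = 0 :=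
    fun w ↦ DFunLike.congr_fun (congrArg Prod.snd h) w
  have h3 := PartialEquiv.map_source _ hx
  have h4 := mfderiv_symm_comp_mfderiv_extChartAt h3
  rw [PartialEquiv.left_inv _ hx] at h4
  refine Prod.ext ?_ (ContinuousLinearMap.ext fun w ↦ ?_)
  · change v = 0
    rw [← h4 v]
    refine (congrArg (mfderiv 𝓘(ℝ, E) 𝓘(ℝ, E) (extChartAt 𝓘(ℝ, E) x₀).symm
      (extChartAt 𝓘(ℝ, E) x₀ x) : E → E) h1).trans (map_zero _)
  · exact (congrArg α (h4 w)).symm.trans (h2 _)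

omit [IsManifold 𝓘(ℝ, F) ∞ N] in
theorem contMDiffAt_pontryaginCoord {f : N → M} {n : N} {x₀ : M} (hx₀ : f n = x₀)
    (hf : ContMDiffAt 𝓘(ℝ, F) 𝓘(ℝ, E) ∞ f n)
    (X : ∀ y : N, TangentSpace 𝓘(ℝ, E) (f y)) (α : ∀ x : M, TangentSpace 𝓘(ℝ, E) x →L[ℝ] ℝ)
    (hX : ContMDiffAt 𝓘(ℝ, F) 𝓘(ℝ, E).tangent ∞
      (fun y ↦ (⟨f y, X y⟩ : TangentBundle 𝓘(ℝ, E) M)) n)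
    (hα : ContMDiffAt 𝓘(ℝ, E) (𝓘(ℝ, E).prod 𝓘(ℝ, E →L[ℝ] ℝ)) ∞
      (fun x ↦ TotalSpace.mk' (E →L[ℝ] ℝ)
        (E := fun x : M ↦ (TangentSpace 𝓘(ℝ, E) x →L[ℝ] Bundle.Trivial M ℝ x)) x (α x)) x₀) :
    ContMDiffAt 𝓘(ℝ, F) 𝓘(ℝ, E × (E →L[ℝ] ℝ)) ∞
      (fun y ↦ pontryaginCoord x₀ (f y) (X y, α (f y))) n := by
  subst hx₀
  have h1 := (contMDiffAt_vectorField_iff hf rfl X).1 hX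
  have h2 : ContMDiffAt 𝓘(ℝ, F) 𝓘(ℝ, E →L[ℝ] ℝ) ∞
      (fun y ↦ DiracGeometry.oneFormInChart α (f n) (extChartAt 𝓘(ℝ, E) (f n) (f y))) n :=
    ContMDiffAt.comp (I' := 𝓘(ℝ, E)) n
      (contMDiffAt_iff_contDiffAt.2 ((contMDiffAt_oneForm_iff α).1 hα))
      ((contMDiffAt_extChartAt (I := 𝓘(ℝ, E)) (n := ∞) (x := f n)).comp n hf)
  refine (h1.prodMk_space h2).congr_of_eventuallyEq ?_
  filter_upwards [hf.continuousAt (extChartAt_source_mem_nhds (I := 𝓘(ℝ, E)) (f n))] with y hy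
  refine Prod.ext rfl (ContinuousLinearMap.ext fun w ↦ ?_)
  have h9 : ∀ x x', x = x' → ∀ w : E, (α x : E → ℝ) w = (α x' : E → ℝ) w := by
    rintro x _ rfl w; rfl
  exact h9 _ _ (PartialEquiv.left_inv _ hy).symm _

theorem contMDiffAt_tangentMap {f : N → M} {U : Set N} (hU : IsOpen U)
    (hf : ContMDiffOn 𝓘(ℝ, F) 𝓘(ℝ, E) ∞ f U) {p : TangentBundle 𝓘(ℝ, F) N} (hp : p.1 ∈ U) :
    ContMDiffAt 𝓘(ℝ, F).tangent 𝓘(ℝ, E).tangent ∞ (tangentMap 𝓘(ℝ, F) 𝓘(ℝ, E) f) p := by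
  have h1 := hf.contMDiffOn_tangentMapWithin (m := ∞) (by simp) hU.uniqueMDiffOn
  have hU' : IsOpen (TotalSpace.proj ⁻¹' U : Set (TangentBundle 𝓘(ℝ, F) N)) :=
    hU.preimage (FiberBundle.continuous_proj F (TangentSpace 𝓘(ℝ, F)))
  refine (h1.contMDiffAt (hU'.mem_nhds hp)).congr_of_eventuallyEq ?_
  filter_upwards [hU'.mem_nhds hp] with q hq
  exact (tangentMapWithin_eq_tangentMap (hU.uniqueMDiffWithinAt hq)
    ((hf.contMDiffAt (hU.mem_nhds hq)).mdifferentiableAt (by simp))).symm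

end

/-- If `L` is a left inverse of `A₀`, then `(L A)⁻¹ L` is a left inverse of every nearby `A`, and it
is smooth in `A` because inversion is. -/
theorem exists_contDiffAt_leftInverse {E W : Type*} [NormedAddCommGroup E] [NormedSpace ℝ E]
    [FiniteDimensional ℝ E] [NormedAddCommGroup W] [NormedSpace ℝ W] [FiniteDimensional ℝ W]
    (A₀ : E →L[ℝ] W) (hA : Function.Injective A₀) :
    ∃ B : (E →L[ℝ] W) → (W →L[ℝ] E), ContDiffAt ℝ ∞ B A₀ ∧ ∀ᶠ A in 𝓝 A₀, (B A).comp A =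
      ContinuousLinearMap.id ℝ E := by
  obtain ⟨L, hL⟩ : ∃ L : W →L[ℝ] E, L.comp A₀ = ContinuousLinearMap.id ℝ E := by
    obtain ⟨L, hL⟩ := LinearMap.exists_leftInverse_of_injective (A₀ : E →ₗ[ℝ] W)
      (LinearMap.ker_eq_bot.2 hA)
    exact ⟨LinearMap.toContinuousLinearMap L, by ext v; exact DFunLike.congr_fun hL v⟩
  have h1 : ContDiffAt ℝ ∞ (fun A : E →L[ℝ] W ↦ (L.comp A).inverse) A₀ := by
    have h2 : ContDiffAt ℝ ∞ (ContinuousLinearMap.inverse : (E →L[ℝ] E) → (E →L[ℝ] E))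
      ((ContinuousLinearEquiv.refl ℝ E : E ≃L[ℝ] E) : E →L[ℝ] E) := contDiffAt_map_inverse _
    refine ContDiffAt.comp A₀ (g := ContinuousLinearMap.inverse) (f := fun A : E →L[ℝ] W ↦ L.comp A) ?_ ?_
    · rw [hL]; exact h2
    · exact contDiffAt_const.clm_comp contDiffAt_id
  refine ⟨fun A ↦ (L.comp A).inverse.comp L, h1.clm_comp contDiffAt_const, ?_⟩
  have h3 : ∀ᶠ T in 𝓝 (ContinuousLinearMap.id ℝ E), T.IsInvertible :=
    ContinuousLinearEquiv.nhds (ContinuousLinearEquiv.refl ℝ E)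
  have h4 : Tendsto (fun A : E →L[ℝ] W ↦ L.comp A) (𝓝 A₀) (𝓝 (ContinuousLinearMap.id ℝ E)) := by
    rw [← hL]
    exact ((ContinuousLinearMap.compL ℝ E W E) L).continuous.tendsto A₀
  filter_upwards [h4 h3] with A hA
  obtain ⟨e, he⟩ := hA
  have he' : (e : E →L[ℝ] E) = L.comp A := he
  ext v
  change (L.comp A).inverse (L.comp A v) = v
  rw [← he', ContinuousLinearMap.inverse_equiv]
  simp

/-- No regularity of `c` is assumed. The coefficients are recovered from `w` by a smoothly varying
left inverse of the frame map. -/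
theorem contMDiffAt_coefficients {F N W : Type*} [NormedAddCommGroup F] [NormedSpace ℝ F]
    [TopologicalSpace N] [ChartedSpace F N] [NormedAddCommGroup W] [NormedSpace ℝ W]
    [FiniteDimensional ℝ W] {k : ℕ} {s : Fin k → N → W} {w : N → W} {c : Fin k → N → ℝ} {n : N}
    (hs : ∀ j, ContMDiffAt 𝓘(ℝ, F) 𝓘(ℝ, W) ∞ (s j) n) (hw : ContMDiffAt 𝓘(ℝ, F) 𝓘(ℝ, W) ∞ w n)
    (hli : LinearIndependent ℝ fun j ↦ s j n) (hc : ∀ᶠ z in 𝓝 n, w z = ∑ j, c j z • s j z)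
    (j : Fin k) : ContMDiffAt 𝓘(ℝ, F) 𝓘(ℝ, ℝ) ∞ (c j) n := by
  set A : N → (Fin k → ℝ) →L[ℝ] W := fun z ↦
    ∑ j, (ContinuousLinearMap.proj (R := ℝ) (φ := fun _ : Fin k ↦ ℝ) j).smulRight (s j z) with hA
  have hAapp : ∀ z (x : Fin k → ℝ), A z x = ∑ j, x j • s j z := by
    intro z x
    simp [hA]
  have hAs : ContMDiffAt 𝓘(ℝ, F) 𝓘(ℝ, (Fin k → ℝ) →L[ℝ] W) ∞ A n := by
    refine contMDiffAt_finsetSum fun j _ ↦ ?_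
    exact ((ContinuousLinearMap.smulRightL ℝ (Fin k → ℝ) W
      (ContinuousLinearMap.proj (R := ℝ) (φ := fun _ : Fin k ↦ ℝ) j)).contMDiff.contMDiffAt).comp n
      (hs j)
  have hinj : Function.Injective (A n) := by
    rw [injective_iff_map_eq_zero]
    intro x hx
    rw [hAapp] at hx
    funext j
    exact Fintype.linearIndependent_iff.1 hli x hx j
  obtain ⟨B, hB, hB'⟩ := exists_contDiffAt_leftInverse (A n) hinj
  have h1 : ContMDiffAt 𝓘(ℝ, F) 𝓘(ℝ, W →L[ℝ] (Fin k → ℝ)) ∞ (fun z ↦ B (A z)) n :=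
    (contMDiffAt_iff_contDiffAt.2 hB).comp n hAs
  have h2 : ContMDiffAt 𝓘(ℝ, F) 𝓘(ℝ, Fin k → ℝ) ∞ (fun z ↦ B (A z) (w z)) n := h1.clm_apply hw
  have h3 := (((ContinuousLinearMap.proj (R := ℝ) (φ := fun _ : Fin k ↦ ℝ)
    j)).contMDiff (n := ∞).contMDiffAt).comp n h2
  refine h3.congr_of_eventuallyEq ?_
  filter_upwards [hc, hAs.continuousAt.eventually hB'] with z hz hz'
  have h4 : w z = A z (fun j ↦ c j z) := by rw [hAapp, hz]
  have h5 := DFunLike.congr_fun hz' (fun j ↦ c j z)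
  change c j z = (B (A z) (w z)) j
  rw [h4]
  exact (congrFun h5 j).symm

theorem ContMDiffAt.eventually_linearIndependent {F N W : Type*} [NormedAddCommGroup F]
    [NormedSpace ℝ F] [TopologicalSpace N] [ChartedSpace F N] [NormedAddCommGroup W]
    [NormedSpace ℝ W] {ι : Type*} [Finite ι] {s : ι → N → W} {n : N}
    (hs : ∀ j, ContMDiffAt 𝓘(ℝ, F) 𝓘(ℝ, W) ∞ (s j) n)
    (hli : LinearIndependent ℝ fun j ↦ s j n) :
    ∀ᶠ z in 𝓝 n, LinearIndependent ℝ fun j ↦ s j z := by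
  have h := (isOpen_setOfPred_linearIndependent (𝕜 := ℝ) (ι := ι) (E := W)).mem_nhds hli
  have h2 : ContinuousAt (fun z j ↦ s j z) n := continuousAt_pi.2 fun j ↦ (hs j).continuousAt
  exact h2 h

/-! ### Linear algebra of Lagrangian subspaces -/

section
variable {V : Type*} [NormedAddCommGroup V] [NormedSpace ℝ V]
  {W : Type*} [NormedAddCommGroup W] [NormedSpace ℝ W]

/-- The pairing is nondegenerate on a space of dimension `2 dim V`, and the dimensions of `L` and of
its orthogonal, which is `L`, add up to that. -/
theorem finrank_of_lagrangian [FiniteDimensional ℝ V] (L : Submodule ℝ (V × (V →L[ℝ] ℝ)))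
    (hL : ∀ p, p ∈ L ↔ ∀ q ∈ L, q.2 p.1 + p.2 q.1 = 0) :
    Module.finrank ℝ L = Module.finrank ℝ V := by
  let B : LinearMap.BilinForm ℝ (V × (V →L[ℝ] ℝ)) := LinearMap.mk₂ ℝ
    (fun p q ↦ p.2 q.1 + q.2 p.1)
    (by intros; simp; ring) (by intros; simp; ring) (by intros; simp; ring) (by intros; simp; ring)
  have hB : ∀ p q, B p q = p.2 q.1 + q.2 p.1 := fun p q ↦ rfl
  have hsep : ∀ v : V, (∀ α : V →L[ℝ] ℝ, α v = 0) → v = 0 := by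
    intro v hv
    by_contra hne
    obtain ⟨α, hα⟩ := exists_dual_vector ℝ v (norm_ne_zero_iff.2 hne)
    have := hv α
    rw [hα.2] at this
    exact hne (by simpa using this)
  have hker : ∀ p, (∀ q, B p q = 0) → p = 0 := by
    rintro ⟨v, α⟩ h
    refine Prod.ext (hsep v fun β ↦ ?_) (ContinuousLinearMap.ext fun w ↦ ?_)
    · simpa [hB] using h (0, β)
    · simpa [hB] using h (w, 0)
  have hsymm : ∀ p q, B p q = B q p := fun p q ↦ by rw [hB, hB, add_comm]
  have hnd : B.Nondegenerate :=
    ⟨fun p h ↦ hker p h, fun p h ↦ hker p fun q ↦ (hsymm p q).trans (h q)⟩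
  have horth : B.orthogonal L = L := by
    ext p
    rw [LinearMap.BilinForm.mem_orthogonal_iff, hL]
    rfl
  have h1 := LinearMap.BilinForm.finrank_orthogonal hnd L
  rw [horth, Module.finrank_prod] at h1
  have h2 : Module.finrank ℝ (V →L[ℝ] ℝ) = Module.finrank ℝ V := by
    rw [← (LinearMap.toContinuousLinearMap (𝕜 := ℝ) (E := V) (F' := ℝ)).finrank_eq]
    exact Subspace.dual_finrank_eq
  have h3 := Submodule.finrank_le L
  rw [Module.finrank_prod] at h3
  omega

variable {D : Submodule ℝ (V × (V →L[ℝ] ℝ))} {i : W →L[ℝ] V} {R : V →L[ℝ] W}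
  (hRi : ∀ v, R (i v) = v)
  (hK : ∀ p ∈ D, (i (R p.1), p.2.comp (i.comp R)) ∈ D) {L : Submodule ℝ (W × (W →L[ℝ] ℝ))}
  (hL : ∀ p, p ∈ L ↔ ∃ q ∈ D, i p.1 = q.1 ∧ p.2 = q.2.comp i)
include hRi hK hL

/-- Invariance of `D` under `i ∘ R` and its transpose turns the existential in the pull-back into
one canonical witness. -/
theorem mem_pullback_iff_of_retraction (p : W × (W →L[ℝ] ℝ)) :
    p ∈ L ↔ (i p.1, p.2.comp R) ∈ D := by
  rw [hL]
  constructor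
  · rintro ⟨q, hq, h1, h2⟩
    have h3 := hK q hq
    rw [← h1, hRi] at h3
    rw [h2]
    exact h3
  · intro h
    exact ⟨_, h, rfl, by ext v; simp [hRi]⟩

theorem pushforward_mem_of_retraction {p : V × (V →L[ℝ] ℝ)} (hp : p ∈ D) :
    (R p.1, p.2.comp i) ∈ L := by
  rw [hL]
  exact ⟨_, hK p hp, rfl, by ext v; simp [hRi]⟩

/-- The maps `(i, R^*)` and `(R, i^*)` are adjoint for the two pairings. A vector orthogonal to `L`
is thus carried by `(i, R^*)` to one orthogonal to `D`, which lies in `D`. -/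
theorem lagrangian_of_retraction (hD : ∀ p, p ∈ D ↔ ∀ q ∈ D, q.2 p.1 + p.2 q.1 = 0)
    (p : W × (W →L[ℝ] ℝ)) : p ∈ L ↔ ∀ q ∈ L, q.2 p.1 + p.2 q.1 = 0 := by
  constructor
  · intro hp q hq
    obtain ⟨p', hp', h1, h2⟩ := (hL p).1 hp
    obtain ⟨q', hq', h3, h4⟩ := (hL q).1 hq
    have := (hD p').1 hp' q' hq'
    rw [h2, h4, ContinuousLinearMap.comp_apply, ContinuousLinearMap.comp_apply, h1, h3, this]
  · intro h
    rw [mem_pullback_iff_of_retraction hRi hK hL, hD]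
    intro q hq
    exact h _ (pushforward_mem_of_retraction hRi hK hL hq)

theorem span_pushforward_of_retraction {ι : Type*} {s : ι → V × (V →L[ℝ] ℝ)}
    (hs : Submodule.span ℝ (range s) = D) :
    Submodule.span ℝ (range fun a ↦ ((R (s a).1, (s a).2.comp i) : W × (W →L[ℝ] ℝ))) = L := by
  let Ψ : (V × (V →L[ℝ] ℝ)) →ₗ[ℝ] (W × (W →L[ℝ] ℝ)) :=
    LinearMap.prodMap R.toLinearMap
      (ContinuousLinearMap.toLinearMap ((ContinuousLinearMap.compL ℝ W V ℝ).flip i))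
  have hΨ : ∀ p, Ψ p = (R p.1, p.2.comp i) := fun p ↦ rfl
  have h1 : (range fun a ↦ ((R (s a).1, (s a).2.comp i) : W × (W →L[ℝ] ℝ))) = Ψ '' range s := by
    rw [← range_comp]; rfl
  rw [h1, ← Submodule.map_span, hs]
  ext p
  rw [Submodule.mem_map]
  constructor
  · rintro ⟨q, hq, rfl⟩
    exact pushforward_mem_of_retraction hRi hK hL hq
  · intro hp
    refine ⟨_, (mem_pullback_iff_of_retraction hRi hK hL p).1 hp, ?_⟩
    rw [hΨ]
    refine Prod.ext (hRi _) ?_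
    ext v
    simp [hRi]
end

/-! ### Invariant retractions and the backward image as a Dirac structure -/

section
open DiracGeometry
variable {E : Type*} [NormedAddCommGroup E] [NormedSpace ℝ E]
  {M : Type*} [TopologicalSpace M] [ChartedSpace E M]
  {F : Type*} [NormedAddCommGroup F] [NormedSpace ℝ F]
  {N : Type*} [TopologicalSpace N] [ChartedSpace F N]

/-- `r` is a smooth retraction of the open set `U` onto the image of `j : N → M` whose tangent maps
preserve the distribution `D` along `j`. -/
structure IsInvariantRetraction (j : N → M) (D : Distribution E M) (U : Set M) (r : M → N) :
    Prop where
  isOpen : IsOpen U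
  contMDiffOn : ContMDiffOn 𝓘(ℝ, E) 𝓘(ℝ, F) ∞ r U
  leftInverse : ∀ z, j z ∈ U → r (j z) = z
  mem_of_mem : ∀ z, j z ∈ U → ∀ p ∈ D (j z), ∀ q : PontryaginFiber E (j z),
    q.1 = (mfderiv 𝓘(ℝ, F) 𝓘(ℝ, E) j z : F →L[ℝ] E)
      ((mfderiv 𝓘(ℝ, E) 𝓘(ℝ, F) r (j z) : E →L[ℝ] F) p.1) →
    (∀ w : E, (q.2 : E → ℝ) w = (p.2 : E → ℝ) ((mfderiv 𝓘(ℝ, F) 𝓘(ℝ, E) j z : F →L[ℝ] E)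
      ((mfderiv 𝓘(ℝ, E) 𝓘(ℝ, F) r (j z) : E →L[ℝ] F) w))) → q ∈ D (j z)

namespace IsInvariantRetraction
variable {j : N → M} (hj : ContMDiff 𝓘(ℝ, F) 𝓘(ℝ, E) ∞ j) {D : Distribution E M} {U : Set M}
  {r : M → N} (h : IsInvariantRetraction (E := E) (F := F) j D U r)
include hj h

theorem mfderiv_comp_eq {z : N} (hz : j z ∈ U) (v : F) :
    (mfderiv 𝓘(ℝ, E) 𝓘(ℝ, F) r (j z) : E →L[ℝ] F)
      ((mfderiv 𝓘(ℝ, F) 𝓘(ℝ, E) j z : F →L[ℝ] E) v) = v := by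
  have h1 : HasMFDerivAt 𝓘(ℝ, F) 𝓘(ℝ, F) (r ∘ j) z
      ((mfderiv 𝓘(ℝ, E) 𝓘(ℝ, F) r (j z)).comp (mfderiv 𝓘(ℝ, F) 𝓘(ℝ, E) j z)) :=
    HasMFDerivAt.comp z ((h.contMDiffOn.contMDiffAt (h.isOpen.mem_nhds hz)).mdifferentiableAt
      (by simp)).hasMFDerivAt ((hj z).mdifferentiableAt (by simp)).hasMFDerivAt
  have h2 : HasMFDerivAt 𝓘(ℝ, F) 𝓘(ℝ, F) (r ∘ j) z (ContinuousLinearMap.id ℝ F) := by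
    refine (hasMFDerivAt_id (I := 𝓘(ℝ, F)) z).congr_of_eventuallyEq ?_
    filter_upwards [hj.continuous.continuousAt (h.isOpen.mem_nhds hz)] with w hw
    exact h.leftInverse w hw
  have h3 := hasMFDerivAt_unique h1 h2
  exact DFunLike.congr_fun h3 v

theorem mem_iff {z : N} (hz : j z ∈ U) (p : F × (F →L[ℝ] ℝ)) :
    p ∈ (backwardImage (F := F) j D z : Submodule ℝ (F × (F →L[ℝ] ℝ))) ↔
    ((mfderiv 𝓘(ℝ, F) 𝓘(ℝ, E) j z : F →L[ℝ] E) p.1,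
      p.2.comp (mfderiv 𝓘(ℝ, E) 𝓘(ℝ, F) r (j z) : E →L[ℝ] F)) ∈
      (D (j z) : Submodule ℝ (E × (E →L[ℝ] ℝ))) :=
  mem_pullback_iff_of_retraction (V := E) (W := F) (D := D (j z))
    (i := mfderiv 𝓘(ℝ, F) 𝓘(ℝ, E) j z) (R := mfderiv 𝓘(ℝ, E) 𝓘(ℝ, F) r (j z))
    (L := backwardImage (F := F) j D z) (h.mfderiv_comp_eq hj hz)
    (fun p hp ↦ h.mem_of_mem z hz p hp _ rfl fun _ ↦ rfl) (fun _ ↦ Iff.rfl) p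

theorem lagrangian (hD : IsLagrangian D) {z : N} (hz : j z ∈ U) (p : F × (F →L[ℝ] ℝ)) :
    p ∈ (backwardImage (F := F) j D z : Submodule ℝ (F × (F →L[ℝ] ℝ))) ↔
    ∀ q ∈ (backwardImage (F := F) j D z : Submodule ℝ (F × (F →L[ℝ] ℝ))), q.2 p.1 + p.2 q.1 = 0 :=
  lagrangian_of_retraction (V := E) (W := F) (D := D (j z))
    (i := mfderiv 𝓘(ℝ, F) 𝓘(ℝ, E) j z) (R := mfderiv 𝓘(ℝ, E) 𝓘(ℝ, F) r (j z))
    (L := backwardImage (F := F) j D z) (h.mfderiv_comp_eq hj hz)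
    (fun p hp ↦ h.mem_of_mem z hz p hp _ rfl fun _ ↦ rfl) (fun _ ↦ Iff.rfl) (hD (j z)) p

theorem span_eq {z : N} (hz : j z ∈ U) {ι : Type*} {s : ι → PontryaginFiber E (j z)}
    (hs : Submodule.span ℝ (range s) = D (j z)) :
    Submodule.span ℝ (range fun a ↦ (((mfderiv 𝓘(ℝ, E) 𝓘(ℝ, F) r (j z) : E →L[ℝ] F) (s a).1,
      ContinuousLinearMap.comp (M₂ := E) (s a).2 (mfderiv 𝓘(ℝ, F) 𝓘(ℝ, E) j z)) :
        F × (F →L[ℝ] ℝ))) = backwardImage (F := F) j D z :=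
  span_pushforward_of_retraction (V := E) (W := F) (D := D (j z))
    (i := mfderiv 𝓘(ℝ, F) 𝓘(ℝ, E) j z) (R := mfderiv 𝓘(ℝ, E) 𝓘(ℝ, F) r (j z))
    (L := backwardImage (F := F) j D z) (h.mfderiv_comp_eq hj hz)
    (fun p hp ↦ h.mem_of_mem z hz p hp _ rfl fun _ ↦ rfl) (fun _ ↦ Iff.rfl) hs

end IsInvariantRetraction
end

theorem card_eq_finrank_of_span_eq {W κ ι : Type*} [AddCommGroup W] [Module ℝ W] [Finite κ]
    {t : ι → W} {a : κ → ι} {L : Submodule ℝ W}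
    (h : Submodule.span ℝ (range (t ∘ a)) = Submodule.span ℝ (range t))
    (hli : LinearIndependent ℝ (t ∘ a)) (hL : Submodule.span ℝ (range t) = L) :
    Nat.card κ = Module.finrank ℝ L := by
  have := Fintype.ofFinite κ
  rw [← hL, ← h, Nat.card_eq_fintype_card]
  exact (finrank_span_eq_card hli).symm

theorem span_eq_of_card_eq_finrank {W : Type*} [AddCommGroup W] [Module ℝ W]
    [FiniteDimensional ℝ W] {n : ℕ} {v : Fin n → W} {L : Submodule ℝ W}
    (hli : LinearIndependent ℝ v) (hv : ∀ b, v b ∈ L) (hn : n = Module.finrank ℝ L) :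
    Submodule.span ℝ (range v) = L := by
  refine Submodule.eq_of_le_of_finrank_eq (Submodule.span_le.2 ?_) ?_
  · rintro _ ⟨b, rfl⟩
    exact hv b
  · rw [finrank_span_eq_card hli, Fintype.card_fin, hn]

section
open DiracGeometry
variable {E : Type*} [NormedAddCommGroup E] [NormedSpace ℝ E]
  {M : Type*} [TopologicalSpace M] [ChartedSpace E M] [IsManifold 𝓘(ℝ, E) ∞ M]
  {F : Type*} [NormedAddCommGroup F] [NormedSpace ℝ F]
  {N : Type*} [TopologicalSpace N] [ChartedSpace F N] [IsManifold 𝓘(ℝ, F) ∞ N]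

omit [IsManifold 𝓘(ℝ, F) ∞ N] in
theorem tangentBundle_mk_eq {a b : N} (hab : a = b) (v : F) :
    (⟨a, v⟩ : TangentBundle 𝓘(ℝ, F) N) = ⟨b, v⟩ := by
  subst hab; rfl

theorem contMDiffAt_mfderiv_retraction_apply {j : N → M} (hj : ContMDiff 𝓘(ℝ, F) 𝓘(ℝ, E) ∞ j)
    {U : Set M} (hU : IsOpen U) {r : M → N} (hr : ContMDiffOn 𝓘(ℝ, E) 𝓘(ℝ, F) ∞ r U)
    (hrj : ∀ z, j z ∈ U → r (j z) = z) {X : ∀ x : M, TangentSpace 𝓘(ℝ, E) x} {z : N}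
    (hz : j z ∈ U) (hX : ContMDiffAt 𝓘(ℝ, E) 𝓘(ℝ, E).tangent ∞
      (fun x ↦ (⟨x, X x⟩ : TangentBundle 𝓘(ℝ, E) M)) (j z)) :
    ContMDiffAt 𝓘(ℝ, F) 𝓘(ℝ, F).tangent ∞
      (fun w ↦ (⟨w, (mfderiv 𝓘(ℝ, E) 𝓘(ℝ, F) r (j w) : E →L[ℝ] F) (X (j w))⟩ :
        TangentBundle 𝓘(ℝ, F) N)) z := by
  have h1 := contMDiffAt_tangentMap hU hr (p := ⟨j z, X (j z)⟩) hz
  have h2 : ContMDiffAt 𝓘(ℝ, F) 𝓘(ℝ, E).tangent ∞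
      (fun w ↦ (⟨j w, X (j w)⟩ : TangentBundle 𝓘(ℝ, E) M)) z :=
    ContMDiffAt.comp (I' := 𝓘(ℝ, E)) z hX (hj z)
  have h3 := ContMDiffAt.comp (I' := 𝓘(ℝ, E).tangent) z h1 h2
  refine h3.congr_of_eventuallyEq ?_
  filter_upwards [hj.continuous.continuousAt (hU.mem_nhds hz)] with w hw
  exact (tangentBundle_mk_eq (hrj w hw) _).symm

/-- A frame of `D` pushes down to smooth sections which span but may be dependent. Since the fibres
are Lagrangian, their dimension is constantly `dim F`. A subfamily that is a basis at `y` stays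
independent nearby, and by counting it still spans. -/
theorem isDiracStructure_backwardImage [FiniteDimensional ℝ E] [FiniteDimensional ℝ F]
    {j : N → M} (hj : ContMDiff 𝓘(ℝ, F) 𝓘(ℝ, E) ∞ j) {D : Distribution E M}
    (hD : IsDiracStructure D)
    (hr : ∀ y : N, ∃ (U : Set M) (r : M → N), j y ∈ U ∧
      IsInvariantRetraction (E := E) (F := F) j D U r) :
    IsDiracStructure (backwardImage (F := F) j D) := by
  refine ⟨fun y ↦ ?_, fun y p ↦ ?_⟩
  swap
  · obtain ⟨U, r, hy, h⟩ := hr y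
    exact h.lagrangian hj hD.isLagrangian hy p
  obtain ⟨U, r, hy, h⟩ := hr y
  obtain ⟨U₁, hU₁, hyU₁, k, s, hs, hspan⟩ := hD.isSmoothSubbundle (j y)
  set t : Fin k → PontryaginSection F N := fun a z ↦
    (((mfderiv 𝓘(ℝ, E) 𝓘(ℝ, F) r (j z) : E →L[ℝ] F) (s a (j z)).1,
      ContinuousLinearMap.comp (M₂ := E) (s a (j z)).2 (mfderiv 𝓘(ℝ, F) 𝓘(ℝ, E) j z)) :
        F × (F →L[ℝ] ℝ)) with ht
  set V : Set N := j ⁻¹' (U ∩ U₁) with hV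
  have hVo : IsOpen V := (h.isOpen.inter hU₁).preimage hj.continuous
  have hyV : y ∈ V := ⟨hy, hyU₁⟩
  have ht1 : ∀ a, ∀ z ∈ V, ContMDiffAt 𝓘(ℝ, F) 𝓘(ℝ, F).tangent ∞
      (fun x ↦ (⟨x, (t a x).1⟩ : TangentBundle 𝓘(ℝ, F) N)) z := fun a z hz ↦
    contMDiffAt_mfderiv_retraction_apply hj h.isOpen h.contMDiffOn h.leftInverse hz.1
      ((hs a).1.contMDiffAt (hU₁.mem_nhds hz.2))
  have ht2 : ∀ a, ∀ z ∈ V, ContMDiffAt 𝓘(ℝ, F) (𝓘(ℝ, F).prod 𝓘(ℝ, F →L[ℝ] ℝ)) ∞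
      (fun x ↦ TotalSpace.mk' (F →L[ℝ] ℝ)
        (E := fun x : N ↦ (TangentSpace 𝓘(ℝ, F) x →L[ℝ] Bundle.Trivial N ℝ x)) x (t a x).2) z :=
    fun a z hz ↦ (hj z).oneForm_pullback (α := fun x ↦ (s a x).2)
      ((hs a).2.contMDiffAt (hU₁.mem_nhds hz.2)) (Eventually.of_forall fun _ ↦ rfl)
  have htspan : ∀ z ∈ V, Submodule.span ℝ (range fun a ↦ t a z) = backwardImage (F := F) j D z :=
    fun z hz ↦ h.span_eq hj hz.1 (hspan (j z) hz.2).2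
  have hfin : ∀ z ∈ V, Module.finrank ℝ (backwardImage (F := F) j D z :
      Submodule ℝ (F × (F →L[ℝ] ℝ))) = Module.finrank ℝ F := fun z hz ↦
    finrank_of_lagrangian (V := F) _ (h.lagrangian hj hD.isLagrangian hz.1)
  obtain ⟨κ, a, ha, haspan, hali⟩ := exists_linearIndependent' (K := ℝ)
    (V := F × (F →L[ℝ] ℝ)) (fun a ↦ t a y)
  have hκ : Finite κ := Finite.of_injective a ha
  have hcoord := ContMDiffAt.eventually_linearIndependent (F := F) (N := N)
    -- Independence is an open condition only in a fixed vector space, so the sections are first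
    -- read in the chart at `y`.
    (W := F × (F →L[ℝ] ℝ)) (s := fun b z ↦ pontryaginCoord y z (t (a b) z)) (n := y)
    (fun b ↦ contMDiffAt_pontryaginCoord (f := fun z : N ↦ z) rfl contMDiffAt_id _
      (fun x ↦ (t (a b) x).2) (ht1 (a b) y hyV) (ht2 (a b) y hyV))
    (hali.map' (pontryaginCoord (E := F) y y) (LinearMap.ker_eq_bot.2
      (pontryaginCoord_injective (mem_extChartAt_source y))))
  obtain ⟨V', hV', hV'o, hyV'⟩ := eventually_nhds_iff.1 hcoord
  have e := Finite.equivFin κ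
  have hcard : Nat.card κ = Module.finrank ℝ F :=
    (card_eq_finrank_of_span_eq (W := F × (F →L[ℝ] ℝ)) haspan hali (htspan y hyV)).trans
      (hfin y hyV)
  refine ⟨V ∩ V', hVo.inter hV'o, ⟨hyV, hyV'⟩, Nat.card κ, fun b ↦ t (a (e.symm b)),
    fun b ↦ ⟨fun z hz ↦ (ht1 _ z hz.1).contMDiffWithinAt,
      fun z hz ↦ (ht2 _ z hz.1).contMDiffWithinAt⟩, fun z hz ↦ ?_⟩
  have hli : LinearIndependent ℝ (M := F × (F →L[ℝ] ℝ)) fun b ↦ t (a b) z :=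
    LinearIndependent.of_comp (pontryaginCoord (E := F) y z) (hV' z hz.2)
  have hli' : LinearIndependent ℝ (M := F × (F →L[ℝ] ℝ)) fun b ↦ t (a (e.symm b)) z :=
    hli.comp e.symm e.symm.injective
  have hmem : ∀ b, t b z ∈ backwardImage (F := F) j D z := fun b ↦
    htspan z hz.1 ▸ Submodule.subset_span ⟨b, rfl⟩
  have key : ∀ {n : ℕ} (v : Fin n → F × (F →L[ℝ] ℝ)) (L : Submodule ℝ (F × (F →L[ℝ] ℝ))),
      LinearIndependent ℝ v → (∀ b, v b ∈ L) → n = Module.finrank ℝ L →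
      Submodule.span ℝ (range v) = L := fun v L ↦ span_eq_of_card_eq_finrank
  exact ⟨hli', key _ (backwardImage (F := F) j D z) hli' (fun b ↦ hmem _)
    (hcard.trans (hfin z hz.1).symm)⟩

end

/-! ### Lifting sections to the ambient manifold, and integrability -/

section
open DiracGeometry
variable {E : Type*} [NormedAddCommGroup E] [NormedSpace ℝ E]
  {M : Type*} [TopologicalSpace M] [ChartedSpace E M] [IsManifold 𝓘(ℝ, E) ∞ M]
  {F : Type*} [NormedAddCommGroup F] [NormedSpace ℝ F]
  {N : Type*} [TopologicalSpace N] [ChartedSpace F N] [IsManifold 𝓘(ℝ, F) ∞ N]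

theorem isLocalSection_sum_smul {D : Distribution E M} {U : Set M} (hU : IsOpen U) {k : ℕ}
    {s : Fin k → PontryaginSection E M} (hs : ∀ a, IsSmoothSectionOn (s a) U)
    (hsD : ∀ a, ∀ x ∈ U, s a x ∈ D x) {c : Fin k → M → ℝ}
    (hc : ∀ a, ∀ x ∈ U, ContMDiffAt 𝓘(ℝ, E) 𝓘(ℝ, ℝ) ∞ (c a) x) :
    IsLocalSection D U (fun x ↦ ∑ a, c a x • s a x) := by
  refine ⟨hU, ⟨fun x hx ↦ ?_, fun x hx ↦ ?_⟩, fun x hx ↦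
    Submodule.sum_mem _ fun a _ ↦ Submodule.smul_mem _ _ (hsD a x hx)⟩
  · have h1 := ContMDiffAt.sum_section (I := 𝓘(ℝ, E)) (F := E) (V := TangentSpace 𝓘(ℝ, E) (M := M))
      (s := Finset.univ) (t := fun a x ↦ c a x • (s a x).1) (x₀ := x) (n := ∞)
      fun a _ ↦ (hc a x hx).smul_section ((hs a).1.contMDiffAt (hU.mem_nhds hx))
    simp only [Prod.fst_sum]
    exact h1.contMDiffWithinAt
  · have h1 := ContMDiffAt.sum_section (I := 𝓘(ℝ, E)) (F := E →L[ℝ] ℝ)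
      (V := fun x : M ↦ (TangentSpace 𝓘(ℝ, E) x →L[ℝ] Bundle.Trivial M ℝ x))
      (s := Finset.univ) (t := fun a x ↦ c a x • (s a x).2) (x₀ := x) (n := ∞)
      fun a _ ↦ (hc a x hx).smul_section ((hs a).2.contMDiffAt (hU.mem_nhds hx))
    simp only [Prod.snd_sum]
    exact h1.contMDiffWithinAt

/-- The section lifts along `j` to `(T j v, α ∘ T r)`, which takes values in `D`. Its coefficients
in a frame of `D` are smooth functions on `N`; composing them with `r` extends the lift to an open
set of `M` without leaving `D`. -/
theorem exists_related_localSection [FiniteDimensional ℝ E]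
    {j : N → M} (hj : ContMDiff 𝓘(ℝ, F) 𝓘(ℝ, E) ∞ j) {D : Distribution E M}
    (hD : IsSmoothSubbundle D) {U : Set M} {r : M → N}
    (h : IsInvariantRetraction (E := E) (F := F) j D U r) {V : Set N}
    {τ : PontryaginSection F N} (hτ : IsLocalSection (backwardImage (F := F) j D) V τ) {y : N}
    (hyV : y ∈ V) (hyU : j y ∈ U) :
    ∃ (U' : Set M) (σ : PontryaginSection E M) (V' : Set N), j y ∈ U' ∧ IsLocalSection D U' σ ∧
      IsOpen V' ∧ y ∈ V' ∧ V' ⊆ V ∧ MapsTo j V' U' ∧ ∀ z ∈ V',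
        mfderiv 𝓘(ℝ, F) 𝓘(ℝ, E) j z (τ z).1 = (σ (j z)).1 ∧
        (τ z).2 = (σ (j z)).2.comp (mfderiv 𝓘(ℝ, F) 𝓘(ℝ, E) j z) := by
  obtain ⟨U₁, hU₁, hyU₁, k, s, hs, hspan⟩ := hD (j y)
  obtain ⟨hVo, ⟨hτ1, hτ2⟩, hτD⟩ := hτ
  set V₁ : Set N := V ∩ j ⁻¹' (U ∩ U₁) with hV₁
  have hV₁o : IsOpen V₁ := hVo.inter ((h.isOpen.inter hU₁).preimage hj.continuous)
  have hyV₁ : y ∈ V₁ := ⟨hyV, hyU, hyU₁⟩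
  set lift : N → E × (E →L[ℝ] ℝ) := fun z ↦
    ((mfderiv 𝓘(ℝ, F) 𝓘(ℝ, E) j z : F →L[ℝ] E) (τ z).1,
      ContinuousLinearMap.comp (M₂ := F) (τ z).2 (mfderiv 𝓘(ℝ, E) 𝓘(ℝ, F) r (j z) : E →L[ℝ] F))
    with hlift
  -- Coefficients are chosen at every point so as to form a total function. Away from `V₁` they are
  -- arbitrary.
  have hex : ∀ z, ∃ c : Fin k → ℝ, z ∈ V₁ →
      (∑ a, c a • (s a (j z) : E × (E →L[ℝ] ℝ))) = lift z := by
    intro z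
    by_cases hz : z ∈ V₁
    · have h1 := (h.mem_iff hj hz.2.1 (τ z)).1 (hτD z hz.1)
      rw [← (hspan (j z) hz.2.2).2] at h1
      obtain ⟨c, hc⟩ := (Submodule.mem_span_range_iff_exists_fun ℝ).1 h1
      exact ⟨c, fun _ ↦ hc⟩
    · exact ⟨0, fun h ↦ absurd h hz⟩
  choose c hc using hex
  have hcs : ∀ a, ∀ z₀ ∈ V₁, ContMDiffAt 𝓘(ℝ, F) 𝓘(ℝ, ℝ) ∞ (fun z ↦ c z a) z₀ := by
    intro a z₀ hz₀
    have hjz : ∀ a, ContMDiffAt 𝓘(ℝ, F) 𝓘(ℝ, E × (E →L[ℝ] ℝ)) ∞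
        (fun z ↦ pontryaginCoord (j z₀) (j z) (s a (j z))) z₀ := fun a ↦
      contMDiffAt_pontryaginCoord rfl (hj z₀) (fun z ↦ (s a (j z)).1) (fun x ↦ (s a x).2)
        (ContMDiffAt.comp (I' := 𝓘(ℝ, E)) z₀ ((hs a).1.contMDiffAt (hU₁.mem_nhds hz₀.2.2)) (hj z₀))
        ((hs a).2.contMDiffAt (hU₁.mem_nhds hz₀.2.2))
    have hr := h.contMDiffOn.contMDiffAt (h.isOpen.mem_nhds hz₀.2.1)
    have hτ2' : ContMDiffAt 𝓘(ℝ, F) (𝓘(ℝ, F).prod 𝓘(ℝ, F →L[ℝ] ℝ)) ∞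
      (fun x ↦ TotalSpace.mk' (F →L[ℝ] ℝ)
        (E := fun x : N ↦ (TangentSpace 𝓘(ℝ, F) x →L[ℝ] Bundle.Trivial N ℝ x)) x (τ x).2)
      (r (j z₀)) := by
      rw [h.leftInverse z₀ hz₀.2.1]
      exact hτ2.contMDiffAt (hVo.mem_nhds hz₀.1)
    have hw : ContMDiffAt 𝓘(ℝ, F) 𝓘(ℝ, E × (E →L[ℝ] ℝ)) ∞
        (fun z ↦ pontryaginCoord (j z₀) (j z) (lift z)) z₀ := by
      -- The form part of the lift is the restriction along `j` of the pull-back of `τ` by `r`, an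
      -- honest one-form near `j z₀`. The two agree on `V₁` because `r (j z) = z` there.
      have h1 := contMDiffAt_pontryaginCoord (f := j) rfl (hj z₀)
        (fun z ↦ mfderiv 𝓘(ℝ, F) 𝓘(ℝ, E) j z (τ z).1)
        (fun x ↦ (τ (r x)).2.comp (mfderiv 𝓘(ℝ, E) 𝓘(ℝ, F) r x))
        (ContMDiffAt.comp (I' := 𝓘(ℝ, F).tangent) z₀
          (contMDiffAt_tangentMap isOpen_univ hj.contMDiffOn (mem_univ _))
          (hτ1.contMDiffAt (hVo.mem_nhds hz₀.1)))
        (hr.oneForm_pullback hτ2' (Eventually.of_forall fun _ ↦ rfl))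
      refine h1.congr_of_eventuallyEq ?_
      filter_upwards [hV₁o.mem_nhds hz₀] with z hz
      refine congrArg _ (Prod.ext rfl (ContinuousLinearMap.ext fun w ↦ ?_))
      have h9 : ∀ x x', x = x' → ∀ w : F, ((τ x).2 : F → ℝ) w = ((τ x').2 : F → ℝ) w := by
        rintro x _ rfl w; rfl
      exact h9 _ _ (h.leftInverse z hz.2.1).symm _
    refine contMDiffAt_coefficients (c := fun a z ↦ c z a) hjz hw ?_ ?_ a
    · exact (hspan (j z₀) hz₀.2.2).1.map' (pontryaginCoord (E := E) (j z₀) (j z₀))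
        (LinearMap.ker_eq_bot.2 (pontryaginCoord_injective (mem_extChartAt_source (j z₀))))
    · filter_upwards [hV₁o.mem_nhds hz₀] with z hz
      have key : ∀ (T : (E × (E →L[ℝ] ℝ)) →ₗ[ℝ] (E × (E →L[ℝ] ℝ))) (b : Fin k → ℝ)
          (v : Fin k → E × (E →L[ℝ] ℝ)), T (∑ a, b a • v a) = ∑ a, b a • T (v a) := by
        intros; simp
      rw [← hc z hz]
      exact key _ _ _
  set σ : PontryaginSection E M := fun x ↦ ∑ a, c (r x) a • s a x with hσ
  set U' : Set M := (U ∩ r ⁻¹' V₁) ∩ U₁ with hU'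
  have hU'o : IsOpen U' := (h.contMDiffOn.continuousOn.isOpen_inter_preimage h.isOpen hV₁o).inter hU₁
  have hcr : ∀ a, ∀ x ∈ U', ContMDiffAt 𝓘(ℝ, E) 𝓘(ℝ, ℝ) ∞ (fun x ↦ c (r x) a) x := fun a x hx ↦
    ContMDiffAt.comp (I' := 𝓘(ℝ, F)) x (hcs a _ hx.1.2)
      (h.contMDiffOn.contMDiffAt (h.isOpen.mem_nhds hx.1.1))
  have hσD : IsLocalSection D U' σ := isLocalSection_sum_smul hU'o
    (fun a ↦ ⟨(hs a).1.mono inter_subset_right, (hs a).2.mono inter_subset_right⟩)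
    (fun a x hx ↦ (hspan x hx.2).2 ▸ Submodule.subset_span ⟨a, rfl⟩) hcr
  refine ⟨U', σ, V₁ ∩ j ⁻¹' U', ?_, hσD, hV₁o.inter (hU'o.preimage hj.continuous), ?_,
    fun z hz ↦ hz.1.1, fun z hz ↦ hz.2, fun z hz ↦ ?_⟩
  · exact ⟨⟨hyU, by rw [mem_preimage, h.leftInverse y hyU]; exact hyV₁⟩, hyU₁⟩
  · exact ⟨hyV₁, ⟨hyU, by rw [mem_preimage, h.leftInverse y hyU]; exact hyV₁⟩, hyU₁⟩
  · have h1 : σ (j z) = lift z := by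
      rw [← hc z hz.1]
      simp only [hσ, h.leftInverse z hz.1.2.1]
    rw [h1]
    refine ⟨rfl, ContinuousLinearMap.ext fun v ↦ ?_⟩
    exact (congrArg ((τ z).2 : F → ℝ) (h.mfderiv_comp_eq hj hz.1.2.1 v)).symm

/-- Locally both sections are related to sections of `D`, whose bracket is again a section of `D`.
Naturality makes that bracket a witness for membership in the backward image, and its pull-back
gives smoothness of the form part. -/
theorem isIntegrable_backwardImage [FiniteDimensional ℝ E] [FiniteDimensional ℝ F]
    {j : N → M} (hj : ContMDiff 𝓘(ℝ, F) 𝓘(ℝ, E) ∞ j) {D : Distribution E M}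
    (hD : IsSmoothSubbundle D) (hI : IsIntegrable D)
    (hr : ∀ y : N, ∃ (U : Set M) (r : M → N), j y ∈ U ∧
      IsInvariantRetraction (E := E) (F := F) j D U r) :
    IsIntegrable (backwardImage (F := F) j D) := by
  intro V τ τ' hτ hτ'
  have key : ∀ y ∈ V, ∃ (U' : Set M) (ρ : PontryaginSection E M) (V' : Set N),
      IsLocalSection D U' ρ ∧ IsOpen V' ∧ y ∈ V' ∧ MapsTo j V' U' ∧ ∀ z ∈ V',
        mfderiv 𝓘(ℝ, F) 𝓘(ℝ, E) j z (courantBracket τ τ' z).1 = (ρ (j z)).1 ∧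
        (courantBracket τ τ' z).2 = (ρ (j z)).2.comp (mfderiv 𝓘(ℝ, F) 𝓘(ℝ, E) j z) := by
    intro y hy
    obtain ⟨U, r, hyU, h⟩ := hr y
    obtain ⟨U₁, σ, V₁, -, hσ, hV₁, hyV₁, hV₁V, hj₁, hrel⟩ :=
      exists_related_localSection hj hD h hτ hy hyU
    obtain ⟨U₂, σ', V₂, -, hσ', hV₂, hyV₂, hV₂V, hj₂, hrel'⟩ :=
      exists_related_localSection hj hD h hτ' hy hyU
    have mono : ∀ {ρ : PontryaginSection E M} {A B : Set M}, IsOpen B → B ⊆ A →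
        IsLocalSection D A ρ → IsLocalSection D B ρ := fun hB hBA hρ ↦
      ⟨hB, ⟨hρ.2.1.1.mono hBA, hρ.2.1.2.mono hBA⟩, fun x hx ↦ hρ.2.2 x (hBA hx)⟩
    have hU : IsOpen (U₁ ∩ U₂) := hσ.1.inter hσ'.1
    refine ⟨U₁ ∩ U₂, courantBracket σ σ', V₁ ∩ V₂,
      hI _ _ _ (mono hU inter_subset_left hσ) (mono hU inter_subset_right hσ'),
      hV₁.inter hV₂, ⟨hyV₁, hyV₂⟩, fun z hz ↦ ⟨hj₁ hz.1, hj₂ hz.2⟩, fun z hz ↦ ?_⟩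
    have a1 := hσ.1.mem_nhds (hj₁ hz.1)
    have a2 := hσ'.1.mem_nhds (hj₂ hz.2)
    have b1 := hτ.1.mem_nhds (hV₁V hz.1)
    exact courantBracket_of_related (hj z) (hσ.2.1.1.contMDiffAt a1) (hσ'.2.1.1.contMDiffAt a2)
      (hτ.2.1.1.contMDiffAt b1) (hτ'.2.1.1.contMDiffAt b1) (hσ.2.1.2.contMDiffAt a1)
      (hσ'.2.1.2.contMDiffAt a2)
      (by filter_upwards [hV₁.mem_nhds hz.1] with w hw using (hrel w hw).1)
      (by filter_upwards [hV₁.mem_nhds hz.1] with w hw using (hrel w hw).2)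
      (by filter_upwards [hV₂.mem_nhds hz.2] with w hw using (hrel' w hw).1)
      (by filter_upwards [hV₂.mem_nhds hz.2] with w hw using (hrel' w hw).2)
  refine ⟨hτ.1, ⟨fun y hy ↦ ?_, fun y hy ↦ ?_⟩, fun y hy ↦ ?_⟩
  · have hm : IsManifold 𝓘(ℝ, F) (((⊤ : ℕ∞) : WithTop ℕ∞) + 1) N := by
      have : (((⊤ : ℕ∞) : WithTop ℕ∞) + 1) = ∞ := rfl
      rw [this]; infer_instance
    have hm2 : IsManifold 𝓘(ℝ, F) (minSmoothness ℝ 2) N := by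
      rw [minSmoothness_of_isRCLikeNormedField]
      exact IsManifold.of_le (n := ∞) (WithTop.coe_le_coe.2 (le_top : (_ : ℕ∞) ≤ ⊤))
    have b1 := hτ.1.mem_nhds hy
    exact (ContMDiffAt.mlieBracket_vectorField (m := ⊤) (n := ⊤) (hτ.2.1.1.contMDiffAt b1)
      (hτ'.2.1.1.contMDiffAt b1)
      (by rw [minSmoothness_of_isRCLikeNormedField]; exact le_rfl)).contMDiffWithinAt
  · obtain ⟨U', ρ, V', hρ, hV', hyV', hjV', hrel⟩ := key y hy
    refine ContMDiffAt.contMDiffWithinAt ?_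
    exact (hj y).oneForm_pullback (hρ.2.1.2.contMDiffAt (hρ.1.mem_nhds (hjV' hyV')))
      (by filter_upwards [hV'.mem_nhds hyV'] with w hw using (hrel w hw).2)
  · obtain ⟨U', ρ, V', hρ, hV', hyV', hjV', hrel⟩ := key y hy
    exact ⟨ρ (j y), hρ.2.2 _ (hjV' hyV'), (hrel y hyV').1, (hrel y hyV').2⟩

end

/-! ### Averaging over the isotropy group, and retractions onto `Q` -/

section
open DiracGeometry
variable {E : Type*} [NormedAddCommGroup E] [NormedSpace ℝ E]
  {M : Type*} [TopologicalSpace M] [ChartedSpace E M] [IsManifold 𝓘(ℝ, E) ∞ M]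

theorem exists_localSection_eq {D : Distribution E M} (hD : IsSmoothSubbundle D) {x : M}
    {p : PontryaginFiber E x} (hp : p ∈ D x) :
    ∃ (U : Set M) (σ : PontryaginSection E M), x ∈ U ∧ IsLocalSection D U σ ∧ σ x = p := by
  obtain ⟨U, hU, hxU, k, s, hs, hspan⟩ := hD x
  rw [← (hspan x hxU).2] at hp
  obtain ⟨c, hc⟩ := (Submodule.mem_span_range_iff_exists_fun ℝ).1 hp
  exact ⟨U, fun y ↦ ∑ a, c a • s a y, hxU, isLocalSection_sum_smul (c := fun a _ ↦ c a) hU hs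
    (fun a x hx ↦ (hspan x hx).2 ▸ Submodule.subset_span ⟨a, rfl⟩)
    (fun a x hx ↦ contMDiffAt_const), hc⟩

/-- Canonicity concerns sections, so `p` is extended to a local section first. As `g` fixes `x`, the
pulled-back section at `x` only involves the value `p`. -/
theorem mem_of_mem_of_stabilizer {G : Type*} [Group G] [MulAction G M] {D : Distribution E M}
    (hG : ∀ g : G, ContMDiff 𝓘(ℝ, E) 𝓘(ℝ, E) ∞ (fun x : M ↦ g • x))
    (hD : IsSmoothSubbundle D) (hGD : IsCanonicalAction G D) {x : M} {g : G} (hg : g • x = x)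
    {p : PontryaginFiber E x} (hp : p ∈ D x) {q : PontryaginFiber E x}
    (hq₁ : q.1 = (mfderiv 𝓘(ℝ, E) 𝓘(ℝ, E) (fun y : M ↦ g⁻¹ • y) x : E →L[ℝ] E) p.1)
    (hq₂ : ∀ w : E, (q.2 : E → ℝ) w =
      (p.2 : E → ℝ) ((mfderiv 𝓘(ℝ, E) 𝓘(ℝ, E) (fun y : M ↦ g • y) x : E →L[ℝ] E) w)) :
    q ∈ D x := by
  obtain ⟨U, σ, hxU, hσ, rfl⟩ := exists_localSection_eq hD hp
  have h1 := (hGD g U σ hσ).2.2 x (by rw [mem_preimage, hg]; exact hxU)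
  have h9 : ∀ x', x' = x → ((σ x').1 : E) = (σ x).1 ∧
      ∀ w : E, ((σ x').2 : E → ℝ) w = ((σ x).2 : E → ℝ) w := by
    rintro _ rfl; exact ⟨rfl, fun _ ↦ rfl⟩
  set A : E →L[ℝ] E := mfderiv 𝓘(ℝ, E) 𝓘(ℝ, E) (fun y : M ↦ g • y) x with hA
  set B : E →L[ℝ] E := mfderiv 𝓘(ℝ, E) 𝓘(ℝ, E) (fun y : M ↦ g⁻¹ • y) x with hB
  have dA : ∀ k : G, HasMFDerivAt 𝓘(ℝ, E) 𝓘(ℝ, E) (fun y : M ↦ k • y) x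
      (mfderiv 𝓘(ℝ, E) 𝓘(ℝ, E) (fun y : M ↦ k • y) x : E →L[ℝ] E) := fun k ↦
    (((hG k) x).mdifferentiableAt (by simp)).hasMFDerivAt
  have hg' : g⁻¹ • x = x := by rw [inv_smul_eq_iff, hg]
  have comp : ∀ k l : G, l • x = x → k * l = 1 →
      (mfderiv 𝓘(ℝ, E) 𝓘(ℝ, E) (fun y : M ↦ k • y) x : E →L[ℝ] E).comp
      (mfderiv 𝓘(ℝ, E) 𝓘(ℝ, E) (fun y : M ↦ l • y) x : E →L[ℝ] E) =
        ContinuousLinearMap.id ℝ E := by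
    intro k l hl hkl
    have d1 : HasMFDerivAt 𝓘(ℝ, E) 𝓘(ℝ, E) (fun y : M ↦ k • y) (l • x)
      (mfderiv 𝓘(ℝ, E) 𝓘(ℝ, E) (fun y : M ↦ k • y) x : E →L[ℝ] E) := by
      rw [hl]; exact dA k
    have d2 := (HasMFDerivAt.comp x d1 (dA l)).congr_of_eventuallyEq (f₁ := id)
      (Eventually.of_forall fun y ↦ by simp [smul_smul, hkl])
    have d3 := hasMFDerivAt_unique d2 (hasMFDerivAt_id x)
    exact d3
  have hinv : A.inverse = B := ContinuousLinearMap.inverse_eq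
    (comp g g⁻¹ hg' (mul_inv_cancel g)) (comp g⁻¹ g hg (inv_mul_cancel g))
  have hqe : q = pullbackSection (fun y : M ↦ g • y) σ x := by
    refine Prod.ext ?_ (ContinuousLinearMap.ext fun w ↦ ?_)
    · rw [hq₁]
      refine (congrArg B (h9 _ hg).1).symm.trans ?_
      exact (congrArg (fun T : E →L[ℝ] E ↦ T ((σ (g • x)).1 : E)) hinv).symm
    · exact (hq₂ w).trans ((h9 _ hg).2 _).symm
  rw [hqe]
  exact h1

/-- Since `D x` is its own orthogonal, membership is tested by pairing with each `p'` in `D x`. Only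
scalar identities then need averaging, and `hT` states exactly that `T` is such an average. -/
theorem mem_of_stabilizer_projection {G : Type*} [Group G] [MulAction G M] {D : Distribution E M}
    (hG : ∀ g : G, ContMDiff 𝓘(ℝ, E) 𝓘(ℝ, E) ∞ (fun x : M ↦ g • x))
    (hD : IsDiracStructure D) (hGD : IsCanonicalAction G D) {x : M} {T : E →L[ℝ] E}
    (hT : ∀ (v w : E) (α β : E →L[ℝ] ℝ),
      (∀ k ∈ MulAction.stabilizer G x,
        β ((mfderiv 𝓘(ℝ, E) 𝓘(ℝ, E) (fun y : M ↦ k⁻¹ • y) x : E →L[ℝ] E) v) +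
        α ((mfderiv 𝓘(ℝ, E) 𝓘(ℝ, E) (fun y : M ↦ k • y) x : E →L[ℝ] E) w) = 0) →
      β (T v) + α (T w) = 0)
    {p : PontryaginFiber E x} (hp : p ∈ D x) {q : PontryaginFiber E x} (hq₁ : q.1 = T p.1)
    (hq₂ : ∀ w : E, (q.2 : E → ℝ) w = (p.2 : E → ℝ) (T w)) : q ∈ D x := by
  rw [hD.isLagrangian]
  intro p' hp'
  have h1 := hT p.1 p'.1 p.2 p'.2 fun k hk ↦ by
    let q' : E × (E →L[ℝ] ℝ) :=
      ((mfderiv 𝓘(ℝ, E) 𝓘(ℝ, E) (fun y : M ↦ k⁻¹ • y) x : E →L[ℝ] E) p.1,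
        ContinuousLinearMap.comp (M₂ := E) p.2
          (mfderiv 𝓘(ℝ, E) 𝓘(ℝ, E) (fun y : M ↦ k • y) x : E →L[ℝ] E))
    have h2 : (q' : PontryaginFiber E x) ∈ D x :=
      mem_of_mem_of_stabilizer hG hD.isSmoothSubbundle hGD (MulAction.mem_stabilizer_iff.1 hk) hp
        rfl fun _ ↦ rfl
    exact (hD.isLagrangian x q').1 h2 p' hp'
  have h3 : (p'.2 : E → ℝ) q.1 = (p'.2 : E → ℝ) (T p.1) := congrArg _ hq₁
  exact (congrArg₂ (· + ·) h3 (hq₂ p'.1)).trans h1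

-- In the chart these points form the intersection of a ball with a linear subspace. That set is
-- convex, hence connected, so it stays in the component of `m`.
omit [ChartedSpace E M] [IsManifold 𝓘(ℝ, E) ∞ M] in
theorem isotropyType_inter_source_subset {G : Type*} [Group G] [MulAction G M] {H : Subgroup G}
    {Q : Set M} (hQ : IsConnectedComponentOf Q (isotropyType M H)) {m : M} (hm : m ∈ Q)
    {e : OpenPartialHomeomorph M E} {P : E →L[ℝ] E} {c : E} {ε : ℝ} (hme : m ∈ e.source)
    (he : e.target = Metric.ball c ε)
    (hP : ∀ x ∈ e.source, MulAction.stabilizer G x = MulAction.stabilizer G m ↔ P (e x) = e x) :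
    isotropyType M H ∩ e.source ⊆ Q := by
  obtain ⟨q, hq, rfl⟩ := hQ
  have hmH' : m ∈ isotropyType M H := connectedComponentIn_subset _ _ hm
  have hmH : MulAction.stabilizer G m = H := hmH'
  have hset : isotropyType M H ∩ e.source = e.symm '' (Metric.ball c ε ∩ {y | P y = y}) := by
    ext x
    constructor
    · rintro ⟨hx, hxe⟩
      exact ⟨e x, ⟨he ▸ e.map_source hxe, (hP x hxe).1 (Eq.trans hx hmH.symm)⟩, e.left_inv hxe⟩
    · rintro ⟨y, ⟨hy, hPy⟩, rfl⟩
      rw [← he] at hy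
      refine ⟨((hP _ (e.map_target hy)).2 ?_).trans hmH, e.map_target hy⟩
      rw [e.right_inv hy]; exact hPy
  have hconv : Convex ℝ {y | P y = y} := by
    intro x hx y hy a b _ _ _
    have hx' : P x = x := hx
    have hy' : P y = y := hy
    change P (a • x + b • y) = a • x + b • y
    rw [map_add, map_smul, map_smul, hx', hy']
  have hpre : IsPreconnected (isotropyType M H ∩ e.source) := by
    rw [hset]
    refine ((convex_ball c ε).inter hconv).isPreconnected.image _ ?_
    rw [← he]
    exact e.continuousOn_symm.mono inter_subset_left
  rw [connectedComponentIn_eq hm]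
  exact hpre.subset_connectedComponentIn ⟨hmH, hme⟩ inter_subset_left

end

section
open DiracGeometry

theorem exists_isInvariantRetraction
    {EG : Type*} [NormedAddCommGroup EG] [NormedSpace ℝ EG] [FiniteDimensional ℝ EG]
    {G : Type*} [TopologicalSpace G] [T2Space G] [ChartedSpace EG G] [Group G]
    [LieGroup 𝓘(ℝ, EG) ∞ G]
    {E : Type*} [NormedAddCommGroup E] [NormedSpace ℝ E] [FiniteDimensional ℝ E]
    {M : Type*} [TopologicalSpace M] [ChartedSpace E M] [IsManifold 𝓘(ℝ, E) ∞ M]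
    [MulAction G M] [ContMDiffSMul 𝓘(ℝ, EG) 𝓘(ℝ, E) ∞ G M] [ProperSMul G M]
    {D : Distribution E M} (hD : IsDiracStructure D) (hGD : IsCanonicalAction G D)
    {H : Subgroup G} {Q : Set M} (hQ : IsConnectedComponentOf Q (isotropyType M H))
    {F : Type*} [NormedAddCommGroup F] [NormedSpace ℝ F] [ChartedSpace F Q]
    [IsManifold 𝓘(ℝ, F) ∞ Q]
    (hj : Manifold.IsSmoothEmbedding 𝓘(ℝ, F) 𝓘(ℝ, E) ∞ (Subtype.val : Q → M)) (m : Q) :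
    ∃ (U : Set M) (r : M → Q), (m : M) ∈ U ∧
      IsInvariantRetraction (E := E) (F := F) (Subtype.val : Q → M) D U r := by
  classical
  have hG : ∀ g : G, ContMDiff 𝓘(ℝ, E) 𝓘(ℝ, E) ∞ (fun x : M ↦ g • x) := fun g ↦
    ContMDiffSMul.contMDiff_const_smul (I := 𝓘(ℝ, EG)) (I' := 𝓘(ℝ, E)) g
  obtain ⟨e, P, c, ε, he, hPP, hme, het, -, hP, hslice⟩ :=
    exists_slice_chart (EG := EG) (G := G) (E := E) (m : M)
  have hPP' : ∀ v, P (P v) = P v := fun v ↦ DFunLike.congr_fun hPP v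
  have hQH : ∀ x ∈ Q, MulAction.stabilizer G x = H := by
    obtain ⟨q, hq, rfl⟩ := hQ
    intro x hx
    have : x ∈ isotropyType M H := connectedComponentIn_subset _ _ hx
    exact this
  have hstab : ∀ x ∈ Q, MulAction.stabilizer G x = MulAction.stabilizer G (m : M) := fun x hx ↦
    (hQH x hx).trans (hQH m m.2).symm
  have hsub := isotropyType_inter_source_subset hQ m.2 hme het hP
  set U : Set M := e.source ∩ e ⁻¹' (P ⁻¹' e.target) with hU
  have hUo : IsOpen U := e.continuousOn.isOpen_inter_preimage e.open_source
    (e.open_target.preimage P.continuous)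
  set r₀ : M → M := fun x ↦ e.symm (P (e x)) with hr₀
  have hr₀Q : ∀ x ∈ U, r₀ x ∈ Q := by
    intro x hx
    have h1 : r₀ x ∈ e.source := e.map_target hx.2
    refine hsub ⟨((hP _ h1).2 ?_).trans (hQH m m.2), h1⟩
    simp only [hr₀]
    rw [e.right_inv hx.2, hPP']
  -- The value `m` is a default off the set where `r₀` lands in `Q`; on `U` it is never used.
  set r : M → Q := fun x ↦ if h : r₀ x ∈ Q then ⟨r₀ x, h⟩ else m with hr
  have hjr : ∀ x ∈ U, (r x : M) = r₀ x := by
    intro x hx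
    simp only [hr, dif_pos (hr₀Q x hx)]
  have hr₀s : ∀ x ∈ U, ContMDiffAt 𝓘(ℝ, E) 𝓘(ℝ, E) ∞ r₀ x := fun x hx ↦
    (contMDiffAt_symm_of_mem_maximalAtlas he hx.2).comp x
      ((P.contMDiff.contMDiffAt).comp x (contMDiffAt_of_mem_maximalAtlas he hx.1))
  have hjrs : ∀ x ∈ U, ContMDiffAt 𝓘(ℝ, E) 𝓘(ℝ, E) ∞ (Subtype.val ∘ r) x := fun x hx ↦
    (hr₀s x hx).congr_of_eventuallyEq (by filter_upwards [hUo.mem_nhds hx] with y hy using hjr y hy)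
  -- A continuous map into an immersed manifold is smooth as soon as its composite with the
  -- immersion is. Continuity into `Q` holds for the subspace topology.
  have hrs : ∀ x ∈ U, ContMDiffAt 𝓘(ℝ, E) 𝓘(ℝ, F) ∞ r x := fun x hx ↦
    (ContMDiffAt.iff_comp_isImmersionAt (hj.isImmersion.isImmersionAt (r x))).2
      ⟨(Topology.IsInducing.subtypeVal.continuousAt_iff).2 (hjrs x hx).continuousAt, hjrs x hx⟩
  have hfix : ∀ z : Q, (z : M) ∈ e.source → P (e z) = e z := fun z hz ↦
    (hP z hz).1 (hstab z z.2)
  refine ⟨U, r, ⟨hme, ?_⟩, hUo, fun x hx ↦ (hrs x hx).contMDiffWithinAt, fun z hz ↦ ?_,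
    fun z hz p hp q hq₁ hq₂ ↦ ?_⟩
  · rw [mem_preimage, mem_preimage, hfix m hme]
    exact e.map_source hme
  · refine Subtype.ext ((hjr z hz).trans ?_)
    simp only [hr₀, hfix z hz.1, e.left_inv hz.1]
  · set T : E →L[ℝ] E := mfderiv 𝓘(ℝ, E) 𝓘(ℝ, E) e (z : M) with hT
    set S : E →L[ℝ] E := mfderiv 𝓘(ℝ, E) 𝓘(ℝ, E) e.symm (e z) with hS
    have d1 : HasMFDerivAt 𝓘(ℝ, E) 𝓘(ℝ, E) r₀ (z : M) (S.comp (P.comp T)) := by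
      have a1 : HasMFDerivAt 𝓘(ℝ, E) 𝓘(ℝ, E) e (z : M) T :=
        ((contMDiffAt_of_mem_maximalAtlas he hz.1).mdifferentiableAt (by simp)).hasMFDerivAt
      have a2 : HasMFDerivAt 𝓘(ℝ, E) 𝓘(ℝ, E) P (e z) P := P.hasMFDerivAt
      have a3 : HasMFDerivAt 𝓘(ℝ, E) 𝓘(ℝ, E) e.symm (P (e z)) S := by
        rw [hfix z hz.1]
        exact ((contMDiffAt_symm_of_mem_maximalAtlas he (e.map_source hz.1)).mdifferentiableAt
          (by simp)).hasMFDerivAt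
      exact HasMFDerivAt.comp (z : M) a3 (HasMFDerivAt.comp (z : M) a2 a1)
    have hrz : r z = z := Subtype.ext ((hjr z hz).trans (by
      simp only [hr₀, hfix z hz.1, e.left_inv hz.1]))
    set R : E →L[ℝ] F := mfderiv 𝓘(ℝ, E) 𝓘(ℝ, F) r (z : M) with hR
    set i : F →L[ℝ] E := mfderiv 𝓘(ℝ, F) 𝓘(ℝ, E) (Subtype.val : Q → M) z with hi
    have d2 : HasMFDerivAt 𝓘(ℝ, E) 𝓘(ℝ, E) r₀ (z : M) (i.comp R) := by
      have a1 : HasMFDerivAt 𝓘(ℝ, E) 𝓘(ℝ, F) r (z : M) R :=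
        ((hrs z hz).mdifferentiableAt (by simp)).hasMFDerivAt
      have a2 : HasMFDerivAt 𝓘(ℝ, F) 𝓘(ℝ, E) (Subtype.val : Q → M) (r z) i := by
        rw [hrz]
        exact ((hj.contMDiff z).mdifferentiableAt (by simp)).hasMFDerivAt
      refine (HasMFDerivAt.comp (z : M) a2 a1).congr_of_eventuallyEq ?_
      filter_upwards [hUo.mem_nhds hz] with y hy using (hjr y hy).symm
    -- Both sides are the derivative at `z` of the same map `r₀`, once factored through `Q` and once
    -- through the chart.
    have key : ∀ v, i (R v) = S (P (T v)) := fun v ↦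
      DFunLike.congr_fun (hasMFDerivAt_unique d2 d1) v
    refine mem_of_stabilizer_projection (T := S.comp (P.comp T)) hG hD hGD ?_ hp
      (hq₁.trans (key _)) fun w ↦ (hq₂ w).trans (congrArg (p.2 : E → ℝ) (key w))
    intro v w α β h
    refine hslice z hz.1 (hstab z z.2) v w α β fun k hk ↦ h k ?_
    rw [hstab z z.2]
    exact hk

end

/-! ### The smooth structure on `Q` -/

theorem exists_continuousLinearMap_splitting {E : Type*} [NormedAddCommGroup E] [NormedSpace ℝ E]
    [FiniteDimensional ℝ E] {P : E →L[ℝ] E} (hP : ∀ v, P (P v) = P v) {k : ℕ}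
    (hk : Module.finrank ℝ (LinearMap.range (P : E →ₗ[ℝ] E)) = k) :
    ∃ (A : E →L[ℝ] EuclideanSpace ℝ (Fin k)) (B : EuclideanSpace ℝ (Fin k) →L[ℝ] E),
      (∀ u, A (B u) = u) ∧ ∀ v, B (A v) = P v := by
  have hfr : Module.finrank ℝ (LinearMap.range (P : E →ₗ[ℝ] E)) =
      Module.finrank ℝ (EuclideanSpace ℝ (Fin k)) := by rw [hk, finrank_euclideanSpace_fin]
  let L := LinearEquiv.ofFinrankEq _ _ hfr
  let A : E →ₗ[ℝ] EuclideanSpace ℝ (Fin k) := L.toLinearMap ∘ₗ (P : E →ₗ[ℝ] E).rangeRestrict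
  let B : EuclideanSpace ℝ (Fin k) →ₗ[ℝ] E := (LinearMap.range (P : E →ₗ[ℝ] E)).subtype ∘ₗ
    L.symm.toLinearMap
  refine ⟨LinearMap.toContinuousLinearMap A, LinearMap.toContinuousLinearMap B, fun u ↦ ?_,
    fun v ↦ ?_⟩
  · change L ((P : E →ₗ[ℝ] E).rangeRestrict (L.symm u : E)) = u
    rw [← LinearEquiv.eq_symm_apply]
    refine Subtype.ext ?_
    obtain ⟨w, hw⟩ := (L.symm u).2
    change P (L.symm u : E) = _
    rw [← hw]
    exact hP w
  · change ((L.symm (L ((P : E →ₗ[ℝ] E).rangeRestrict v)) : LinearMap.range (P : E →ₗ[ℝ] E)) : E) = _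
    rw [LinearEquiv.symm_apply_apply]
    rfl

theorem exists_prod_equiv_of_injective {K E : Type*} [NormedAddCommGroup K] [NormedSpace ℝ K]
    [FiniteDimensional ℝ K] [NormedAddCommGroup E] [NormedSpace ℝ E] [FiniteDimensional ℝ E]
    (B : K →L[ℝ] E) (hB : Function.Injective B) :
    ∃ Λ : (K × EuclideanSpace ℝ (Fin (Module.finrank ℝ E - Module.finrank ℝ K))) ≃L[ℝ] E,
      ∀ u, Λ (u, 0) = B u := by
  obtain ⟨W, hW⟩ := Submodule.exists_isCompl (LinearMap.range (B : K →ₗ[ℝ] E))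
  have h1 := Submodule.finrank_add_eq_of_isCompl hW
  have h2 : Module.finrank ℝ (LinearMap.range (B : K →ₗ[ℝ] E)) = Module.finrank ℝ K :=
    LinearMap.finrank_range_of_inj hB
  have h3 : Module.finrank ℝ (EuclideanSpace ℝ (Fin (Module.finrank ℝ E - Module.finrank ℝ K))) =
      Module.finrank ℝ W := by
    rw [finrank_euclideanSpace_fin]; omega
  let Λ := ((LinearEquiv.ofInjective (B : K →ₗ[ℝ] E) hB).prodCongr
    (LinearEquiv.ofFinrankEq _ _ h3)).trans (Submodule.prodEquivOfIsCompl _ _ hW)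
  refine ⟨Λ.toContinuousLinearEquiv, fun u ↦ ?_⟩
  change Λ (u, 0) = B u
  simp [Λ]

/-- The derivative of the change of charts is injective and maps the fixed space of `P` into that of
`P'`. Used in both directions, it makes the dimension of the slices locally constant along `Q`. -/
theorem finrank_range_le_of_slice {E : Type*} [NormedAddCommGroup E] [NormedSpace ℝ E]
    [FiniteDimensional ℝ E] {M : Type*} [TopologicalSpace M] [ChartedSpace E M]
    [IsManifold 𝓘(ℝ, E) ∞ M] {e e' : OpenPartialHomeomorph M E}
    (he : e ∈ IsManifold.maximalAtlas 𝓘(ℝ, E) ∞ M) (he' : e' ∈ IsManifold.maximalAtlas 𝓘(ℝ, E) ∞ M)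
    {P P' : E →L[ℝ] E} (hPP : ∀ v, P (P v) = P v) {x : M} (hx : x ∈ e.source)
    (hx' : x ∈ e'.source) (hPx : P (e x) = e x)
    (h : ∀ y ∈ e.source ∩ e'.source, P (e y) = e y → P' (e' y) = e' y) :
    Module.finrank ℝ (LinearMap.range (P : E →ₗ[ℝ] E)) ≤
      Module.finrank ℝ (LinearMap.range (P' : E →ₗ[ℝ] E)) := by
  set S : E →L[ℝ] E := mfderiv 𝓘(ℝ, E) 𝓘(ℝ, E) e.symm (e x) with hS
  set T : E →L[ℝ] E := mfderiv 𝓘(ℝ, E) 𝓘(ℝ, E) e' x with hT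
  have hSi : Function.Injective S := fun v w hvw ↦ by
    have h1 := mfderiv_comp_mfderiv_symm_of_mem_maximalAtlas he hx
    have h2 := DFunLike.congr_fun h1 v
    have h3 := DFunLike.congr_fun h1 w
    refine h2.symm.trans (Eq.trans ?_ h3)
    exact congrArg (mfderiv 𝓘(ℝ, E) 𝓘(ℝ, E) e x : E → E) hvw
  have hTi : Function.Injective T := fun v w hvw ↦ by
    have h1 := mfderiv_symm_comp_mfderiv_of_mem_maximalAtlas he' hx'
    have h2 := DFunLike.congr_fun h1 v
    have h3 := DFunLike.congr_fun h1 w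
    refine h2.symm.trans (Eq.trans ?_ h3)
    exact congrArg (mfderiv 𝓘(ℝ, E) 𝓘(ℝ, E) e'.symm (e' x) : E → E) hvw
  have dS : HasMFDerivAt 𝓘(ℝ, E) 𝓘(ℝ, E) e.symm (P (e x)) S := by
    rw [hPx]
    exact ((contMDiffAt_symm_of_mem_maximalAtlas he (e.map_source hx)).mdifferentiableAt
      (by simp)).hasMFDerivAt
  have hsx : e.symm (P (e x)) = x := by rw [hPx, e.left_inv hx]
  have dT : HasMFDerivAt 𝓘(ℝ, E) 𝓘(ℝ, E) e' (e.symm (P (e x))) T := by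
    rw [hsx]
    exact ((contMDiffAt_of_mem_maximalAtlas he' hx').mdifferentiableAt (by simp)).hasMFDerivAt
  have dP : HasMFDerivAt 𝓘(ℝ, E) 𝓘(ℝ, E) P (e x) P := P.hasMFDerivAt
  have d1 : HasMFDerivAt 𝓘(ℝ, E) 𝓘(ℝ, E) (fun u ↦ e' (e.symm (P u))) (e x)
      (T.comp (S.comp P)) := HasMFDerivAt.comp (e x) (g := e') (f := fun u ↦ e.symm (P u)) dT
        (HasMFDerivAt.comp (e x) dS dP)
  have d2 : HasMFDerivAt 𝓘(ℝ, E) 𝓘(ℝ, E) (fun u ↦ P' (e' (e.symm (P u)))) (e x)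
      (P'.comp (T.comp (S.comp P))) :=
    HasMFDerivAt.comp (e x) (g := P') (f := fun u ↦ e' (e.symm (P u))) P'.hasMFDerivAt d1
  have hc : ContinuousAt (fun u ↦ e.symm (P u)) (e x) :=
    ContinuousAt.comp dS.continuousAt dP.continuousAt
  -- On the slice the change of charts lands among the fixed points of `P'`, so composing with `P'`
  -- changes nothing. Differentiating puts the range of `T S P` inside that of `P'`.
  have hev : (fun u ↦ P' (e' (e.symm (P u)))) =ᶠ[𝓝 (e x)] fun u ↦ e' (e.symm (P u)) := by
    have h1 : ∀ᶠ u in 𝓝 (e x), P u ∈ e.target :=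
      dP.continuousAt (e.open_target.mem_nhds (by rw [hPx]; exact e.map_source hx))
    have h2 : ∀ᶠ u in 𝓝 (e x), e.symm (P u) ∈ e'.source :=
      hc (e'.open_source.mem_nhds (by show e.symm (P (e x)) ∈ _; rw [hsx]; exact hx'))
    filter_upwards [h1, h2] with u hu hu'
    exact h _ ⟨e.map_target hu, hu'⟩ (by rw [e.right_inv hu, hPP])
  have d3 := hasMFDerivAt_unique d2 (d1.congr_of_eventuallyEq hev)
  have d4 : ∀ v, P' (T (S (P v))) = T (S (P v)) := fun v ↦ DFunLike.congr_fun d3 v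
  have h5 : Submodule.map ((T.comp S : E →L[ℝ] E) : E →ₗ[ℝ] E) (LinearMap.range (P : E →ₗ[ℝ] E)) ≤
      LinearMap.range (P' : E →ₗ[ℝ] E) := by
    rintro _ ⟨_, ⟨v, rfl⟩, rfl⟩
    exact ⟨T (S (P v)), d4 v⟩
  refine le_trans (le_of_eq ?_) (Submodule.finrank_mono h5)
  have hTS : Function.Injective ((T.comp S : E →L[ℝ] E) : E →ₗ[ℝ] E) := fun v w h ↦ hSi (hTi h)
  exact (Submodule.equivMapOfInjective _ hTS _).finrank_eq

section
variable {E : Type*} [NormedAddCommGroup E] [NormedSpace ℝ E]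
  {M : Type*} [TopologicalSpace M]
  {K : Type*} [NormedAddCommGroup K] [NormedSpace ℝ K]

open Classical in
/-- The chart of a subset `Q` induced by a chart `e` of the ambient space in which `Q` is the
range of the projection `B ∘ A`. -/
noncomputable def sliceChart (Q : Set M) (e : OpenPartialHomeomorph M E) (A : E →L[ℝ] K)
    (B : K →L[ℝ] E) (hAB : ∀ u, A (B u) = u)
    (hQ : ∀ x ∈ e.source, x ∈ Q ↔ B (A (e x)) = e x) (q₀ : Q) : OpenPartialHomeomorph Q K where
  toFun q := A (e q)
  invFun u := if h : e.symm (B u) ∈ Q then ⟨e.symm (B u), h⟩ else q₀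
  source := Subtype.val ⁻¹' e.source
  target := B ⁻¹' e.target
  map_source' q hq := by
    rw [mem_preimage, (hQ q hq).1 q.2]
    exact e.map_source hq
  map_target' u hu := by
    have h : e.symm (B u) ∈ Q := (hQ _ (e.map_target hu)).2 (by rw [e.right_inv hu, hAB])
    rw [dif_pos h]
    exact e.map_target hu
  left_inv' q hq := by
    have h : e.symm (B (A (e q))) = q := by rw [(hQ q hq).1 q.2, e.left_inv hq]
    rw [dif_pos (by rw [h]; exact q.2)]
    exact Subtype.ext h
  right_inv' u hu := by
    have h : e.symm (B u) ∈ Q := (hQ _ (e.map_target hu)).2 (by rw [e.right_inv hu, hAB])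
    rw [dif_pos h]
    change A (e (e.symm (B u))) = u
    rw [e.right_inv hu, hAB]
  open_source := e.open_source.preimage continuous_subtype_val
  open_target := e.open_target.preimage B.continuous
  continuousOn_toFun := A.continuous.comp_continuousOn
    (e.continuousOn.comp continuous_subtype_val.continuousOn fun _ hq ↦ hq)
  continuousOn_invFun := by
    rw [Topology.IsInducing.subtypeVal.continuousOn_iff]
    refine (e.continuousOn_symm.comp B.continuous.continuousOn fun _ hu ↦ hu).congr fun u hu ↦ ?_
    have h : e.symm (B u) ∈ Q := (hQ _ (e.map_target hu)).2 (by rw [e.right_inv hu, hAB])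
    rw [Function.comp_apply, dif_pos h]
    rfl

theorem coe_sliceChart_symm {Q : Set M} {e : OpenPartialHomeomorph M E} {A : E →L[ℝ] K}
    {B : K →L[ℝ] E} (hAB : ∀ u, A (B u) = u)
    (hQ : ∀ x ∈ e.source, x ∈ Q ↔ B (A (e x)) = e x) (q₀ : Q) {u : K} (hu : B u ∈ e.target) :
    ((sliceChart Q e A B hAB hQ q₀).symm u : M) = e.symm (B u) := by
  have h : e.symm (B u) ∈ Q := (hQ _ (e.map_target hu)).2 (by rw [e.right_inv hu, hAB])
  exact congrArg Subtype.val (dif_pos h)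
end

section
open DiracGeometry

/-- A subset covered by smooth charts of the ambient manifold in which it is a linear subspace of
constant dimension is a smoothly embedded manifold. -/
theorem exists_isSmoothEmbedding_of_linear_charts {E : Type*} [NormedAddCommGroup E]
    [NormedSpace ℝ E] [FiniteDimensional ℝ E] {M : Type*} [TopologicalSpace M] [ChartedSpace E M]
    [IsManifold 𝓘(ℝ, E) ∞ M] {Q : Set M} (e : Q → OpenPartialHomeomorph M E) (P : Q → E →L[ℝ] E)
    (he : ∀ q, e q ∈ IsManifold.maximalAtlas 𝓘(ℝ, E) ∞ M) (hq : ∀ q : Q, (q : M) ∈ (e q).source)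
    (hPP : ∀ q v, P q (P q v) = P q v) {k : ℕ}
    (hk : ∀ q, Module.finrank ℝ (LinearMap.range (P q : E →ₗ[ℝ] E)) = k)
    (hP : ∀ q, ∀ x ∈ (e q).source, x ∈ Q ↔ P q (e q x) = e q x) :
    ∃ _ : ChartedSpace (EuclideanSpace ℝ (Fin k)) Q,
      IsManifold 𝓘(ℝ, EuclideanSpace ℝ (Fin k)) ∞ Q ∧
      Manifold.IsSmoothEmbedding 𝓘(ℝ, EuclideanSpace ℝ (Fin k)) 𝓘(ℝ, E) ∞
        (Subtype.val : Q → M) := by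
  choose A B hAB hBA using fun q ↦ exists_continuousLinearMap_splitting (hPP q) (hk q)
  have hQ : ∀ q, ∀ x ∈ (e q).source, x ∈ Q ↔ B q (A q (e q x)) = e q x := fun q x hx ↦ by
    rw [hBA]; exact hP q x hx
  set φ : Q → OpenPartialHomeomorph Q (EuclideanSpace ℝ (Fin k)) := fun q ↦
    sliceChart Q (e q) (A q) (B q) (hAB q) (hQ q) q with hφ
  have hsymm : ∀ q u, u ∈ (φ q).target → ((φ q).symm u : M) = (e q).symm (B q u) := fun q u hu ↦
    coe_sliceChart_symm (hAB q) (hQ q) q hu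
  let _ : ChartedSpace (EuclideanSpace ℝ (Fin k)) Q :=
    { atlas := range φ
      chartAt := φ
      mem_chart_source := hq
      chart_mem_atlas := fun q ↦ ⟨q, rfl⟩ }
  have hman : IsManifold 𝓘(ℝ, EuclideanSpace ℝ (Fin k)) ∞ Q := by
    refine isManifold_of_contDiffOn _ _ _ ?_
    rintro _ _ ⟨q, rfl⟩ ⟨q', rfl⟩
    intro u hu
    have hu1 : u ∈ (φ q).target := hu.1.1
    have hu1' : B q u ∈ (e q).target := hu1
    have hu2 : (e q).symm (B q u) ∈ (e q').source := by
      rw [← hsymm q u hu1]; exact hu.1.2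
    have h1 : ContMDiffAt 𝓘(ℝ, EuclideanSpace ℝ (Fin k)) 𝓘(ℝ, EuclideanSpace ℝ (Fin k)) ∞
        (fun w ↦ A q' (e q' ((e q).symm (B q w)))) u :=
      (A q').contMDiff.contMDiffAt.comp u
        (ContMDiffAt.comp u (g := e q') (f := fun w ↦ (e q).symm (B q w))
          (contMDiffAt_of_mem_maximalAtlas (he q') hu2)
          (ContMDiffAt.comp u (contMDiffAt_symm_of_mem_maximalAtlas (he q) hu1')
            (B q).contMDiff.contMDiffAt))
    refine (h1.contDiffAt.congr_of_eventuallyEq ?_).contDiffWithinAt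
    filter_upwards [(φ q).open_target.mem_nhds hu1] with w hw
    exact congrArg (fun x ↦ A q' (e q' x)) (hsymm q w hw)
  refine ⟨inferInstance, hman, ?_, Topology.IsEmbedding.subtypeVal⟩
  choose Λ hΛ using fun q ↦ exists_prod_equiv_of_injective (B q)
    (Function.LeftInverse.injective (hAB q))
  refine Manifold.IsImmersionOfComplement.isImmersion
    (F := EuclideanSpace ℝ (Fin (Module.finrank ℝ E -
      Module.finrank ℝ (EuclideanSpace ℝ (Fin k))))) fun q ↦ ?_
  -- In the slice chart on `Q` and the chart `e q` on `M` the inclusion is the linear map `B q`, and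
  -- `Λ q` displays it as `u ↦ (u, 0)`.
  refine Manifold.IsImmersionAtOfComplement.mk_of_continuousAt continuous_subtype_val.continuousAt
    (Λ q) (φ q) (e q) (hq q) (hq q) (IsManifold.chart_mem_maximalAtlas q) (he q) ?_
  intro u hu
  have hu1 : u ∈ (φ q).target := by simpa using hu
  have h2 : e q ((e q).symm (B q u)) = B q u := (e q).right_inv hu1
  refine (congrArg (e q) (hsymm q u hu1)).trans (h2.trans (hΛ q u).symm)

theorem exists_isSmoothEmbedding_of_isConnectedComponentOf
    {EG : Type*} [NormedAddCommGroup EG] [NormedSpace ℝ EG] [FiniteDimensional ℝ EG]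
    {G : Type*} [TopologicalSpace G] [T2Space G] [ChartedSpace EG G] [Group G]
    [LieGroup 𝓘(ℝ, EG) ∞ G]
    {E : Type*} [NormedAddCommGroup E] [NormedSpace ℝ E] [FiniteDimensional ℝ E]
    {M : Type*} [TopologicalSpace M] [ChartedSpace E M] [IsManifold 𝓘(ℝ, E) ∞ M]
    [MulAction G M] [ContMDiffSMul 𝓘(ℝ, EG) 𝓘(ℝ, E) ∞ G M] [ProperSMul G M]
    {H : Subgroup G} {Q : Set M} (hQ : IsConnectedComponentOf Q (isotropyType M H)) :
    ∃ (k : ℕ) (_ : ChartedSpace (EuclideanSpace ℝ (Fin k)) Q),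
      IsManifold 𝓘(ℝ, EuclideanSpace ℝ (Fin k)) ∞ Q ∧
      Manifold.IsSmoothEmbedding 𝓘(ℝ, EuclideanSpace ℝ (Fin k)) 𝓘(ℝ, E) ∞
        (Subtype.val : Q → M) := by
  choose e P c ε he hPP hm het _ hstab _ using fun q : Q ↦
    exists_slice_chart (EG := EG) (G := G) (E := E) (q : M)
  have hPP' : ∀ q v, P q (P q v) = P q v := fun q v ↦ DFunLike.congr_fun (hPP q) v
  have hQH : ∀ x ∈ Q, MulAction.stabilizer G x = H := by
    obtain ⟨q, hq, rfl⟩ := hQ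
    intro x hx
    have : x ∈ isotropyType M H := connectedComponentIn_subset _ _ hx
    exact this
  have hP : ∀ q, ∀ x ∈ (e q).source, x ∈ Q ↔ P q (e q x) = e q x := fun q x hx ↦
    ⟨fun h ↦ (hstab q x hx).1 ((hQH x h).trans (hQH q q.2).symm), fun h ↦
      isotropyType_inter_source_subset hQ q.2 (hm q) (het q) (hstab q)
        ⟨((hstab q x hx).2 h).trans (hQH q q.2), hx⟩⟩
  have hle : ∀ q q' : Q, (q' : M) ∈ (e q).source →
      Module.finrank ℝ (LinearMap.range (P q' : E →ₗ[ℝ] E)) =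
        Module.finrank ℝ (LinearMap.range (P q : E →ₗ[ℝ] E)) := fun q q' h ↦
    le_antisymm
      (finrank_range_le_of_slice (he q') (he q) (hPP' q') (hm q') h ((hP q' q' (hm q')).1 q'.2)
        fun y hy hy' ↦ (hP q y hy.2).1 ((hP q' y hy.1).2 hy'))
      (finrank_range_le_of_slice (he q) (he q') (hPP' q) h (hm q') ((hP q q' h).1 q'.2)
        fun y hy hy' ↦ (hP q' y hy.2).1 ((hP q y hy.1).2 hy'))
  -- Connectedness of `Q` enters here: a locally constant dimension becomes a single `k`.
  have hlc : IsLocallyConstant fun q ↦ Module.finrank ℝ (LinearMap.range (P q : E →ₗ[ℝ] E)) := by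
    rw [IsLocallyConstant.iff_eventually_eq]
    intro q
    filter_upwards [continuous_subtype_val.continuousAt.preimage_mem_nhds
      ((e q).open_source.mem_nhds (hm q))] with q' hq' using hle q q' hq'
  have hpre : PreconnectedSpace Q := by
    obtain ⟨q, hq, rfl⟩ := hQ
    exact Subtype.preconnectedSpace isPreconnected_connectedComponentIn
  obtain ⟨q₀, hq₀⟩ : Q.Nonempty := by
    obtain ⟨q, hq, rfl⟩ := hQ
    exact ⟨q, mem_connectedComponentIn hq⟩
  exact ⟨_, exists_isSmoothEmbedding_of_linear_charts e P he hm hPP'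
    (fun q ↦ hlc.apply_eq_of_preconnectedSpace q ⟨q₀, hq₀⟩) hP⟩

end

end

/-- The second half ranges over every smooth structure making the inclusion an embedding, so the
Dirac statements do not depend on the particular charts built for the first half. -/
theorem theorem4p1
    {EG : Type*} [NormedAddCommGroup EG] [NormedSpace ℝ EG] [FiniteDimensional ℝ EG]
    {G : Type*} [TopologicalSpace G] [T2Space G] [ChartedSpace EG G] [Group G]
    [LieGroup 𝓘(ℝ, EG) ∞ G]
    {E : Type*} [NormedAddCommGroup E] [NormedSpace ℝ E] [FiniteDimensional ℝ E]
    {M : Type*} [TopologicalSpace M] [T2Space M] [ParacompactSpace M] [ChartedSpace E M]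
    [IsManifold 𝓘(ℝ, E) ∞ M]
    [MulAction G M] [ContMDiffSMul 𝓘(ℝ, EG) 𝓘(ℝ, E) ∞ G M] [ProperSMul G M]
    (D : DiracGeometry.Distribution E M) (hD : DiracGeometry.IsDiracStructure D)
    (hGD : DiracGeometry.IsCanonicalAction G D)
    (H : Subgroup G) (Q : Set M)
    (hQ : DiracGeometry.IsConnectedComponentOf Q (DiracGeometry.isotropyType M H)) :
    (∃ (k : ℕ) (_ : ChartedSpace (EuclideanSpace ℝ (Fin k)) Q),
      IsManifold 𝓘(ℝ, EuclideanSpace ℝ (Fin k)) ∞ Q ∧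
      Manifold.IsSmoothEmbedding 𝓘(ℝ, EuclideanSpace ℝ (Fin k)) 𝓘(ℝ, E) ∞
        (Subtype.val : Q → M)) ∧
    ∀ (k : ℕ) [ChartedSpace (EuclideanSpace ℝ (Fin k)) Q]
      [IsManifold 𝓘(ℝ, EuclideanSpace ℝ (Fin k)) ∞ Q],
      Manifold.IsSmoothEmbedding 𝓘(ℝ, EuclideanSpace ℝ (Fin k)) 𝓘(ℝ, E) ∞
        (Subtype.val : Q → M) →
      DiracGeometry.IsDiracStructure
        (DiracGeometry.backwardImage (F := EuclideanSpace ℝ (Fin k)) (Subtype.val : Q → M) D) ∧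
      (DiracGeometry.IsIntegrable D → DiracGeometry.IsIntegrable
        (DiracGeometry.backwardImage (F := EuclideanSpace ℝ (Fin k)) (Subtype.val : Q → M) D)) := by
  refine ⟨exists_isSmoothEmbedding_of_isConnectedComponentOf (EG := EG) hQ, ?_⟩
  intro k _ _ hj
  have hr := exists_isInvariantRetraction (EG := EG) hD hGD hQ hj
  exact ⟨isDiracStructure_backwardImage hj.contMDiff hD hr, fun hI ↦
    isIntegrable_backwardImage hj.contMDiff hD.isSmoothSubbundle hI hr⟩
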